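/- Let $K\subset\mathbf{C}$ be an imaginary quadratic field of class number one and discriminant $-D_K$, with ring of integers $\mathcal{O}$ and inverse different $\mathcal{D}^{-1}=\frac{1}{\sqrt{-D_K}}\mathcal{O}$. Let $N\ge 1$ and $k\ge 1$ be integers with $\#\mathcal{O}^\times\mid k$, and write $e[x]=e^{2\pi i x}$. Let $\mathbf{H}_2=\{Z\in M_2(\mathbf{C}) : (Z-{}^t\overline{Z})/(2i)>0\}$, $J=\begin{pmatrix}0&-I_2\\ I_2&0\end{pmatrix}$, and let $\Gamma_0^{(2)}(N)$ be the group of $M=\begin{pmatrix}A&B\\ C&D\end{pmatrix}\in \mathrm{GL}_4(\mathcal{O})$ with ${}^t\overline{M}JM=J$ and $C\in N M_2(\mathcal{O})$. Let $\mathcal{M}_k(N)$ be the space of holomorphic $F:\mathbf{H}_2\to\mathbf{C}$ with $F((AZ+B)(CZ+D)^{-1})=\det(CZ+D)^kF(Z)$ for all such $M\in\Gamma_0^{(2)}(N)$. Let $\mathcal{S}$ be the set of matrices $\begin{pmatrix}\ell&t\\ \overline{t}&m\end{pmatrix}$ with $\ell,m\in\mathbf{Z}$, $t\in\mathcal{D}^{-1}$,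 and for $0\ne T\in\mathcal{S}$ put $\epsilon(T)=\max\{q\in\mathbf{Z}_{>0} : \frac1qT\in\mathcal{S}\}$. Each $F\in\mathcal{M}_k(N)$ has a Fourier expansion $F(Z)=\sum_{T\in\mathcal{S},\,T\ge0}C_F(T)\,e[\mathrm{tr}\,TZ]$. The Maass space $\mathcal{M}_k^*(N)$ consists of the $F\in\mathcal{M}_k(N)$ for which there is a function $\alpha_F^*:\mathbf{Z}_{\ge0}\to\mathbf{C}$ with $$C_F(T)=\sum_{d\mid\epsilon(T),\ \gcd(d,N)=1}d^{k-1}\alpha_F^*(D_K\det T/d^2)\qquad\text{for all } T\in\mathcal{S},\ T\ge0,\ T\ne0 .$$ The Fourier–Jacobi coefficients of $F$ are, for $\tau\in\mathbf{C}$ with $\mathrm{Im}\,\tau>0$ and $z,w\in\mathbf{C}$, $$\varphi_m(\tau,z,w)=\sum_{T=\begin{pmatrix}n&t\\ \overline{t}&m\end{pmatrix}\in\mathcal{S},\ T\ge0}C_F(T)\,e[n\tau+\overline{t}z+tw]\qquad(m\ge 0).$$ For a function $\varphi(\tau,z,w)$ and $S=\begin{pmatrix}a&b\\ c&d\end{pmatrix}\in\mathrm{GL}_2(\mathbf{R})$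 with $\det S>0$ put $$(\varphi|_{k,1}[S])(\tau,z,w)=\varphi\Big(\tfrac{a\tau+b}{c\tau+d},\tfrac{\sqrt{\det S}\,z}{c\tau+d},\tfrac{\sqrt{\det S}\,w}{c\tau+d}\Big)\,e\Big[-\tfrac{czw}{c\tau+d}\Big]\,(c\tau+d)^{-k}.$$ For $m\ge1$ let $\Delta_N(m)$ be the set of integral matrices $\begin{pmatrix}a&b\\ c&d\end{pmatrix}$ of determinant $m$ with $N\mid c$ and $\gcd(a,N)=1$. For $\varphi$ invariant under $|_{k,1}[\gamma]$ for all $\gamma\in\Gamma_0(N)\subset\mathrm{SL}_2(\mathbf{Z})$ (as $\varphi_1$ is), put $$V_m\varphi=m^{k-1}\sum_{g\in\Gamma_0(N)\backslash\Delta_N(m)}\varphi|_{k,1}[g].$$ Put also $$(V_0\varphi)(\tau,z,w)=c_\varphi(0,0)\Big(-\frac{B_k}{2k}\prod_{p\mid N}(1-p^{k-1})+\sum_{n\ge1}\ \sum_{d\mid n,\ \gcd(d,N)=1}d^{k-1}e[n\tau]\Big),$$ where $B_k$ is the $k$-th Bernoulli number and $c_\varphi(0,0)$ is the constant coefficient in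 the Fourier expansion $\varphi(\tau,z,w)=\sum_{\ell\ge 0,\,t\in\mathcal{D}^{-1}}c_\varphi(\ell,t)\,e[\ell\tau+\overline{t}z+tw]$. **Proposition.** Let $F\in\mathcal{M}_k^*(N)$. Then $F$ has the Fourier–Jacobi expansion $F\begin{pmatrix}\tau&z\\ w&\tau^*\end{pmatrix}=\sum_{m\ge0}\varphi_m(\tau,z,w)\,e[m\tau^*]$ on $\mathbf{H}_2$, and for all $\tau$ with $\mathrm{Im}\,\tau>0$ and all $z,w\in\mathbf{C}$ $$\varphi_m\Big(\tau,\frac{z}{\sqrt m},\frac{w}{\sqrt m}\Big)=(V_m\varphi_1)(\tau,z,w)\quad\text{for every } m\ge1,\qquad \varphi_0(\tau,z,w)=(V_0\varphi_1)(\tau,z,w).$$ In particular $F$ is uniquely determined by $\varphi_1$: if $F,G\in\mathcal{M}_k^*(N)$ have the same first Fourier–Jacobi coefficient, then $F=G$. -/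

import Mathlib

open scoped NumberField ComplexOrder MatrixGroups

noncomputable section

namespace HermitianMaass

/-- `e[z] = exp(2πiz)`. -/
def e (z : ℂ) : ℂ := Complex.exp (2 * Real.pi * Complex.I * z)

section Field

variable {K : Type*} [Field K] [NumberField K]

variable (K) in
/-- `D_K`, the absolute value of the discriminant of `K`
(so that the discriminant of an imaginary quadratic `K` is `-D_K`). -/
def absDisc : ℕ := (NumberField.discr K).natAbs

variable (K) in
/-- `√(-D_K) = i √D_K` as a complex number. -/
def sqrtNegDisc : ℂ := Complex.I * (Real.sqrt (absDisc K) : ℂ)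

/-- The ring of integers `𝒪` of `K`, seen inside `ℂ` through the embedding `σ`. When `K` is imaginary
quadratic, the nontrivial automorphism of `K` is the restriction of complex conjugation. -/
def integers (σ : K →+* ℂ) : Subring ℂ := (σ.comp (algebraMap (𝓞 K) K)).range

/-- The inverse different `𝒟⁻¹ = 𝒪 / √(-D_K)`, seen inside `ℂ`. -/
def inverseDifferent (σ : K →+* ℂ) : Set ℂ :=
  {t | ∃ a ∈ integers σ, t = a / sqrtNegDisc K}

variable (K) in
/-- `ω = (D_K + √(-D_K)) / 2`; for imaginary quadratic `K` one has `𝒪 = ℤ + ℤ ω`. -/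
def omega : ℂ := ((absDisc K : ℂ) + sqrtNegDisc K) / 2

/-- The group `Γ₀⁽²⁾(N)` of all `M = (A B; C D)` with entries in `𝒪` and `ᵗM̄ J M = J`, where
`J = (0 -1; 1 0)`, such that `C ∈ N M₂(𝒪)`. (Such an `M` is automatically invertible
over `𝒪`, with inverse `J⁻¹ ᵗM̄ J`.) -/
def hermitianGamma0 (σ : K →+* ℂ) (N : ℕ) : Set (Matrix (Fin 2 ⊕ Fin 2) (Fin 2 ⊕ Fin 2) ℂ) :=
  {M | (∀ i j, M i j ∈ integers σ) ∧
    M.conjTranspose * Matrix.J (Fin 2) ℂ * M = Matrix.J (Fin 2) ℂ ∧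
    ∀ i j, ∃ c ∈ integers σ, M.toBlocks₂₁ i j = (N : ℂ) * c}

/-- The Hermitian upper half space `{Z ∈ M₂(ℂ) | (Z - ᵗZ̄)/(2i) > 0}`. -/
def upperHalfSpace : Set (Matrix (Fin 2) (Fin 2) ℂ) :=
  {Z | ((2 * Complex.I)⁻¹ • (Z - Z.conjTranspose)).PosDef}

/-- `F ∈ 𝓜_k(N)`: Hermitian modular forms of weight `k` and level `N`. Only the values of `F` on the
upper half space matter. -/
structure IsHermitianModularForm (σ : K →+* ℂ) (k N : ℕ)
    (F : Matrix (Fin 2) (Fin 2) ℂ → ℂ) : Prop where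
  holo : DifferentiableOn ℂ F upperHalfSpace
  modular : ∀ M ∈ hermitianGamma0 σ N, ∀ Z ∈ upperHalfSpace,
    F ((M.toBlocks₁₁ * Z + M.toBlocks₁₂) * (M.toBlocks₂₁ * Z + M.toBlocks₂₂)⁻¹) =
      (M.toBlocks₂₁ * Z + M.toBlocks₂₂).det ^ k * F Z

/-- The lattice `𝓢` of Hermitian matrices `(ℓ t; t̄ m)` with `ℓ, m ∈ ℤ` and `t ∈ 𝒟⁻¹`, dual to the
lattice of Hermitian matrices with entries in `𝒪`. -/
def dualLattice (σ : K →+* ℂ) : Set (Matrix (Fin 2) (Fin 2) ℂ) :=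
  {T | ∃ l m : ℤ, ∃ t ∈ inverseDifferent σ, T = !![(l : ℂ), t; (starRingEnd ℂ) t, (m : ℂ)]}

/-- `ε(T) = max {q ∈ ℤ₊ | T / q ∈ 𝓢}` (used for `T ≠ 0` only). -/
def content (σ : K →+* ℂ) (T : Matrix (Fin 2) (Fin 2) ℂ) : ℕ :=
  sSup {q : ℕ | 0 < q ∧ (q : ℂ)⁻¹ • T ∈ dualLattice σ}

variable (K) in
/-- The Fourier coefficient `C_F(T)`: the integral of `F(X + iY) e[-tr T(X + iY)]` over the Hermitian
matrices `X = (x₁ u; ū x₂)` modulo those with entries in `𝒪`, normalised to total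
volume one, at `Y = 1`. Here `u = a + b ω` with `a, b ∈ [0,1]` runs over `ℂ / 𝒪`. -/
def fourierCoeff (F : Matrix (Fin 2) (Fin 2) ℂ → ℂ) (T : Matrix (Fin 2) (Fin 2) ℂ) : ℂ :=
  ∫ x₁ in (0 : ℝ)..1, ∫ x₂ in (0 : ℝ)..1, ∫ a in (0 : ℝ)..1, ∫ b in (0 : ℝ)..1,
    (fun Z : Matrix (Fin 2) (Fin 2) ℂ => F Z * e (-(T * Z).trace))
      !![(x₁ : ℂ) + Complex.I, (a : ℂ) + b * omega K;
         (a : ℂ) + b * (starRingEnd ℂ) (omega K), (x₂ : ℂ) + Complex.I]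

/-- `F ∈ 𝓜*_k(N)`: the Maass space. The number `D_K det T / d²` is a non-negative integer for every
`d ∣ ε(T)`, so the floor below only converts it to a natural number. -/
structure IsMaassForm (σ : K →+* ℂ) (k N : ℕ) (F : Matrix (Fin 2) (Fin 2) ℂ → ℂ) : Prop where
  modularForm : IsHermitianModularForm σ k N F
  maass : ∃ α : ℕ → ℂ, ∀ T ∈ dualLattice σ, T.PosSemidef → T ≠ 0 →
    fourierCoeff K F T =
      ∑ d ∈ (content σ T).divisors with d.Coprime N,
        (d : ℂ) ^ (k - 1) * α ⌊(absDisc K : ℝ) * T.det.re / (d : ℝ) ^ 2⌋₊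

/-- The `m`-th Fourier–Jacobi coefficient `φ_m(τ, z, w)` of `F`: the part of the Fourier expansion
`F(τ z; w τ*) = ∑ C_F(T) e[tr T (τ z; w τ*)]` over the `T ∈ 𝓢`, `T ≥ 0`, with lower right entry
`m`, with the factor `e[m τ*]` removed. -/
def fourierJacobiCoeff (σ : K →+* ℂ) (F : Matrix (Fin 2) (Fin 2) ℂ → ℂ) (m : ℕ)
    (τ z w : ℂ) : ℂ :=
  ∑' T : {T : Matrix (Fin 2) (Fin 2) ℂ // T ∈ dualLattice σ ∧ T.PosSemidef ∧ T 1 1 = (m : ℂ)},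
    fourierCoeff K F T.1 * e (T.1 0 0 * τ + T.1 1 0 * z + T.1 0 1 * w)

variable (K) in
/-- The constant Fourier coefficient `c_φ(0,0)` of a Jacobi form `φ(τ, z, w)`: the integral of `φ`
over `τ = x + i`, `x ∈ ℝ/ℤ`, and `(z, w) = (u, ū)`, `u = a + b ω ∈ ℂ / 𝒪`. -/
def jacobiConstCoeff (φ : ℂ → ℂ → ℂ → ℂ) : ℂ :=
  ∫ x in (0 : ℝ)..1, ∫ a in (0 : ℝ)..1, ∫ b in (0 : ℝ)..1,
    φ ((x : ℂ) + Complex.I) ((a : ℂ) + b * omega K) ((a : ℂ) + b * (starRingEnd ℂ) (omega K))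

variable (K) in
/-- The operator `V₀` of weight `k` and level `N`. -/
def V0 (k N : ℕ) (φ : ℂ → ℂ → ℂ → ℂ) (τ _z _w : ℂ) : ℂ :=
  jacobiConstCoeff K φ *
    (-((bernoulli k : ℚ) : ℂ) / (2 * (k : ℂ)) * ∏ p ∈ N.primeFactors, (1 - (p : ℂ) ^ (k - 1)) +
      ∑' n : ℕ+, (∑ d ∈ (n : ℕ).divisors with d.Coprime N, (d : ℂ) ^ (k - 1)) * e ((n : ℕ) * τ))

end Field

/-- The action `φ|_{k,t}[S]` of a real matrix `S` of positive determinant on functions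
`φ(τ, z, w)`, `τ` in the upper half plane, `z, w ∈ ℂ`. -/
def jacobiSlash (k t : ℕ) (S : Matrix (Fin 2) (Fin 2) ℝ) (φ : ℂ → ℂ → ℂ → ℂ) (τ z w : ℂ) : ℂ :=
  φ (((S 0 0 : ℂ) * τ + S 0 1) / ((S 1 0 : ℂ) * τ + S 1 1))
      ((Real.sqrt S.det : ℂ) * z / ((S 1 0 : ℂ) * τ + S 1 1))
      ((Real.sqrt S.det : ℂ) * w / ((S 1 0 : ℂ) * τ + S 1 1)) *
    e (-((t : ℂ) * S 1 0 * z * w / ((S 1 0 : ℂ) * τ + S 1 1))) *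
    (((S 1 0 : ℂ) * τ + S 1 1) ^ k)⁻¹

/-- `Δ_N(m)`: integral matrices `(a b; c d)` of determinant `m` with `N ∣ c` and `gcd(a, N) = 1`. -/
def heckeSet (N m : ℕ) : Set (Matrix (Fin 2) (Fin 2) ℤ) :=
  {g | (N : ℤ) ∣ g 1 0 ∧ g.det = (m : ℤ) ∧ Int.gcd (g 0 0) (N : ℤ) = 1}

/-- Two elements of `Δ_N(m)` are equivalent if they lie in the same left coset `Γ₀(N) g`. -/
def heckeSetoid (N m : ℕ) : Setoid (heckeSet N m) where
  r g h := ∃ γ ∈ CongruenceSubgroup.Gamma0 N, (γ : Matrix (Fin 2) (Fin 2) ℤ) * g.1 = h.1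
  iseqv :=
    { refl := fun g => ⟨1, one_mem _, by simp⟩
      symm := by
        rintro g h ⟨γ, hγ, hgh⟩
        refine ⟨γ⁻¹, inv_mem hγ, ?_⟩
        rw [← hgh, ← Matrix.mul_assoc, ← Matrix.SpecialLinearGroup.coe_mul]
        simp
      trans := by
        rintro g h l ⟨γ, hγ, hgh⟩ ⟨δ, hδ, hhl⟩
        refine ⟨δ * γ, mul_mem hδ hγ, ?_⟩
        rw [← hhl, ← hgh, Matrix.SpecialLinearGroup.coe_mul, Matrix.mul_assoc] }

/-- The operator `V_m` for `m ≥ 1`: `V_m φ = m^{k-1} ∑ φ|_{k,t}[g]`, the sum over `Γ₀(N) \ Δ_N(m)`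
(a finite set). By `jacobiSlash_mul_left` below the summand does not depend on the chosen
representative `g` of a coset when `φ` is invariant under `Γ₀(N)`. -/
def V (k t N m : ℕ) (φ : ℂ → ℂ → ℂ → ℂ) (τ z w : ℂ) : ℂ :=
  (m : ℂ) ^ (k - 1) *
    ∑ᶠ q : Quotient (heckeSetoid N m),
      jacobiSlash k t (q.out.1.map (Int.cast : ℤ → ℝ)) φ τ z w

theorem jacobiSlash_mul_left (k t : ℕ) (φ : ℂ → ℂ → ℂ → ℂ) (A S : Matrix (Fin 2) (Fin 2) ℝ)
    (hA : A.det = 1) (hS : 0 < S.det)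
    (hφ : ∀ τ z w : ℂ, 0 < τ.im → jacobiSlash k t A φ τ z w = φ τ z w)
    (τ z w : ℂ) (hτ : 0 < τ.im) :
    jacobiSlash k t (A * S) φ τ z w = jacobiSlash k t S φ τ z w := by
  have hdS : S.det = S 0 0 * S 1 1 - S 0 1 * S 1 0 := Matrix.det_fin_two S
  have hdA : (A 0 0 : ℂ) * A 1 1 - A 0 1 * A 1 0 = 1 := by
    rw [Matrix.det_fin_two] at hA
    exact_mod_cast hA
  have ne : ∀ (c d : ℝ) (x : ℂ), 0 < x.im → (c ≠ 0 ∨ d ≠ 0) → (c : ℂ) * x + d ≠ 0 := by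
    intro c d x hx hcd h
    have h1 := congrArg Complex.im h
    have h2 := congrArg Complex.re h
    simp at h1 h2
    rcases h1 with h1 | h1
    · subst h1
      simp at h2
      simp [h2] at hcd
    · exact hx.ne' h1
  have hj : (S 1 0 : ℂ) * τ + S 1 1 ≠ 0 := by
    apply ne _ _ _ hτ
    by_contra! h
    rw [hdS, h.1, h.2] at hS
    simp at hS
  set j : ℂ := (S 1 0 : ℂ) * τ + S 1 1 with hjdef
  set τ' : ℂ := ((S 0 0 : ℂ) * τ + S 0 1) / j with hτ'def
  have hτ' : 0 < τ'.im := by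
    have h1 : τ'.im = S.det * τ.im / Complex.normSq j := by
      have hn : Complex.normSq j ≠ 0 := fun h => hj (Complex.normSq_eq_zero.mp h)
      rw [hτ'def, Complex.div_im, hdS]
      simp only [hjdef, Complex.add_im, Complex.mul_im, Complex.ofReal_re, Complex.ofReal_im,
        Complex.add_re, Complex.mul_re]
      rw [← hjdef]
      field_simp
      ring
    rw [h1]
    exact div_pos (mul_pos hS hτ) (Complex.normSq_pos.mpr hj)
  have hj' : (A 1 0 : ℂ) * τ' + A 1 1 ≠ 0 := by
    apply ne _ _ _ hτ'
    by_contra! h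
    rw [Matrix.det_fin_two, h.1, h.2] at hA
    simp at hA
  have key := hφ τ' ((Real.sqrt S.det : ℂ) * z / j) ((Real.sqrt S.det : ℂ) * w / j) hτ'
  have hdet : (A * S).det = S.det := by rw [Matrix.det_mul, hA, one_mul]
  have e0 : ((A * S) 0 0 : ℂ) * τ + (A * S) 0 1 = (A 0 0 * τ' + A 0 1) * j := by
    simp only [Matrix.mul_apply, Fin.sum_univ_two, hτ'def]
    push_cast
    field_simp
    rw [hjdef]; ring
  have e1 : ((A * S) 1 0 : ℂ) * τ + (A * S) 1 1 = (A 1 0 * τ' + A 1 1) * j := by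
    simp only [Matrix.mul_apply, Fin.sum_univ_two, hτ'def]
    push_cast
    field_simp
    rw [hjdef]; ring
  set j' : ℂ := (A 1 0 : ℂ) * τ' + A 1 1 with hj'def
  have hsq : ((Real.sqrt S.det : ℝ) : ℂ) * Real.sqrt S.det
      = (S 0 0 : ℂ) * S 1 1 - S 0 1 * S 1 0 := by
    rw [← Complex.ofReal_mul, Real.mul_self_sqrt hS.le, hdS]
    push_cast
    ring
  have hexp : -((t : ℂ) * (A * S) 1 0 * z * w / (j' * j))
      = -((t : ℂ) * A 1 0 * ((Real.sqrt S.det : ℂ) * z / j) * ((Real.sqrt S.det : ℂ) * w / j) / j')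
        + -((t : ℂ) * S 1 0 * z * w / j) := by
    have h2 : ((A * S) 1 0 : ℂ) * j = A 1 0 * ((Real.sqrt S.det : ℂ) * Real.sqrt S.det)
        + S 1 0 * (j' * j) := by
      rw [← e1, hsq, hjdef]
      simp only [Matrix.mul_apply, Fin.sum_univ_two]
      push_cast
      ring
    have h3 : -((t : ℂ) * (A * S) 1 0 * z * w / (j' * j))
        = -((t : ℂ) * (((A * S) 1 0 : ℂ) * j) * z * w / (j' * j * j)) := by
      field_simp
    rw [h3, h2]
    field_simp
    ring
  have eadd : ∀ x y : ℂ, e (x + y) = e x * e y := by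
    intro x y
    rw [e, e, e, ← Complex.exp_add]
    ring_nf
  have hz : ∀ x : ℂ, (Real.sqrt S.det : ℂ) * x / (j' * j) = (Real.sqrt S.det : ℂ) * x / j / j' := by
    intro x
    field_simp
  unfold jacobiSlash
  unfold jacobiSlash at key
  rw [← hjdef, ← hτ'def, ← key, e0, e1, hdet, hexp, eadd, mul_div_mul_right _ _ hj, hz, hz, hA]
  simp only [Real.sqrt_one, Complex.ofReal_one, one_mul]
  rw [← hj'def, mul_pow, mul_inv]
  ring

end HermitianMaass

end

open HermitianMaass

/-! Translation invariance gives $F$ a Fourier expansion over $\mathcal{S}$, and Koecher's principle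
(`fourierCoeff_eq_zero_of_not_posSemidef`) removes every $T$ that is not positive semidefinite.
Grouping the absolutely convergent series by the lower right entry $m$ of $T$ yields the
Fourier–Jacobi expansion. Embedding $\Gamma_0(N)$ in $\Gamma_0^{(2)}(N)$ and comparing coefficients
of $e[m\tau^*]$ makes each $\varphi_m$ invariant under $\Gamma_0(N)$.

For $m\ge1$, the cosets $\Gamma_0(N)\backslash\Delta_N(m)$ are represented by
$\begin{pmatrix}a&b\\0&d\end{pmatrix}$ with $ad=m$, $\gcd(a,N)=1$ and $b$ modulo $d$. Summing over
$b$ keeps only the indices $(\ell,t)$ of $\varphi_1$ with $d\mid\ell$. Hence the coefficient of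
$V_m\varphi_1$ at $(n,t)$ is the sum of $a^{k-1}C_F\begin{pmatrix}mn/a^2&t/a\\ \overline
t/a&1\end{pmatrix}$ over the $a$ that divide $m$, $n$ and $t$ and are prime to $N$. A matrix with
lower right entry $1$ has content $1$, so its coefficient is a single value of $\alpha_F^*$, and the
sum is exactly the Maass relation for $C_F\begin{pmatrix}n&t\\ \overline t&m\end{pmatrix}$
(`IsMaassForm.fourierCoeff_dualVec`, `hasSum_sum_jacobiSlash`).

For $m=0$, semidefiniteness forces $t=0$, and the Maass relation gives all coefficients with $n\ge1$
as multiples of $\alpha_F^*(0)=c_{\varphi_1}(0,0)$. It says nothing about $C_F(0)$, which comes from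
modularity: subtracting the level $N$ Eisenstein series leaves a constant, and a nonzero constant
cannot transform with weight $k$ under $\tau\mapsto\tau/(N\tau+1)$ (`constantTerm_eq`). The weight
is even because $-1\in\mathcal{O}^\times$; weight two needs care, as $G_2$ is only quasimodular.

Thus every $\varphi_m$, and with it $F$, is recovered from $\varphi_1$. -/

open scoped NumberField ComplexOrder MatrixGroups
noncomputable section
namespace HermitianMaass
open MeasureTheory Set Filter Topology

/-! ### The exponential $e[x]$. -/

section Exponential

theorem e_add (x y : ℂ) : e (x + y) = e x * e y := by
  rw [e, e, e, ← Complex.exp_add]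
  ring_nf

theorem e_zero : e 0 = 1 := by simp [e]

theorem e_int (n : ℤ) : e n = 1 := by
  rw [e, mul_comm, Complex.exp_int_mul_two_pi_mul_I]

theorem norm_e (x : ℂ) : ‖e x‖ = Real.exp (-(2 * Real.pi * x.im)) := by
  rw [e, Complex.norm_exp]
  congr 1
  simp

theorem e_ne_zero (x : ℂ) : e x ≠ 0 := Complex.exp_ne_zero _

theorem e_natCast_mul (n : ℕ) (x : ℂ) : e (n * x) = e x ^ n := by
  rw [e, e, ← Complex.exp_nat_mul]
  ring_nf

theorem differentiable_e : Differentiable ℂ e := by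
  unfold e
  fun_prop

theorem continuous_e : Continuous e := differentiable_e.continuous

end Exponential

/-! ### Periodic functions on $\mathbf{R}^d$ and integration over the unit box. -/

section Torus

attribute [local instance] instMeasureSpaceUnitAddCircle

variable {d : ℕ}

/-- The half-open unit box in `ℝ^d`. -/
def unitBox (d : ℕ) : Set (Fin d → ℝ) := {x | ∀ i, x i ∈ Ioc (0 : ℝ) (0 + 1)}

theorem unitBox_subset : unitBox d ⊆ Icc 0 1 := fun x hx =>
  ⟨fun i => (hx i).1.le, fun i => by simpa using (hx i).2⟩

theorem measurableSet_unitBox : MeasurableSet (unitBox d) :=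
  MeasurableSet.univ_pi' fun _ => measurableSet_Ioc

theorem volume_unitBox : volume (unitBox d) = 1 := by
  have : unitBox d = Set.pi univ fun _ => Ioc (0 : ℝ) (0 + 1) := by
    ext x; simp [unitBox]
  rw [this, Real.volume_pi_Ioc]
  simp

/-- A continuous function on `ℝ^d` that is periodic under `ℤ^d` descends to the torus. -/
theorem exists_torus_lift (f : (Fin d → ℝ) → ℂ) (hf : Continuous f)
    (hper : ∀ (n : Fin d → ℤ) x, f (fun i => x i + n i) = f x) :
    ∃ g : C(UnitAddTorus (Fin d), ℂ), ∀ x : Fin d → ℝ,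
      g (fun i => (x i : UnitAddCircle)) = f x := by
  let π : (Fin d → ℝ) → UnitAddTorus (Fin d) := Pi.map fun _ x => (x : UnitAddCircle)
  have hπ : IsOpenQuotientMap π :=
    IsOpenQuotientMap.piMap fun _ => QuotientAddGroup.isOpenQuotientMap_mk
  have key : ∀ x y, π x = π y → f x = f y := by
    intro x y hxy
    have h : ∀ i, ∃ n : ℤ, y i + n = x i := by
      intro i
      have h1 : (x i : UnitAddCircle) = (y i : UnitAddCircle) := congrFun hxy i
      have h2 : ((x i - y i : ℝ) : UnitAddCircle) = 0 := by
        rw [AddCircle.coe_sub, h1, sub_self]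
      obtain ⟨n, hn⟩ := (AddCircle.coe_eq_zero_iff (1 : ℝ)).1 h2
      refine ⟨n, ?_⟩
      simp at hn
      linarith
    choose n hn using h
    rw [← hper n y]
    congr 1
    ext i
    exact (hn i).symm
  let πc : C(Fin d → ℝ, UnitAddTorus (Fin d)) := ⟨π, hπ.continuous⟩
  have hπc : IsQuotientMap πc := hπ.isQuotientMap
  let fc : C(Fin d → ℝ, ℂ) := ⟨f, hf⟩
  have hfc : Function.FactorsThrough fc πc := fun x y h => key x y h
  exact ⟨hπc.lift fc hfc, fun x =>
    congrArg (fun h : C(Fin d → ℝ, ℂ) => h x) (hπc.lift_comp fc hfc)⟩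

theorem integral_torus_eq (g : UnitAddTorus (Fin d) → ℂ) :
    ∫ t, g t = ∫ x in unitBox d, g (fun i => (x i : UnitAddCircle)) :=
  UnitAddTorus.integral_preimage g 0

/-- On the torus this is the translation invariance of Haar measure. -/
theorem setIntegral_unitBox_add (f : (Fin d → ℝ) → ℂ) (hf : Continuous f)
    (hper : ∀ (n : Fin d → ℤ) x, f (fun i => x i + n i) = f x) (a : Fin d → ℝ) :
    ∫ x in unitBox d, f (x + a) = ∫ x in unitBox d, f x := by
  obtain ⟨g, hg⟩ := exists_torus_lift f hf hper
  have h1 := integral_torus_eq (fun t => g (t + fun i => (a i : UnitAddCircle)))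
  have h2 := integral_torus_eq (fun t => g t)
  have : (volume : Measure UnitAddCircle).IsAddHaarMeasure :=
    inferInstanceAs (Measure.IsAddHaarMeasure AddCircle.haarAddCircle)
  rw [integral_add_right_eq_self (fun t => g t)] at h1
  rw [h1] at h2
  have h3 : ∀ x : Fin d → ℝ, g ((fun i => (x i : UnitAddCircle)) + fun i => (a i : UnitAddCircle))
      = f (x + a) := by
    intro x
    rw [← hg]
    rfl
  simp_rw [h3, hg] at h2
  exact h2

theorem summable_pi_prod {f : ℤ → ℝ} (hf : Summable f) (h0 : ∀ n, 0 ≤ f n) (d : ℕ) :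
    Summable fun n : Fin d → ℤ => ∏ i, f (n i) := by
  induction d with
  | zero => exact Summable.of_finite
  | succ d ih =>
    rw [← (Fin.consEquiv (fun _ : Fin (d + 1) => ℤ)).summable_iff]
    have := hf.mul_of_nonneg ih h0 (fun n => Finset.prod_nonneg fun i _ => h0 _)
    refine this.congr fun p => ?_
    simp [Fin.prod_univ_succ, Fin.consEquiv]

theorem summable_exp_neg_abs {c : ℝ} (hc : 0 < c) :
    Summable fun n : ℤ => Real.exp (-(c * |(n : ℝ)|)) := by
  have h : Summable fun n : ℕ => Real.exp (-(c * n)) := by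
    refine (summable_geometric_of_lt_one (Real.exp_pos (-c)).le
      (Real.exp_lt_one_iff.2 (by linarith))).congr fun n => ?_
    rw [← Real.exp_nat_mul]
    ring_nf
  refine Summable.of_nat_of_neg ?_ ?_
  · simpa using h
  · simpa using h

end Torus

/-! ### Fourier expansion of periodic holomorphic functions on tube domains. -/

section Tube

attribute [local instance] instMeasureSpaceUnitAddCircle

variable {d : ℕ}

/-- The tube domain over a set of imaginary parts. -/
def tube (C : Set (Fin d → ℝ)) : Set (Fin d → ℂ) := {z | (fun i => (z i).im) ∈ C}

/-- The point `x + ζ v + i y`. -/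
def tubePoint (y v : Fin d → ℝ) (ζ : ℂ) (x : Fin d → ℝ) : Fin d → ℂ :=
  fun i => x i + ζ * v i + Complex.I * y i

theorem tubePoint_mem {C : Set (Fin d → ℝ)} {y v : Fin d → ℝ} {ζ : ℂ} {x : Fin d → ℝ} :
    tubePoint y v ζ x ∈ tube C ↔ (fun i => ζ.im * v i + y i) ∈ C := by
  simp [tubePoint, tube]

theorem continuous_tubePoint (y v : Fin d → ℝ) :
    Continuous fun p : ℂ × (Fin d → ℝ) => tubePoint y v p.1 p.2 := by
  unfold tubePoint
  fun_prop

theorem differentiable_tubePoint (y v x : Fin d → ℝ) :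
    Differentiable ℂ fun ζ : ℂ => tubePoint y v ζ x := by
  unfold tubePoint
  fun_prop

theorem integrableOn_unitBox {f : (Fin d → ℝ) → ℂ} (hf : Continuous f) :
    IntegrableOn f (unitBox d) :=
  (hf.continuousOn.integrableOn_compact isCompact_Icc).mono_set unitBox_subset

variable {C : Set (Fin d → ℝ)} {H : (Fin d → ℂ) → ℂ}

/-- Differentiation under the integral sign. The dominating constant is a Cauchy estimate from a
bound for $H$ on a compact set. -/
theorem differentiableOn_setIntegral_tubePoint (hC : IsOpen C)
    (hH : DifferentiableOn ℂ H (tube C)) (y v : Fin d → ℝ) :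
    DifferentiableOn ℂ (fun ζ => ∫ x in unitBox d, H (tubePoint y v ζ x))
      {ζ | (fun i => ζ.im * v i + y i) ∈ C} := by
  set S : Set ℂ := {ζ | (fun i => ζ.im * v i + y i) ∈ C} with hS
  have hSo : IsOpen S := hC.preimage (by fun_prop)
  intro ζ₀ hζ₀
  obtain ⟨r, hr, hball⟩ := Metric.isOpen_iff.1 hSo ζ₀ hζ₀
  have hcl : Metric.closedBall ζ₀ (r / 2) ⊆ S :=
    (Metric.closedBall_subset_ball (by linarith)).trans hball
  have hcont : ∀ ζ ∈ S, Continuous fun x => H (tubePoint y v ζ x) := by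
    intro ζ hζ
    refine hH.continuousOn.comp_continuous
      ((continuous_tubePoint y v).comp (by fun_prop : Continuous fun x => (ζ, x))) fun x => ?_
    exact tubePoint_mem.2 hζ
  have hdiff : ∀ x, DifferentiableOn ℂ (fun ζ => H (tubePoint y v ζ x)) S := by
    intro x
    exact hH.comp (differentiable_tubePoint y v x).differentiableOn
      fun ζ hζ => tubePoint_mem.2 hζ
  obtain ⟨M, hM⟩ : ∃ M, ∀ p ∈ Metric.closedBall ζ₀ (r / 2) ×ˢ Icc (0 : Fin d → ℝ) 1,
      ‖H (tubePoint y v p.1 p.2)‖ ≤ M := by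
    refine ((isCompact_closedBall ζ₀ (r / 2)).prod isCompact_Icc).exists_bound_of_continuousOn ?_
    refine hH.continuousOn.comp (continuous_tubePoint y v).continuousOn ?_
    rintro ⟨ζ, x⟩ ⟨hζ, -⟩
    exact tubePoint_mem.2 (hcl hζ)
  have hderiv : ∀ x, ∀ ζ ∈ Metric.ball ζ₀ (r / 4),
      HasDerivAt (fun ζ => H (tubePoint y v ζ x)) (deriv (fun ζ => H (tubePoint y v ζ x)) ζ) ζ := by
    intro x ζ hζ
    have hζS : ζ ∈ S := hcl (Metric.ball_subset_closedBall.trans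
      (Metric.closedBall_subset_closedBall (by linarith)) hζ)
    exact ((hdiff x).differentiableAt (hSo.mem_nhds hζS)).hasDerivAt
  have hmeas : AEStronglyMeasurable (fun x => deriv (fun ζ => H (tubePoint y v ζ x)) ζ₀)
      (volume.restrict (unitBox d)) := by
    -- The derivative is measurable in $x$ as a pointwise limit of difference quotients along this
    -- null sequence, each of which is continuous in $x$.
    let u : ℕ → ℂ := fun n => ((r / 4 : ℝ) : ℂ) * ((n : ℂ) + 1)⁻¹
    have hu0 : ∀ n, u n ≠ 0 := fun n =>
      mul_ne_zero (by exact_mod_cast (by positivity : r / 4 ≠ 0))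
        (inv_ne_zero (by exact_mod_cast n.succ_ne_zero))
    have hu : Tendsto u atTop (𝓝 0) := by
      have := (tendsto_one_div_add_atTop_nhds_zero_nat (𝕜 := ℂ)).const_mul ((r / 4 : ℝ) : ℂ)
      simpa [u, one_div] using this
    have hut : Tendsto u atTop (𝓝[≠] 0) :=
      tendsto_nhdsWithin_iff.2 ⟨hu, Eventually.of_forall hu0⟩
    have huS : ∀ᶠ n in atTop, ζ₀ + u n ∈ S := by
      have : Tendsto (fun n => ζ₀ + u n) atTop (𝓝 ζ₀) := by simpa using hu.const_add ζ₀
      exact this.eventually (hSo.mem_nhds hζ₀)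
    obtain ⟨n₀, hn₀⟩ := eventually_atTop.1 huS
    refine aestronglyMeasurable_of_tendsto_ae atTop
      (f := fun n x => (u (n + n₀))⁻¹ • (H (tubePoint y v (ζ₀ + u (n + n₀)) x)
        - H (tubePoint y v ζ₀ x))) (fun n => ?_) (Eventually.of_forall fun x => ?_)
    · have h1 := hcont _ (hn₀ (n + n₀) (by omega))
      have h2 := hcont _ hζ₀
      exact ((h1.sub h2).const_smul ((u (n + n₀))⁻¹)).aestronglyMeasurable
    · have := (hasDerivAt_iff_tendsto_slope_zero.1
        (hderiv x ζ₀ (Metric.mem_ball_self (by linarith)))).comp hut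
      exact this.comp (tendsto_add_atTop_nat n₀)
  have := hasDerivAt_integral_of_dominated_loc_of_deriv_le (μ := volume.restrict (unitBox d))
    (F := fun ζ x => H (tubePoint y v ζ x))
    (F' := fun ζ x => deriv (fun ζ => H (tubePoint y v ζ x)) ζ) (x₀ := ζ₀)
    (bound := fun _ => M / (r / 4)) (Metric.ball_mem_nhds ζ₀ (by linarith : 0 < r / 4))
    (by
      filter_upwards [hSo.mem_nhds hζ₀] with ζ hζ
      exact (hcont ζ hζ).aestronglyMeasurable)
    (integrableOn_unitBox (hcont ζ₀ hζ₀)) hmeas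
    (by
      refine (ae_restrict_iff' measurableSet_unitBox).2 (Eventually.of_forall fun x hx ζ hζ => ?_)
      refine Complex.norm_deriv_le_of_forall_mem_sphere_norm_le (by linarith) ?_ ?_
      · refine ((hdiff x).mono ?_).diffContOnCl
        rw [closure_ball _ (by linarith)]
        refine (Metric.closedBall_subset_closedBall' ?_).trans hcl
        rw [Metric.mem_ball] at hζ
        linarith
      · intro w hw
        refine hM (w, x) ⟨?_, unitBox_subset hx⟩
        rw [Metric.mem_sphere] at hw
        rw [Metric.mem_ball] at hζ
        rw [Metric.mem_closedBall]
        linarith [dist_triangle w ζ ζ₀])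
    (by
      have : IsFiniteMeasure (volume.restrict (unitBox d)) :=
        ⟨by simp [volume_unitBox]⟩
      exact integrable_const _)
    (Eventually.of_forall fun x ζ hζ => hderiv x ζ hζ)
  exact this.2.differentiableAt.differentiableWithinAt

/-- The mean of a periodic holomorphic function over the real directions does not depend on the
imaginary part. -/
theorem setIntegral_tube_eq (hC : IsOpen C) (hconv : Convex ℝ C)
    (hH : DifferentiableOn ℂ H (tube C))
    (hper : ∀ (n : Fin d → ℤ), ∀ z ∈ tube C, H (fun i => z i + n i) = H z)
    {y₀ y₁ : Fin d → ℝ} (h₀ : y₀ ∈ C) (h₁ : y₁ ∈ C) :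
    ∫ x in unitBox d, H (fun i => x i + Complex.I * y₀ i) =
      ∫ x in unitBox d, H (fun i => x i + Complex.I * y₁ i) := by
  set v : Fin d → ℝ := y₁ - y₀ with hv
  set S : Set ℂ := {ζ | (fun i => ζ.im * v i + y₀ i) ∈ C} with hS
  have hSo : IsOpen S := hC.preimage (by fun_prop)
  have hSc : Convex ℝ S := by
    intro a ha b hb s t hs ht hst
    have := hconv ha hb hs ht hst
    simp only [hS, mem_ofPred_eq] at this ⊢
    convert this using 2
    simp
    linear_combination (-(y₀ _)) * hst
  set A : ℂ → ℂ := fun ζ => ∫ x in unitBox d, H (tubePoint y₀ v ζ x) with hA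
  have hAd : DifferentiableOn ℂ A S := differentiableOn_setIntegral_tubePoint hC hH y₀ v
  have h0S : (0 : ℂ) ∈ S := by simpa [hS] using h₀
  have hIS : Complex.I ∈ S := by
    simp only [hS, mem_ofPred_eq, hv]
    convert h₁ using 2
    simp
  -- A real $\zeta$ only translates $x$ by $\zeta v$, which does not change the mean. Being
  -- holomorphic and constant on the reals, `A` is constant on the convex set `S`, and $\zeta=i$
  -- moves the height from `y₀` to `y₁`.
  have hreal : ∀ s : ℝ, A s = A 0 := by
    intro s
    have hc : Continuous fun x => H (tubePoint y₀ v 0 x) := by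
      refine hH.continuousOn.comp_continuous
        ((continuous_tubePoint y₀ v).comp (by fun_prop : Continuous fun x => ((0 : ℂ), x)))
        fun x => ?_
      exact tubePoint_mem.2 h0S
    have := setIntegral_unitBox_add _ hc (fun n x => by
      have := hper n (tubePoint y₀ v 0 x) (tubePoint_mem.2 h0S)
      rw [← this]
      congr 1
      ext i
      simp [tubePoint]
      ring) (s • v)
    rw [hA]
    simp only
    rw [← this]
    congr 1
    ext x
    congr 1
    ext i
    simp [tubePoint]
  have hAn : AnalyticOnNhd ℂ A S := hAd.analyticOnNhd hSo
  have hconst : EqOn A (fun _ => A 0) S := by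
    refine hAn.eqOn_of_preconnected_of_frequently_eq analyticOnNhd_const
      hSc.isPreconnected h0S ?_
    have hut : Tendsto (fun n : ℕ => (((1 / ((n : ℝ) + 1) : ℝ)) : ℂ)) atTop (𝓝[≠] 0) := by
      refine tendsto_nhdsWithin_iff.2 ⟨?_, Eventually.of_forall fun n => ?_⟩
      · have := (Complex.continuous_ofReal.tendsto 0).comp
          (tendsto_one_div_add_atTop_nhds_zero_nat (𝕜 := ℝ))
        simpa [Function.comp_def] using this
      · simp only [mem_compl_iff, mem_singleton_iff, Complex.ofReal_eq_zero]
        positivity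
    refine hut.frequently (Eventually.frequently (Eventually.of_forall fun n => ?_))
    exact hreal _
  have := hconst hIS
  simp only [hA] at this
  rw [eq_comm]
  convert this using 4 with x x
  · ext i
    simp [tubePoint, hv]
    ring
  · ext i
    simp [tubePoint]

/-- Fourier expansion of a periodic holomorphic function on a tube domain. -/
theorem exists_fourier_expansion (hC : IsOpen C) (hconv : Convex ℝ C)
    (hH : DifferentiableOn ℂ H (tube C))
    (hper : ∀ (n : Fin d → ℤ), ∀ z ∈ tube C, H (fun i => z i + n i) = H z) :
    ∃ c : (Fin d → ℤ) → ℂ, ∀ z ∈ tube C,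
      Summable (fun n => ‖c n * e (∑ i, n i * z i)‖) ∧
      HasSum (fun n => c n * e (∑ i, n i * z i)) (H z) := by
  rcases C.eq_empty_or_nonempty with rfl | ⟨y₀, hy₀⟩
  · exact ⟨0, fun z hz => hz.elim⟩
  let G : (Fin d → ℤ) → (Fin d → ℂ) → ℂ := fun n z => H z * e (-∑ i, n i * z i)
  have hGd : ∀ n, DifferentiableOn ℂ (G n) (tube C) := by
    intro n
    refine hH.mul (Differentiable.differentiableOn ?_)
    exact differentiable_e.comp (by fun_prop)
  have hGper : ∀ n, ∀ (m : Fin d → ℤ), ∀ z ∈ tube C, G n (fun i => z i + m i) = G n z := by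
    intro n m z hz
    simp only [G, hper m z hz]
    congr 1
    have : -∑ i, (n i : ℂ) * (z i + m i) = -∑ i, (n i : ℂ) * z i + ((-∑ i, n i * m i : ℤ) : ℂ) := by
      push_cast
      rw [← neg_add, ← Finset.sum_add_distrib]
      congr 1
      exact Finset.sum_congr rfl fun i _ => by ring
    rw [this, e_add, e_int, mul_one]
  let c : (Fin d → ℤ) → ℂ := fun n => ∫ x in unitBox d, G n (fun i => x i + Complex.I * y₀ i)
  have hc : ∀ n, ∀ y ∈ C, c n = ∫ x in unitBox d, G n (fun i => x i + Complex.I * y i) :=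
    fun n y hy => setIntegral_tube_eq hC hconv (hGd n) (hGper n) hy₀ hy
  have hbound : ∀ y ∈ C, ∃ ε > 0, ∃ M : ℝ, ∀ n : Fin d → ℤ,
      ‖c n‖ * Real.exp (-(2 * Real.pi * ∑ i, n i * y i)) ≤
        M * ∏ i, Real.exp (-(2 * Real.pi * ε * |(n i : ℝ)|)) := by
    intro y hy
    obtain ⟨r, hr, hball⟩ := Metric.isOpen_iff.1 hC y hy
    have hcl : Metric.closedBall y (r / 2) ⊆ C :=
      (Metric.closedBall_subset_ball (by linarith)).trans hball
    obtain ⟨M, hM⟩ : ∃ M, ∀ p ∈ Metric.closedBall y (r / 2) ×ˢ Icc (0 : Fin d → ℝ) 1,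
        ‖H (fun i => p.2 i + Complex.I * p.1 i)‖ ≤ M := by
      refine ((isCompact_closedBall y (r / 2)).prod isCompact_Icc).exists_bound_of_continuousOn ?_
      refine hH.continuousOn.comp (by fun_prop) ?_
      rintro ⟨y', x⟩ ⟨hy', -⟩
      simpa [tube] using hcl hy'
    refine ⟨r / 2, by linarith, M, fun n => ?_⟩
    -- The coefficient may be computed at any height. Moving each coordinate against the sign of
    -- $n_i$ gains a factor $e^{-\pi r|n_i|}$, hence absolute convergence.
    let y' : Fin d → ℝ := fun i => y i - r / 2 * SignType.sign (n i : ℝ)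
    have hy' : y' ∈ Metric.closedBall y (r / 2) := by
      rw [Metric.mem_closedBall, dist_pi_le_iff (by linarith)]
      intro i
      rw [Real.dist_eq]
      simp only [y', sub_sub_cancel_left, abs_neg, abs_mul]
      rw [abs_of_pos (by linarith : 0 < r / 2)]
      have : |((SignType.sign (n i : ℝ) : SignType) : ℝ)| ≤ 1 := by
        rcases lt_trichotomy (n i : ℝ) 0 with h | h | h <;> simp [h]
      nlinarith
    have h1 : ‖c n‖ ≤ M * Real.exp (2 * Real.pi * ∑ i, n i * y' i) := by
      rw [hc n y' (hcl hy')]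
      have := norm_setIntegral_le_of_norm_le_const (μ := volume) (s := unitBox d)
        (C := M * Real.exp (2 * Real.pi * ∑ i, n i * y' i))
        (f := fun x => G n (fun i => x i + Complex.I * y' i)) (by simp [volume_unitBox])
        (fun x hx => by
          simp only [G, norm_mul, norm_e]
          refine mul_le_mul (hM (y', x) ⟨hy', unitBox_subset hx⟩) (le_of_eq ?_)
            (Real.exp_pos _).le ((norm_nonneg _).trans (hM (y', x) ⟨hy', unitBox_subset hx⟩))
          congr 1
          simp)
      simpa [Measure.real, volume_unitBox] using this
    calc ‖c n‖ * Real.exp (-(2 * Real.pi * ∑ i, n i * y i))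
        ≤ M * Real.exp (2 * Real.pi * ∑ i, n i * y' i) *
          Real.exp (-(2 * Real.pi * ∑ i, n i * y i)) := by gcongr
      _ = M * ∏ i, Real.exp (-(2 * Real.pi * (r / 2) * |(n i : ℝ)|)) := by
        rw [mul_assoc, ← Real.exp_add, ← Real.exp_sum]
        congr 2
        rw [Finset.mul_sum, Finset.mul_sum, ← Finset.sum_neg_distrib, ← Finset.sum_add_distrib]
        refine Finset.sum_congr rfl fun i _ => ?_
        simp only [y']
        rw [← self_mul_sign (n i : ℝ)]
        ring
  refine ⟨c, fun z hz => ?_⟩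
  set y : Fin d → ℝ := fun i => (z i).im with hy
  have hyC : y ∈ C := hz
  have hsum : Summable fun n => ‖c n * e (∑ i, n i * z i)‖ := by
    obtain ⟨ε, hε, M, hM⟩ := hbound y hyC
    refine Summable.of_nonneg_of_le (fun n => norm_nonneg _) (fun n => ?_)
      ((summable_pi_prod (summable_exp_neg_abs (c := 2 * Real.pi * ε) (by positivity))
        (fun n => (Real.exp_pos _).le) d).mul_left M)
    refine le_trans (le_of_eq ?_) (hM n)
    rw [norm_mul, norm_e]
    congr 3
    simp [hy]
  refine ⟨hsum, ?_⟩
  have hcont : Continuous fun x : Fin d → ℝ => H (fun i => x i + Complex.I * y i) :=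
    hH.continuousOn.comp_continuous (by fun_prop) fun x => by simpa [tube] using hyC
  obtain ⟨g, hg⟩ := exists_torus_lift _ hcont (fun n x => by
    rw [← hper n (fun i => (x i : ℂ) + Complex.I * y i) (by simpa [tube] using hyC)]
    congr 1
    ext i
    push_cast
    ring)
  have hmF : ∀ (n : Fin d → ℤ) (x : Fin d → ℝ),
      UnitAddTorus.mFourier n (fun i => (x i : UnitAddCircle)) = e (∑ i, n i * x i) := by
    intro n x
    simp only [UnitAddTorus.mFourier, ContinuousMap.coe_mk, fourier_coe_apply, e]
    rw [← Complex.exp_sum, Finset.mul_sum]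
    congr 1
    refine Finset.sum_congr rfl fun i _ => ?_
    push_cast
    ring
  have hcoef : ∀ n, UnitAddTorus.mFourierCoeff g n = c n * e (∑ i, n i * (Complex.I * y i)) := by
    intro n
    rw [UnitAddTorus.mFourierCoeff, integral_torus_eq, hc n y hyC, ← integral_mul_const]
    congr 1
    ext x
    rw [hmF, hg, smul_eq_mul]
    simp only [G]
    rw [mul_assoc, ← e_add, mul_comm]
    congr 2
    simp only [Pi.neg_apply, Int.cast_neg, neg_mul, Finset.sum_neg_distrib, mul_add,
      Finset.sum_add_distrib]
    ring
  have hterm : ∀ n (x : Fin d → ℝ), UnitAddTorus.mFourierCoeff g n •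
      UnitAddTorus.mFourier n (fun i => (x i : UnitAddCircle)) =
      c n * e (∑ i, n i * (x i + Complex.I * y i)) := by
    intro n x
    rw [hmF, hcoef, smul_eq_mul, mul_assoc, ← e_add]
    congr 2
    simp only [mul_add, Finset.sum_add_distrib]
    ring
  have hzz : ∀ i, ((z i).re : ℂ) + Complex.I * y i = z i := by
    intro i
    rw [hy, mul_comm]
    exact Complex.re_add_im _
  have hs' : Summable (UnitAddTorus.mFourierCoeff g) := by
    refine Summable.of_norm (hsum.congr fun n => ?_)
    rw [hcoef, norm_mul, norm_mul, norm_e, norm_e]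
    congr 3
    simp [hy]
  have := UnitAddTorus.hasSum_mFourier_series_apply_of_summable hs'
    (fun i => ((z i).re : UnitAddCircle))
  rw [hg] at this
  simp_rw [hzz] at this
  refine this.congr_fun fun n => ?_
  rw [hterm n fun i => (z i).re]
  simp_rw [hzz]

end Tube

/-! ### Arithmetic of the imaginary quadratic field. -/

section Field

variable {K : Type*} [Field K] [NumberField K]

theorem absDisc_pos : 0 < absDisc K := Int.natAbs_pos.2 (NumberField.discr_ne_zero K)

theorem sqrtNegDisc_sq : sqrtNegDisc K ^ 2 = -(absDisc K : ℂ) := by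
  rw [sqrtNegDisc, mul_pow, Complex.I_sq, ← Complex.ofReal_pow, Real.sq_sqrt (by positivity)]
  simp

theorem sqrtNegDisc_ne_zero : sqrtNegDisc K ≠ 0 := by
  intro h
  have h1 := sqrtNegDisc_sq (K := K)
  rw [h] at h1
  have h2 := absDisc_pos (K := K)
  simp at h1
  omega

theorem conj_sqrtNegDisc : (starRingEnd ℂ) (sqrtNegDisc K) = -sqrtNegDisc K := by
  simp [sqrtNegDisc]

theorem conj_omega : (starRingEnd ℂ) (omega K) = (absDisc K : ℂ) - omega K := by
  simp only [omega, map_div₀, map_add, conj_sqrtNegDisc, map_natCast, map_ofNat]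
  ring

theorem two_mul_omega : 2 * omega K = (absDisc K : ℂ) + sqrtNegDisc K := by
  rw [omega]; ring

theorem omega_im : (omega K).im = Real.sqrt (absDisc K) / 2 := by
  simp [omega, sqrtNegDisc]

theorem omega_im_pos : 0 < (omega K).im := by
  rw [omega_im]
  have := absDisc_pos (K := K)
  positivity

/-- The embedding $\sigma$ is not real, so $\sigma$ and $\overline\sigma$ are the two embeddings of
$K$. -/
theorem coe_algebraTrace_eq [NumberField.IsTotallyComplex K] (hK : Module.finrank ℚ K = 2)
    (σ : K →+* ℂ) (x : K) :
    ((Algebra.trace ℚ K x : ℚ) : ℂ) = σ x + (starRingEnd ℂ) (σ x) := by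
  classical
  let f : K →ₐ[ℚ] ℂ := σ.toRatAlgHom
  let g : K →ₐ[ℚ] ℂ := (NumberField.ComplexEmbedding.conjugate σ).toRatAlgHom
  have hfg : f ≠ g := by
    intro h
    have h1 : ∀ y, σ y = NumberField.ComplexEmbedding.conjugate σ y := fun y =>
      DFunLike.congr_fun h y
    have h2 := NumberField.IsTotallyComplex.isComplex (NumberField.InfinitePlace.mk σ)
    rw [NumberField.InfinitePlace.isComplex_mk_iff] at h2
    exact h2 (RingHom.ext fun y => (h1 y).symm)
  have hcard : Fintype.card (K →ₐ[ℚ] ℂ) = 2 := by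
    rw [AlgHom.card, hK]
  have huniv : (Finset.univ : Finset (K →ₐ[ℚ] ℂ)) = {f, g} := by
    symm
    rw [← Finset.card_eq_iff_eq_univ, Finset.card_pair hfg, hcard]
  have h := trace_eq_sum_embeddings (K := ℚ) (L := K) ℂ (x := x)
  rw [huniv, Finset.sum_pair hfg] at h
  exact h

/-- The ring of integers of an imaginary quadratic field has a `ℤ`-basis `1, θ`. -/
theorem exists_integers_basis [NumberField.IsTotallyComplex K] (hK : Module.finrank ℚ K = 2)
    (σ : K →+* ℂ) :
    ∃ θ ∈ integers σ, (∀ z ∈ integers σ, ∃ x y : ℤ, z = x + y * θ) ∧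
      (θ - (starRingEnd ℂ) θ) ^ 2 = (NumberField.discr K : ℂ) := by
  have hrank : Module.finrank ℤ (𝓞 K) = 2 := by rw [NumberField.RingOfIntegers.rank, hK]
  let b : Module.Basis (Fin 2) ℤ (𝓞 K) :=
    (NumberField.RingOfIntegers.basis K).reindex (Fintype.equivFinOfCardEq (by
      rw [← Module.finrank_eq_card_chooseBasisIndex, hrank]))
  let s : 𝓞 K →+* ℂ := σ.comp (algebraMap (𝓞 K) K)
  have hs : Function.Injective s :=
    σ.injective.comp (FaithfulSMul.algebraMap_injective (𝓞 K) K)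
  set β : Fin 2 → ℂ := fun i => s (b i) with hβ
  have hspan : ∀ z : 𝓞 K, s z = b.repr z 0 * β 0 + b.repr z 1 * β 1 := by
    intro z
    conv_lhs => rw [← b.sum_repr z]
    simp [Fin.sum_univ_two, hβ]
  have htr : ∀ x : 𝓞 K, ((Algebra.trace ℤ (𝓞 K) x : ℤ) : ℂ) = s x + (starRingEnd ℂ) (s x) := by
    intro x
    have := coe_algebraTrace_eq hK σ (x : K)
    rw [← Algebra.coe_trace_int] at this
    rw [← Rat.cast_intCast]
    exact this
  have hdisc : (NumberField.discr K : ℂ) =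
      (β 0 * (starRingEnd ℂ) (β 1) - β 1 * (starRingEnd ℂ) (β 0)) ^ 2 := by
    rw [← NumberField.discr_eq_discr K b, Algebra.discr_def, Matrix.det_fin_two]
    simp only [Algebra.traceMatrix_apply, Algebra.traceForm_apply]
    push_cast
    rw [htr, htr, htr, htr]
    simp only [map_mul]
    simp only [hβ]
    ring
  set p := b.repr 1 0 with hp
  set q := b.repr 1 1 with hq
  have hone : (1 : ℂ) = p * β 0 + q * β 1 := by rw [← hspan 1, map_one]
  -- A prime $r$ dividing both coordinates of $1$ would be a unit of $\mathcal{O}$, but its norm is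
  -- $r^2$.
  have hcop : IsCoprime p q := by
    rw [Int.isCoprime_iff_gcd_eq_one]
    by_contra hg
    obtain ⟨r, hr, hrg⟩ := Nat.exists_prime_and_dvd hg
    have hrp : (r : ℤ) ∣ p := (Int.natCast_dvd_natCast.2 hrg).trans (Int.gcd_dvd_left ..)
    have hrq : (r : ℤ) ∣ q := (Int.natCast_dvd_natCast.2 hrg).trans (Int.gcd_dvd_right ..)
    obtain ⟨p', hp'⟩ := hrp
    obtain ⟨q', hq'⟩ := hrq
    have h1 : (1 : 𝓞 K) = (r : 𝓞 K) * (p' • b 0 + q' • b 1) := by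
      apply hs
      rw [map_one, map_mul, map_add, map_zsmul, map_zsmul, map_natCast, hone, hp', hq']
      simp [hβ]
      ring
    have h2 : IsUnit ((r : ℤ) : 𝓞 K) := by
      rw [Int.cast_natCast]
      exact IsUnit.of_mul_eq_one _ h1.symm
    have h3 := (h2.map (Algebra.norm ℤ))
    rw [← eq_intCast (algebraMap ℤ (𝓞 K)), Algebra.norm_algebraMap, hrank, Int.isUnit_iff_natAbs_eq,
      Int.natAbs_pow, Int.natAbs_natCast] at h3
    have := hr.two_le
    nlinarith
  obtain ⟨x, y, hxy⟩ := hcop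
  have hxyC : (x : ℂ) * p + y * q = 1 := by exact_mod_cast hxy
  -- By Bézout, $1$ and $\theta$ arise from the basis by a matrix of determinant $xp+yq=1$.
  set θ : ℂ := -y * β 0 + x * β 1 with hθ
  refine ⟨θ, ⟨-y • b 0 + x • b 1, ?_⟩, ?_, ?_⟩
  · change s _ = _
    rw [map_add, map_zsmul, map_zsmul]
    simp [hθ, hβ]
  · rintro z ⟨w, rfl⟩
    refine ⟨b.repr w 0 * x + b.repr w 1 * y, b.repr w 0 * (-q) + b.repr w 1 * p, ?_⟩
    change s w = _
    rw [hspan w]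
    push_cast
    rw [hθ]
    linear_combination (-(b.repr w 0 : ℂ) * β 0 - (b.repr w 1 : ℂ) * β 1) * hxyC
      + ((b.repr w 0 : ℂ) * x + (b.repr w 1 : ℂ) * y) * (-hone)
  · rw [hdisc]
    have hone' := congrArg (starRingEnd ℂ) hone
    simp only [map_one, map_add, map_mul, map_intCast] at hone'
    have : θ - (starRingEnd ℂ) θ = -(β 0 * (starRingEnd ℂ) (β 1) - β 1 * (starRingEnd ℂ) (β 0)) := by
      have h3 : θ - (starRingEnd ℂ) θ = θ * 1 - 1 * (starRingEnd ℂ) θ := by ring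
      rw [h3]
      nth_rewrite 1 [hone']
      rw [hone, hθ]
      simp only [map_add, map_mul, map_neg, map_intCast]
      linear_combination -(β 0 * (starRingEnd ℂ) (β 1) - β 1 * (starRingEnd ℂ) (β 0)) * hxyC
    rw [this]
    ring

/-- `𝒪 = ℤ + ℤ ω`. -/
theorem mem_integers_iff [NumberField.IsTotallyComplex K] (hK : Module.finrank ℚ K = 2)
    (σ : K →+* ℂ) {z : ℂ} : z ∈ integers σ ↔ ∃ x y : ℤ, z = x + y * omega K := by
  obtain ⟨θ, hθ, hspan, hd⟩ := exists_integers_basis hK σ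
  obtain ⟨n, u, hu⟩ := hspan _ (mul_mem hθ hθ)
  have hu' := congrArg (starRingEnd ℂ) hu
  simp only [map_add, map_mul, map_intCast] at hu'
  have hne : θ - (starRingEnd ℂ) θ ≠ 0 := by
    intro h
    rw [h] at hd
    have := NumberField.discr_ne_zero K
    simp at hd
    exact this (by exact_mod_cast hd.symm)
  have htr : θ + (starRingEnd ℂ) θ = u := by
    apply mul_left_cancel₀ hne
    linear_combination hu - hu'
  -- The discriminant is the square of the purely imaginary number $\theta-\overline\theta$, hence
  -- not positive.
  have hneg : (NumberField.discr K : ℂ) = -(absDisc K : ℂ) := by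
    have h1 : (NumberField.discr K : ℝ) ≤ 0 := by
      have h2 : (θ - (starRingEnd ℂ) θ) ^ 2 = ((-(2 * θ.im) ^ 2 : ℝ) : ℂ) := by
        rw [Complex.sub_conj]
        push_cast
        rw [mul_pow, Complex.I_sq]
        ring
      rw [h2] at hd
      have h3 : -(2 * θ.im) ^ 2 = (NumberField.discr K : ℝ) := by exact_mod_cast hd
      rw [← h3]
      nlinarith [sq_nonneg (2 * θ.im)]
    have h2 : NumberField.discr K ≤ 0 := by exact_mod_cast h1
    have h3 : NumberField.discr K = -(absDisc K : ℤ) := by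
      rw [absDisc]; omega
    rw [h3]
    push_cast
    rfl
  rw [hneg] at hd
  have hsq := sqrtNegDisc_sq (K := K)
  have hDu : (absDisc K : ℂ) = -(u ^ 2 + 4 * n) := by
    have h1 : (θ - (starRingEnd ℂ) θ) ^ 2 = u ^ 2 + 4 * n := by
      rw [← htr]
      linear_combination (-4 * θ) * htr + 4 * hu
    rw [h1] at hd
    rw [hd, neg_neg]
  have hDu' : (absDisc K : ℤ) = -(u ^ 2 + 4 * n) := by exact_mod_cast hDu
  -- From $\theta^2=n+u\theta$ one gets $D_K=-(u^2+4n)\equiv u$ modulo $2$. This parity makes the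
  -- difference between $\omega$ and $\pm\theta$ an integer.
  have hpar : (2 : ℤ) ∣ (absDisc K : ℤ) - u := by
    have : Even ((absDisc K : ℤ) - u) := by
      rw [hDu']
      have h4 : -(u ^ 2 + 4 * n) - u = -(u * (u + 1)) + 2 * (-2 * n) := by ring
      rw [h4]
      exact (Int.even_mul_succ_self u).neg.add (even_two_mul _)
    exact this.two_dvd
  obtain ⟨v, hv⟩ := hpar
  have hvC : (absDisc K : ℂ) - u = 2 * v := by exact_mod_cast hv
  have hω := two_mul_omega (K := K)
  have hcases : omega K = θ + v ∨ omega K = -θ + (v + u : ℤ) := by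
    have h0 : (θ - (starRingEnd ℂ) θ - sqrtNegDisc K) *
        (θ - (starRingEnd ℂ) θ + sqrtNegDisc K) = 0 := by
      linear_combination hd - hsq
    rcases mul_eq_zero.1 h0 with h | h
    · left
      linear_combination hω / 2 + hvC / 2 - h / 2 - htr / 2
    · right
      push_cast
      linear_combination hω / 2 + hvC / 2 + h / 2 + htr / 2
  have hωm : omega K ∈ integers σ := by
    rcases hcases with h | h <;> rw [h]
    · exact add_mem hθ (intCast_mem _ _)
    · exact add_mem (neg_mem hθ) (intCast_mem _ _)
  constructor
  · intro hz
    obtain ⟨x, y, rfl⟩ := hspan z hz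
    rcases hcases with h | h
    · refine ⟨x - y * v, y, ?_⟩
      rw [h]; push_cast; ring
    · refine ⟨x + y * (v + u), -y, ?_⟩
      rw [h]; push_cast; ring
  · rintro ⟨x, y, rfl⟩
    exact add_mem (intCast_mem _ _) (mul_mem (intCast_mem _ _) hωm)

theorem even_of_card_units_dvd {k : ℕ} (hkO : Nat.card (𝓞 K)ˣ ∣ k) (hk : 0 < k) : Even k := by
  -- `Nat.card` of an infinite group is $0$, which does not divide the positive $k$.
  have hfin : Finite (𝓞 K)ˣ := by
    refine Nat.finite_of_card_ne_zero fun h => ?_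
    rw [h, zero_dvd_iff] at hkO
    omega
  have h1 : orderOf (-1 : (𝓞 K)ˣ) = 2 := by
    refine orderOf_eq_prime (by simp) fun h => ?_
    have h2 := congrArg Units.val h
    simp only [Units.val_neg, Units.val_one] at h2
    have h3 : (2 : 𝓞 K) = 0 := by linear_combination -h2
    exact two_ne_zero h3
  have h2 : 2 ∣ Nat.card (𝓞 K)ˣ := by
    rw [← h1]
    exact orderOf_dvd_natCard _
  exact (even_iff_two_dvd).2 (h2.trans hkO)

end Field

/-! ### Positivity of Hermitian $2\times2$ matrices. -/

section TwoByTwo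

theorem dotProduct_mulVec_hermitian (a d : ℝ) (b : ℂ) (v : Fin 2 → ℂ) :
    star v ⬝ᵥ (!![(a : ℂ), b; (starRingEnd ℂ) b, (d : ℂ)]).mulVec v =
      ((a * Complex.normSq (v 0) + d * Complex.normSq (v 1)
        + 2 * ((starRingEnd ℂ) (v 0) * b * v 1).re : ℝ) : ℂ) := by
  have h : ((2 * ((starRingEnd ℂ) (v 0) * b * v 1).re : ℝ) : ℂ) =
      (starRingEnd ℂ) (v 0) * b * v 1 + v 0 * (starRingEnd ℂ) b * (starRingEnd ℂ) (v 1) := by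
    have := Complex.add_conj ((starRingEnd ℂ) (v 0) * b * v 1)
    rw [← this]
    simp
  simp only [Matrix.mulVec, dotProduct, Fin.sum_univ_two, Pi.star_apply, RCLike.star_def]
  rw [Complex.ofReal_add, h]
  push_cast
  rw [Complex.normSq_eq_conj_mul_self, Complex.normSq_eq_conj_mul_self]
  simp
  ring

theorem isHermitian_fin_two (a d : ℝ) (b : ℂ) :
    (!![(a : ℂ), b; (starRingEnd ℂ) b, (d : ℂ)]).IsHermitian := by
  ext i j
  fin_cases i <;> fin_cases j <;> simp

theorem posSemidef_fin_two_iff {a d : ℝ} {b : ℂ} :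
    (!![(a : ℂ), b; (starRingEnd ℂ) b, (d : ℂ)]).PosSemidef ↔
      0 ≤ a ∧ 0 ≤ d ∧ Complex.normSq b ≤ a * d := by
  constructor
  · intro h
    refine ⟨?_, ?_, ?_⟩
    · simpa using h.diag_nonneg (i := 0)
    · simpa using h.diag_nonneg (i := 1)
    · have := h.det_nonneg
      rw [Matrix.det_fin_two_of, Complex.mul_conj, ← Complex.ofReal_mul, ← Complex.ofReal_sub,
        Complex.zero_le_real] at this
      linarith
  · rintro ⟨ha, hd, hb⟩
    refine Matrix.PosSemidef.of_dotProduct_mulVec_nonneg (isHermitian_fin_two a d b) fun v => ?_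
    rw [dotProduct_mulVec_hermitian, Complex.zero_le_real]
    rcases ha.eq_or_lt with rfl | ha
    · have : b = 0 := by
        rw [zero_mul] at hb
        exact Complex.normSq_eq_zero.1 (le_antisymm hb (Complex.normSq_nonneg _))
      subst this
      simp only [zero_mul, mul_zero, Complex.zero_re, add_zero, zero_add]
      exact mul_nonneg hd (Complex.normSq_nonneg _)
    · refine (mul_nonneg_iff_of_pos_left ha).1 ?_
      -- Completing the square. The excluded case $a=0$ forces $b=0$.
      have h1 : a * (a * Complex.normSq (v 0) + d * Complex.normSq (v 1)
          + 2 * ((starRingEnd ℂ) (v 0) * b * v 1).re) =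
          Complex.normSq (a * v 0 + b * v 1) + (a * d - Complex.normSq b) * Complex.normSq (v 1) := by
        rw [Complex.normSq_add]
        simp only [Complex.normSq_ofReal, map_mul, Complex.mul_re,
          Complex.mul_im, Complex.conj_re, Complex.conj_im, Complex.ofReal_re, Complex.ofReal_im]
        ring
      rw [h1]
      exact add_nonneg (Complex.normSq_nonneg _)
        (mul_nonneg (by linarith) (Complex.normSq_nonneg _))

theorem posDef_fin_two_iff {a d : ℝ} {b : ℂ} :
    (!![(a : ℂ), b; (starRingEnd ℂ) b, (d : ℂ)]).PosDef ↔
      0 < a ∧ Complex.normSq b < a * d := by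
  constructor
  · intro h
    refine ⟨?_, ?_⟩
    · simpa using h.diag_pos (i := 0)
    · have := h.det_pos
      rw [Matrix.det_fin_two_of, Complex.mul_conj, ← Complex.ofReal_mul, ← Complex.ofReal_sub,
        Complex.zero_lt_real] at this
      linarith
  · rintro ⟨ha, hb⟩
    refine Matrix.PosDef.of_dotProduct_mulVec_pos (isHermitian_fin_two a d b) fun v hv => ?_
    rw [dotProduct_mulVec_hermitian, Complex.zero_lt_real]
    refine pos_of_mul_pos_right (a := a) ?_ ha.le
    have h1 : a * (a * Complex.normSq (v 0) + d * Complex.normSq (v 1)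
        + 2 * ((starRingEnd ℂ) (v 0) * b * v 1).re) =
        Complex.normSq (a * v 0 + b * v 1) + (a * d - Complex.normSq b) * Complex.normSq (v 1) := by
      rw [Complex.normSq_add]
      simp only [Complex.normSq_ofReal, map_mul, Complex.mul_re,
        Complex.mul_im, Complex.conj_re, Complex.conj_im, Complex.ofReal_re, Complex.ofReal_im]
      ring
    rw [h1]
    by_cases h1 : v 1 = 0
    · have h0 : v 0 ≠ 0 := by
        intro h0
        apply hv
        ext i
        fin_cases i
        · exact h0
        · exact h1
      rw [h1]
      simp only [mul_zero, add_zero, Complex.normSq_zero]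
      exact Complex.normSq_pos.2 (mul_ne_zero (by exact_mod_cast ha.ne') h0)
    · exact add_pos_of_nonneg_of_pos (Complex.normSq_nonneg _)
        (mul_pos (by linarith) (Complex.normSq_pos.2 h1))

theorem mem_upperHalfSpace_iff {τ z w τ' : ℂ} :
    !![τ, z; w, τ'] ∈ upperHalfSpace ↔
      0 < τ.im ∧ Complex.normSq ((2 * Complex.I)⁻¹ * (z - (starRingEnd ℂ) w)) < τ.im * τ'.im := by
  rw [← posDef_fin_two_iff]
  change Matrix.PosDef _ ↔ _
  have hI : (2 * Complex.I) ≠ 0 := by simp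
  have : (2 * Complex.I)⁻¹ • (!![τ, z; w, τ'] - (!![τ, z; w, τ']).conjTranspose) =
      !![(τ.im : ℂ), (2 * Complex.I)⁻¹ * (z - (starRingEnd ℂ) w);
        (starRingEnd ℂ) ((2 * Complex.I)⁻¹ * (z - (starRingEnd ℂ) w)), (τ'.im : ℂ)] := by
    have him : ∀ x : ℂ, (2 * Complex.I)⁻¹ * (x - (starRingEnd ℂ) x) = x.im := by
      intro x
      rw [Complex.sub_conj]
      field_simp
      push_cast
      ring
    ext i j
    fin_cases i <;> fin_cases j
    · simpa using him τ
    · simp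
    · simp [Complex.conj_ofNat]
      ring
    · simpa using him τ'
  rw [this]

end TwoByTwo

/-! ### Integral coordinates on the half space and on the dual lattice. -/

section Coordinates

variable {K : Type*} [Field K] [NumberField K]

variable (K) in
/-- The matrix `(z₀, z₂ + z₃ ω; z₂ + z₃ ω̄, z₁)`. -/
def toMat (z : Fin 4 → ℂ) : Matrix (Fin 2) (Fin 2) ℂ :=
  !![z 0, z 2 + z 3 * omega K; z 2 + z 3 * (starRingEnd ℂ) (omega K), z 1]

variable (K) in
/-- The element `t` of the inverse different with `t + t̄ = p` and `t ω̄ + t̄ ω = q`. -/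
def dualEntry (p q : ℤ) : ℂ := (-q + p * omega K) / sqrtNegDisc K

variable (K) in
/-- The matrix `T` of the dual lattice with `tr (T Z) = ∑ nᵢ zᵢ` for `Z = toMat K z`. -/
def dualMat (n : Fin 4 → ℤ) : Matrix (Fin 2) (Fin 2) ℂ :=
  !![((n 0 : ℝ) : ℂ), dualEntry K (n 2) (n 3);
    (starRingEnd ℂ) (dualEntry K (n 2) (n 3)), ((n 1 : ℝ) : ℂ)]

theorem sqrtNegDisc_eq : sqrtNegDisc K = omega K - (starRingEnd ℂ) (omega K) := by
  rw [conj_omega]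
  linear_combination -two_mul_omega (K := K)

theorem dualEntry_add_conj (p q : ℤ) :
    dualEntry K p q + (starRingEnd ℂ) (dualEntry K p q) = p := by
  have h := sqrtNegDisc_ne_zero (K := K)
  simp only [dualEntry, map_div₀, map_add, map_neg, map_mul, map_intCast, conj_sqrtNegDisc]
  rw [div_neg, ← sub_eq_add_neg, ← sub_div, div_eq_iff h]
  linear_combination -(p : ℂ) * sqrtNegDisc_eq (K := K)

theorem dualEntry_mul_add_conj (p q : ℤ) :
    dualEntry K p q * (starRingEnd ℂ) (omega K) +
      (starRingEnd ℂ) (dualEntry K p q) * omega K = q := by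
  have h := sqrtNegDisc_ne_zero (K := K)
  simp only [dualEntry, map_div₀, map_add, map_neg, map_mul, map_intCast, conj_sqrtNegDisc]
  rw [div_neg, neg_mul, ← sub_eq_add_neg, div_mul_eq_mul_div, div_mul_eq_mul_div, ← sub_div,
    div_eq_iff h]
  linear_combination -(q : ℂ) * sqrtNegDisc_eq (K := K)

theorem dualEntry_mul (d p q : ℤ) : dualEntry K (d * p) (d * q) = d * dualEntry K p q := by
  simp only [dualEntry]
  push_cast
  ring

theorem mem_inverseDifferent_iff [NumberField.IsTotallyComplex K] (hK : Module.finrank ℚ K = 2)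
    (σ : K →+* ℂ) {t : ℂ} : t ∈ inverseDifferent σ ↔ ∃ p q : ℤ, t = dualEntry K p q := by
  constructor
  · rintro ⟨a, ha, rfl⟩
    obtain ⟨x, y, rfl⟩ := (mem_integers_iff hK σ).1 ha
    exact ⟨y, -x, by simp [dualEntry]⟩
  · rintro ⟨p, q, rfl⟩
    exact ⟨-q + p * omega K, (mem_integers_iff hK σ).2 ⟨-q, p, by simp⟩, rfl⟩

theorem mem_dualLattice_iff [NumberField.IsTotallyComplex K] (hK : Module.finrank ℚ K = 2)
    (σ : K →+* ℂ) {T : Matrix (Fin 2) (Fin 2) ℂ} :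
    T ∈ dualLattice σ ↔ ∃ n, T = dualMat K n := by
  constructor
  · rintro ⟨l, m, t, ht, rfl⟩
    obtain ⟨p, q, rfl⟩ := (mem_inverseDifferent_iff hK σ).1 ht
    exact ⟨![l, m, p, q], by simp [dualMat]⟩
  · rintro ⟨n, rfl⟩
    exact ⟨n 0, n 1, _, (mem_inverseDifferent_iff hK σ).2 ⟨n 2, n 3, rfl⟩, by simp [dualMat]⟩

/-- In these dual coordinates the Hermitian Fourier expansion becomes an ordinary Fourier series in
four variables. -/
theorem trace_dualMat_mul_toMat (n : Fin 4 → ℤ) (z : Fin 4 → ℂ) :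
    (dualMat K n * toMat K z).trace = ∑ i, n i * z i := by
  simp only [dualMat, toMat, Matrix.trace_fin_two, Matrix.mul_apply, Fin.sum_univ_two,
    Fin.sum_univ_four]
  simp
  linear_combination z 2 * dualEntry_add_conj (K := K) (n 2) (n 3) +
    z 3 * dualEntry_mul_add_conj (K := K) (n 2) (n 3)

theorem dualMat_injective : Function.Injective (dualMat K) := by
  intro n m h
  have h0 : dualEntry K (n 2) (n 3) = dualEntry K (m 2) (m 3) := congrFun (congrFun h 0) 1
  ext i
  fin_cases i
  · have := congrFun (congrFun h 0) 0
    simpa [dualMat] using this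
  · have := congrFun (congrFun h 1) 1
    simpa [dualMat] using this
  · have := dualEntry_add_conj (K := K) (n 2) (n 3)
    rw [h0, dualEntry_add_conj] at this
    exact_mod_cast this.symm
  · have := dualEntry_mul_add_conj (K := K) (n 2) (n 3)
    rw [h0, dualEntry_mul_add_conj] at this
    exact_mod_cast this.symm

theorem exists_toMat (M : Matrix (Fin 2) (Fin 2) ℂ) : ∃ z, toMat K z = M := by
  have h := sqrtNegDisc_ne_zero (K := K)
  have hs := sqrtNegDisc_eq (K := K)
  refine ⟨![M 0 0, M 1 1, M 0 1 - (M 0 1 - M 1 0) / sqrtNegDisc K * omega K,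
    (M 0 1 - M 1 0) / sqrtNegDisc K], ?_⟩
  ext i j
  fin_cases i <;> fin_cases j
  · simp [toMat]
  · simp [toMat]
  · simp only [toMat, Matrix.of_apply, Matrix.cons_val', Matrix.cons_val, Fin.mk_one, Fin.zero_eta]
    have h2 : (M 0 1 - M 1 0) / sqrtNegDisc K * (omega K - (starRingEnd ℂ) (omega K)) =
        M 0 1 - M 1 0 := by
      rw [← hs, div_mul_cancel₀ _ h]
    linear_combination -h2
  · simp [toMat]

variable (K) in
/-- The imaginary parts of the coordinates of points of the upper half space. -/
def posCone : Set (Fin 4 → ℝ) :=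
  {y | 0 < y 0 ∧ Complex.normSq (y 2 + y 3 * omega K) < y 0 * y 1}

theorem toMat_mem_upperHalfSpace_iff {z : Fin 4 → ℂ} :
    toMat K z ∈ upperHalfSpace ↔ z ∈ tube (posCone K) := by
  rw [toMat, mem_upperHalfSpace_iff, tube, posCone]
  simp only [mem_ofPred_eq]
  have : (2 * Complex.I)⁻¹ * (z 2 + z 3 * omega K -
      (starRingEnd ℂ) (z 2 + z 3 * (starRingEnd ℂ) (omega K))) =
      (z 2).im + (z 3).im * omega K := by
    have him : ∀ x : ℂ, x - (starRingEnd ℂ) x = 2 * Complex.I * x.im := by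
      intro x
      rw [Complex.sub_conj]
      push_cast
      ring
    have hI : (2 * Complex.I) ≠ 0 := by simp
    rw [inv_mul_eq_iff_eq_mul₀ hI]
    simp only [map_add, map_mul, Complex.conj_conj]
    linear_combination him (z 2) + omega K * him (z 3)
  rw [this]

theorem isOpen_posCone : IsOpen (posCone K) := by
  refine IsOpen.and ?_ ?_
  · exact isOpen_lt (by fun_prop) (by fun_prop)
  · exact isOpen_lt (Complex.continuous_normSq.comp (by fun_prop)) (by fun_prop)

theorem convex_posCone : Convex ℝ (posCone K) := by
  have hiff : ∀ y : Fin 4 → ℝ, y ∈ posCone K ↔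
      (!![(y 0 : ℂ), y 2 + y 3 * omega K; (starRingEnd ℂ) (y 2 + y 3 * omega K),
        (y 1 : ℂ)]).PosDef := fun y => posDef_fin_two_iff.symm
  intro x hx y hy a b ha hb hab
  rw [hiff] at hx hy ⊢
  have key : !![((a • x + b • y) 0 : ℂ), (a • x + b • y) 2 + (a • x + b • y) 3 * omega K;
      (starRingEnd ℂ) ((a • x + b • y) 2 + (a • x + b • y) 3 * omega K),
      ((a • x + b • y) 1 : ℂ)] =
      a • !![(x 0 : ℂ), x 2 + x 3 * omega K; (starRingEnd ℂ) (x 2 + x 3 * omega K), (x 1 : ℂ)] +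
      b • !![(y 0 : ℂ), y 2 + y 3 * omega K; (starRingEnd ℂ) (y 2 + y 3 * omega K), (y 1 : ℂ)] := by
    ext i j
    fin_cases i <;> fin_cases j <;> simp <;> ring
  rw [key]
  -- Weights equal to zero are split off because the scaling of positive definite matrices needs a
  -- positive scalar.
  rcases ha.eq_or_lt with rfl | ha
  · have : b = 1 := by linarith
    subst this
    simpa using hy
  · rcases hb.eq_or_lt with rfl | hb
    · have : a = 1 := by linarith
      subst this
      simpa using hx
    · exact (hx.smul ha).add (hy.smul hb)

end Coordinates

/-! ### Translations in $\Gamma_0^{(2)}(N)$ and the Fourier expansion of a modular form. -/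

section Modular

theorem fromBlocks_mem_hermitianGamma0 {K : Type*} [Field K] {σ : K →+* ℂ} {N : ℕ} {A B C D : Matrix (Fin 2) (Fin 2) ℂ}
    (hA : ∀ i j, A i j ∈ integers σ) (hB : ∀ i j, B i j ∈ integers σ)
    (hC : ∀ i j, ∃ c ∈ integers σ, C i j = (N : ℂ) * c) (hD : ∀ i j, D i j ∈ integers σ)
    (h1 : A.conjTranspose * C = C.conjTranspose * A)
    (h2 : A.conjTranspose * D - C.conjTranspose * B = 1)
    (h3 : B.conjTranspose * D = D.conjTranspose * B) :
    Matrix.fromBlocks A B C D ∈ hermitianGamma0 σ N := by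
  refine ⟨?_, ?_, ?_⟩
  · rintro (i | i) (j | j)
    · exact hA i j
    · exact hB i j
    · obtain ⟨c, hc, h⟩ := hC i j
      rw [Matrix.fromBlocks_apply₂₁, h]
      exact mul_mem (natCast_mem _ _) hc
    · exact hD i j
  · rw [Matrix.J, Matrix.fromBlocks_conjTranspose, Matrix.fromBlocks_multiply,
      Matrix.fromBlocks_multiply]
    have h2' : D.conjTranspose * A - B.conjTranspose * C = 1 := by
      have := congrArg Matrix.conjTranspose h2
      simpa using this
    congr 1
    · simp [h1]
    · simp only [mul_zero, mul_one, zero_add, mul_neg, add_zero, neg_mul]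
      rw [← h2]
      abel
    · simp only [mul_zero, mul_one, zero_add, mul_neg, add_zero, neg_mul]
      rw [← h2']
      abel
    · simp [h3]
  · intro i j
    simpa using hC i j

variable {K : Type*} [Field K] [NumberField K]

theorem IsHermitianModularForm.translate {σ : K →+* ℂ} {k N : ℕ}
    {F : Matrix (Fin 2) (Fin 2) ℂ → ℂ} (hF : IsHermitianModularForm σ k N F)
    {S : Matrix (Fin 2) (Fin 2) ℂ} (hS : S.IsHermitian) (hSi : ∀ i j, S i j ∈ integers σ)
    {Z : Matrix (Fin 2) (Fin 2) ℂ} (hZ : Z ∈ upperHalfSpace) : F (Z + S) = F Z := by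
  have h01 : ∀ i j, (1 : Matrix (Fin 2) (Fin 2) ℂ) i j ∈ integers σ := by
    intro i j
    rw [Matrix.one_apply]
    split_ifs
    · exact one_mem _
    · exact zero_mem _
  have hM : Matrix.fromBlocks 1 S 0 1 ∈ hermitianGamma0 σ N :=
    fromBlocks_mem_hermitianGamma0 h01 hSi (fun i j => ⟨0, zero_mem _, by simp⟩) h01
      (by simp) (by simp) (by simp [hS.eq])
  have := hF.modular _ hM Z hZ
  simpa using this

theorem conj_omega_mem_integers [NumberField.IsTotallyComplex K] (hK : Module.finrank ℚ K = 2)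
    (σ : K →+* ℂ) (x y : ℤ) : (x : ℂ) + y * (starRingEnd ℂ) (omega K) ∈ integers σ := by
  rw [conj_omega]
  exact (mem_integers_iff hK σ).2 ⟨x + y * absDisc K, -y, by push_cast; ring⟩

theorem IsHermitianModularForm.exists_fourier_expansion [NumberField.IsTotallyComplex K]
    (hK : Module.finrank ℚ K = 2) {σ : K →+* ℂ} {k N : ℕ}
    {F : Matrix (Fin 2) (Fin 2) ℂ → ℂ} (hF : IsHermitianModularForm σ k N F) :
    ∃ c : (Fin 4 → ℤ) → ℂ, ∀ z ∈ tube (posCone K),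
      Summable (fun n => ‖c n * e (∑ i, n i * z i)‖) ∧
      HasSum (fun n => c n * e (∑ i, n i * z i)) (F (toMat K z)) := by
  refine HermitianMaass.exists_fourier_expansion (H := fun z => F (toMat K z)) isOpen_posCone
    convex_posCone ?_ ?_
  · have h1 : DifferentiableOn ℂ (fun M : Fin 2 → Fin 2 → ℂ => F M)
      (upperHalfSpace : Set (Matrix (Fin 2) (Fin 2) ℂ)) := hF.holo
    have h2 : Differentiable ℂ
        (fun z i j => toMat K z i j : (Fin 4 → ℂ) → Fin 2 → Fin 2 → ℂ) := by
      rw [differentiable_pi]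
      intro i
      rw [differentiable_pi]
      intro j
      fin_cases i <;> fin_cases j <;> simp [toMat] <;> fun_prop
    exact h1.comp h2.differentiableOn fun z hz => toMat_mem_upperHalfSpace_iff.2 hz
  · intro n z hz
    have hS : (toMat K fun i => (n i : ℂ)).IsHermitian := by
      ext i j
      fin_cases i <;> fin_cases j <;> simp [toMat]
    have hSi : ∀ i j, (toMat K fun i => (n i : ℂ)) i j ∈ integers σ := by
      intro i j
      fin_cases i <;> fin_cases j
      · exact intCast_mem _ _
      · exact (mem_integers_iff hK σ).2 ⟨n 2, n 3, by simp [toMat]⟩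
      · have := conj_omega_mem_integers hK σ (n 2) (n 3)
        simpa [toMat] using this
      · exact intCast_mem _ _
    rw [← hF.translate hS hSi (toMat_mem_upperHalfSpace_iff.2 hz)]
    congr 1
    ext i j
    fin_cases i <;> fin_cases j <;> simp [toMat] <;> ring

end Modular

/-! ### Identification of the Fourier coefficients with integrals. -/

section Uniqueness

theorem integral_e (n : ℤ) : ∫ x in (0 : ℝ)..1, e (n * (x : ℂ)) = if n = 0 then 1 else 0 := by
  split_ifs with h
  · simp [h, e_zero]
  · have hc : (2 * Real.pi * Complex.I * n : ℂ) ≠ 0 := by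
      simp [h]
    have h1 : ∀ x : ℝ, e (n * (x : ℂ)) = Complex.exp ((2 * Real.pi * Complex.I * n : ℂ) * x) := by
      intro x
      rw [e]
      ring_nf
    simp_rw [h1]
    rw [integral_exp_mul_complex hc]
    have h2 : Complex.exp (2 * Real.pi * Complex.I * n * ((1 : ℝ) : ℂ)) = 1 := by
      have := e_int n
      rw [e] at this
      simpa using this
    rw [h2]
    simp

theorem norm_e_real (x : ℝ) : ‖e x‖ = 1 := by simp [norm_e]

theorem norm_e_int_mul (n : ℤ) (x : ℝ) : ‖e (n * (x : ℂ))‖ = 1 := by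
  have := norm_e_real (n * x)
  simpa using this

/-- Termwise integration of an absolutely convergent Fourier series over a period. -/
theorem integral_tsum_e {ι : Type*} [Countable ι] {c : ι → ℂ} (hc : Summable fun j => ‖c j‖)
    (n : ι → ℤ) :
    ∫ x in (0 : ℝ)..1, ∑' j, c j * e (n j * (x : ℂ)) = ∑' j, if n j = 0 then c j else 0 := by
  let f : ι → C(ℝ, ℂ) := fun j =>
    ⟨fun x => c j * e (n j * (x : ℂ)), by
      have := continuous_e
      fun_prop⟩
  have hf : Summable fun j => ‖(f j).restrict
      (⟨uIcc (0 : ℝ) 1, isCompact_uIcc⟩ : TopologicalSpace.Compacts ℝ)‖ := by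
    refine Summable.of_nonneg_of_le (fun _ => norm_nonneg _) (fun j => ?_) hc
    rw [ContinuousMap.norm_le _ (norm_nonneg _)]
    intro x
    change ‖c j * e (n j * ((x : ℝ) : ℂ))‖ ≤ _
    rw [norm_mul, norm_e_int_mul, mul_one]
  have := (intervalIntegral.hasSum_intervalIntegral_of_summable_norm hf).tsum_eq
  change ∑' j, ∫ x in (0 : ℝ)..1, c j * e (n j * (x : ℂ)) =
    ∫ x in (0 : ℝ)..1, ∑' j, c j * e (n j * (x : ℂ)) at this
  rw [← this]
  refine tsum_congr fun j => ?_
  rw [intervalIntegral.integral_const_mul, integral_e]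
  simp

theorem summable_norm_ite {ι : Type*} {c : ι → ℂ} (hc : Summable fun j => ‖c j‖) (n : ι → ℤ) :
    Summable fun j => ‖if n j = 0 then c j else 0‖ := by
  refine Summable.of_nonneg_of_le (fun _ => norm_nonneg _) (fun j => ?_) hc
  split_ifs <;> simp

theorem ite_mul_e {ι : Type*} (c : ι → ℂ) (n : ι → ℤ) (x : ι → ℂ) (j : ι) :
    (if n j = 0 then c j * x j else 0) = (if n j = 0 then c j else 0) * x j := by
  split_ifs <;> simp

theorem integral_tsum_e_two {ι : Type*} [Countable ι] {c : ι → ℂ} (hc : Summable fun j => ‖c j‖)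
    (n m : ι → ℤ) :
    ∫ x in (0 : ℝ)..1, ∫ y in (0 : ℝ)..1, ∑' j, c j * e (n j * (x : ℂ)) * e (m j * (y : ℂ)) =
      ∑' j, if n j = 0 then (if m j = 0 then c j else 0) else 0 := by
  rw [← integral_tsum_e (summable_norm_ite hc m) n]
  congr 1
  ext x
  rw [integral_tsum_e (c := fun j => c j * e (n j * (x : ℂ)))
    (by simpa [norm_e_int_mul] using hc)]
  exact tsum_congr fun j => ite_mul_e c m (fun j => e (n j * (x : ℂ))) j

theorem integral_tsum_e_three {ι : Type*} [Countable ι] {c : ι → ℂ}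
    (hc : Summable fun j => ‖c j‖) (l n m : ι → ℤ) :
    ∫ t in (0 : ℝ)..1, ∫ x in (0 : ℝ)..1, ∫ y in (0 : ℝ)..1,
      ∑' j, c j * e (l j * (t : ℂ)) * e (n j * (x : ℂ)) * e (m j * (y : ℂ)) =
      ∑' j, if l j = 0 then (if n j = 0 then (if m j = 0 then c j else 0) else 0) else 0 := by
  rw [← integral_tsum_e (summable_norm_ite (summable_norm_ite hc m) n) l]
  congr 1
  ext t
  rw [integral_tsum_e_two (c := fun j => c j * e (l j * (t : ℂ)))
    (by simpa [norm_e_int_mul] using hc)]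
  refine tsum_congr fun j => ?_
  split_ifs <;> simp

theorem integral_tsum_e_four {ι : Type*} [Countable ι] {c : ι → ℂ}
    (hc : Summable fun j => ‖c j‖) (r l n m : ι → ℤ) :
    ∫ s in (0 : ℝ)..1, ∫ t in (0 : ℝ)..1, ∫ x in (0 : ℝ)..1, ∫ y in (0 : ℝ)..1,
      ∑' j, c j * e (r j * (s : ℂ)) * e (l j * (t : ℂ)) * e (n j * (x : ℂ)) * e (m j * (y : ℂ)) =
      ∑' j, if r j = 0 then
        (if l j = 0 then (if n j = 0 then (if m j = 0 then c j else 0) else 0) else 0) else 0 := by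
  rw [← integral_tsum_e (summable_norm_ite (summable_norm_ite (summable_norm_ite hc m) n) l) r]
  congr 1
  ext s
  rw [integral_tsum_e_three (c := fun j => c j * e (r j * (s : ℂ)))
    (by simpa [norm_e_int_mul] using hc)]
  refine tsum_congr fun j => ?_
  split_ifs <;> simp

variable {K : Type*} [Field K] [NumberField K]

/-- Uniqueness of the Fourier expansion: it suffices to know the expansion at height `Y = 1`. -/
theorem fourierCoeff_eq_of_hasSum {ι : Type*} [Countable ι] {F : Matrix (Fin 2) (Fin 2) ℂ → ℂ}
    {c : ι → ℂ} {n : ι → Fin 4 → ℤ} (hn : Function.Injective n)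
    (hc : ∀ z : Fin 4 → ℂ, (z 0).im = 1 → (z 1).im = 1 → (z 2).im = 0 → (z 3).im = 0 →
      Summable (fun j => ‖c j * e (∑ i, n j i * z i)‖) ∧
      HasSum (fun j => c j * e (∑ i, n j i * z i)) (F (toMat K z))) (j₀ : ι) :
    fourierCoeff K F (dualMat K (n j₀)) = c j₀ := by
  rw [fourierCoeff]
  -- The factor evaluates the quotient of the `j`-th and `j₀`-th exponentials at height $Y=1$,
  -- leaving a Fourier series in four real variables.
  let b : ι → ℂ := fun j =>
    c j * e (((n j 0 - n j₀ 0 + n j 1 - n j₀ 1 : ℤ) : ℂ) * Complex.I)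
  have hb : Summable fun j => ‖b j‖ := by
    have h0 := (hc ![Complex.I, Complex.I, 0, 0] (by simp) (by simp) (by simp) (by simp)).1
    refine (h0.mul_right ‖e (-((n j₀ 0 + n j₀ 1 : ℤ) : ℂ) * Complex.I)‖).congr fun j => ?_
    rw [← norm_mul, mul_assoc, ← e_add]
    congr 3
    simp [Fin.sum_univ_four]
    ring
  have key : ∀ s t x y : ℝ, (fun Z : Matrix (Fin 2) (Fin 2) ℂ =>
      F Z * e (-(dualMat K (n j₀) * Z).trace))
      !![(s : ℂ) + Complex.I, (x : ℂ) + y * omega K;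
         (x : ℂ) + y * (starRingEnd ℂ) (omega K), (t : ℂ) + Complex.I] =
      ∑' j, b j * e (((n j 0 - n j₀ 0 : ℤ) : ℂ) * (s : ℂ)) *
        e (((n j 1 - n j₀ 1 : ℤ) : ℂ) * (t : ℂ)) * e (((n j 2 - n j₀ 2 : ℤ) : ℂ) * (x : ℂ)) *
        e (((n j 3 - n j₀ 3 : ℤ) : ℂ) * (y : ℂ)) := by
    intro s t x y
    have hZ : !![(s : ℂ) + Complex.I, (x : ℂ) + y * omega K;
         (x : ℂ) + y * (starRingEnd ℂ) (omega K), (t : ℂ) + Complex.I] =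
         toMat K ![(s : ℂ) + Complex.I, (t : ℂ) + Complex.I, x, y] := by
      simp [toMat]
    simp only
    rw [hZ, trace_dualMat_mul_toMat]
    have h1 := (hc ![(s : ℂ) + Complex.I, (t : ℂ) + Complex.I, x, y]
      (by simp) (by simp) (by simp) (by simp)).2
    rw [← h1.tsum_eq, ← tsum_mul_right]
    refine tsum_congr fun j => ?_
    simp only [b, mul_assoc, ← e_add]
    congr 2
    simp [Fin.sum_univ_four]
    ring
  simp_rw [key]
  rw [integral_tsum_e_four hb, tsum_eq_single j₀]
  · simp [b, e_zero]
  · intro j hj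
    have : ¬ (n j 0 - n j₀ 0 = 0 ∧ n j 1 - n j₀ 1 = 0 ∧ n j 2 - n j₀ 2 = 0 ∧
        n j 3 - n j₀ 3 = 0) := by
      rintro ⟨h0, h1, h2, h3⟩
      apply hj
      apply hn
      ext i
      fin_cases i
      · exact sub_eq_zero.1 h0
      · exact sub_eq_zero.1 h1
      · exact sub_eq_zero.1 h2
      · exact sub_eq_zero.1 h3
    split_ifs <;> simp_all

theorem mem_tube_of_im_eq {z : Fin 4 → ℂ} (h0 : (z 0).im = 1) (h1 : (z 1).im = 1)
    (h2 : (z 2).im = 0) (h3 : (z 3).im = 0) : z ∈ tube (posCone K) := by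
  simp [tube, posCone, h0, h1, h2, h3]

theorem IsHermitianModularForm.hasSum_fourier [NumberField.IsTotallyComplex K]
    (hK : Module.finrank ℚ K = 2) {σ : K →+* ℂ} {k N : ℕ}
    {F : Matrix (Fin 2) (Fin 2) ℂ → ℂ} (hF : IsHermitianModularForm σ k N F)
    {z : Fin 4 → ℂ} (hz : z ∈ tube (posCone K)) :
    Summable (fun n => ‖fourierCoeff K F (dualMat K n) * e (∑ i, n i * z i)‖) ∧
      HasSum (fun n => fourierCoeff K F (dualMat K n) * e (∑ i, n i * z i)) (F (toMat K z)) := by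
  obtain ⟨c, hc⟩ := hF.exists_fourier_expansion hK
  have : ∀ n, fourierCoeff K F (dualMat K n) = c n := fun n =>
    fourierCoeff_eq_of_hasSum (n := fun n => n) (fun _ _ h => h)
      (fun z h0 h1 h2 h3 => hc z (mem_tube_of_im_eq h0 h1 h2 h3)) n
  simp_rw [this]
  exact hc z hz

end Uniqueness

/-! ### Stability of the dual lattice under $T\mapsto{}^t\overline U\,T\,U$. -/

section Lattice

variable {K : Type*} [Field K] [NumberField K] [NumberField.IsTotallyComplex K]
  (hK : Module.finrank ℚ K = 2) {σ : K →+* ℂ}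

include hK

theorem conj_mem_integers {x : ℂ} (hx : x ∈ integers σ) : (starRingEnd ℂ) x ∈ integers σ := by
  obtain ⟨a, b, rfl⟩ := (mem_integers_iff hK σ).1 hx
  simpa using conj_omega_mem_integers hK σ a b

theorem sqrtNegDisc_mem_integers : sqrtNegDisc K ∈ integers σ :=
  (mem_integers_iff hK σ).2 ⟨-absDisc K, 2, by
    push_cast
    linear_combination -two_mul_omega (K := K)⟩

theorem exists_int_of_mem_integers_of_conj_eq {x : ℂ} (hx : x ∈ integers σ)
    (hx' : (starRingEnd ℂ) x = x) : ∃ n : ℤ, x = n := by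
  obtain ⟨a, b, rfl⟩ := (mem_integers_iff hK σ).1 hx
  have h := congrArg Complex.im hx'
  simp at h
  rcases (by linarith : (b : ℝ) * (omega K).im = 0) |> mul_eq_zero.1 with h | h
  · exact ⟨a, by simp [show b = 0 by exact_mod_cast h]⟩
  · exact absurd h omega_im_pos.ne'

theorem exists_int_eq_conj_mul_self {x : ℂ} (hx : x ∈ integers σ) :
    ∃ n : ℤ, (starRingEnd ℂ) x * x = n :=
  exists_int_of_mem_integers_of_conj_eq hK (mul_mem (conj_mem_integers hK hx) hx)
    (by simp [mul_comm])

theorem exists_int_eq_add_conj {t : ℂ} (ht : t ∈ inverseDifferent σ) :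
    ∃ n : ℤ, t + (starRingEnd ℂ) t = n := by
  obtain ⟨p, q, rfl⟩ := (mem_inverseDifferent_iff hK σ).1 ht
  exact ⟨p, dualEntry_add_conj p q⟩

theorem conj_mem_inverseDifferent {t : ℂ} (ht : t ∈ inverseDifferent σ) :
    (starRingEnd ℂ) t ∈ inverseDifferent σ := by
  obtain ⟨a, ha, rfl⟩ := ht
  exact ⟨-(starRingEnd ℂ) a, neg_mem (conj_mem_integers hK ha), by
    rw [map_div₀, conj_sqrtNegDisc, neg_div, div_neg]⟩

theorem integers_subset_inverseDifferent {a : ℂ} (ha : a ∈ integers σ) :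
    a ∈ inverseDifferent σ :=
  ⟨a * sqrtNegDisc K, mul_mem ha (sqrtNegDisc_mem_integers hK), by
    field_simp [sqrtNegDisc_ne_zero (K := K)]⟩

omit [NumberField.IsTotallyComplex K] hK in
theorem mul_mem_inverseDifferent {a t : ℂ} (ha : a ∈ integers σ) (ht : t ∈ inverseDifferent σ) :
    a * t ∈ inverseDifferent σ := by
  obtain ⟨b, hb, rfl⟩ := ht
  exact ⟨a * b, mul_mem ha hb, by rw [mul_div_assoc]⟩

omit [NumberField.IsTotallyComplex K] hK in
theorem add_mem_inverseDifferent {s t : ℂ} (hs : s ∈ inverseDifferent σ)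
    (ht : t ∈ inverseDifferent σ) : s + t ∈ inverseDifferent σ := by
  obtain ⟨a, ha, rfl⟩ := hs
  obtain ⟨b, hb, rfl⟩ := ht
  exact ⟨a + b, add_mem ha hb, by rw [add_div]⟩

theorem conjTranspose_mul_mul_mem_dualLattice {T U : Matrix (Fin 2) (Fin 2) ℂ}
    (hT : T ∈ dualLattice σ) (hU : ∀ i j, U i j ∈ integers σ) :
    U.conjTranspose * T * U ∈ dualLattice σ := by
  obtain ⟨l, m, t, ht, rfl⟩ := hT
  have hdiag : ∀ x ∈ integers σ, ∀ y ∈ integers σ, ∃ n : ℤ,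
      l * ((starRingEnd ℂ) x * x) + ((starRingEnd ℂ) x * y * t +
        (starRingEnd ℂ) ((starRingEnd ℂ) x * y * t)) + m * ((starRingEnd ℂ) y * y) = n := by
    intro x hx y hy
    obtain ⟨a, ha⟩ := exists_int_eq_conj_mul_self hK hx
    obtain ⟨b, hb⟩ := exists_int_eq_conj_mul_self hK hy
    obtain ⟨c, hc⟩ := exists_int_eq_add_conj hK
      (mul_mem_inverseDifferent (mul_mem (conj_mem_integers hK hx) hy) ht)
    exact ⟨l * a + c + m * b, by rw [ha, hb, hc]; push_cast; ring⟩
  obtain ⟨l', hl'⟩ := hdiag _ (hU 0 0) _ (hU 1 0)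
  obtain ⟨m', hm'⟩ := hdiag _ (hU 0 1) _ (hU 1 1)
  have hc : ∀ i j, (starRingEnd ℂ) (U i j) ∈ integers σ := fun i j => conj_mem_integers hK (hU i j)
  refine ⟨l', m', (starRingEnd ℂ) (U 0 0) * l * U 0 1 + (starRingEnd ℂ) (U 0 0) * U 1 1 * t +
    (starRingEnd ℂ) (U 1 0) * U 0 1 * (starRingEnd ℂ) t + (starRingEnd ℂ) (U 1 0) * m * U 1 1,
    ?_, ?_⟩
  · refine add_mem_inverseDifferent (add_mem_inverseDifferent (add_mem_inverseDifferent
      ?_ ?_) ?_) ?_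
    · exact integers_subset_inverseDifferent hK
        (mul_mem (mul_mem (hc _ _) (intCast_mem _ _)) (hU _ _))
    · exact mul_mem_inverseDifferent (mul_mem (hc _ _) (hU _ _)) ht
    · exact mul_mem_inverseDifferent (mul_mem (hc _ _) (hU _ _)) (conj_mem_inverseDifferent hK ht)
    · exact integers_subset_inverseDifferent hK
        (mul_mem (mul_mem (hc _ _) (intCast_mem _ _)) (hU _ _))
  · rw [← hl', ← hm']
    ext i j
    fin_cases i <;> fin_cases j <;>
      simp [Matrix.mul_apply, Fin.sum_univ_two] <;> ring

end Lattice

/-! ### Unimodular invariance and Koecher's principle. -/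

section Unimodular

variable {K : Type*} [Field K] [NumberField K]

theorem conj_mul_mem_upperHalfSpace {U U' Z : Matrix (Fin 2) (Fin 2) ℂ} (hUU : U * U' = 1)
    (hZ : Z ∈ upperHalfSpace) : U * Z * U.conjTranspose ∈ upperHalfSpace := by
  change Matrix.PosDef _ at hZ ⊢
  have h1 : (2 * Complex.I)⁻¹ • (U * Z * U.conjTranspose -
      (U * Z * U.conjTranspose).conjTranspose) =
      U * ((2 * Complex.I)⁻¹ • (Z - Z.conjTranspose)) * U.conjTranspose := by
    simp only [Matrix.conjTranspose_mul, Matrix.conjTranspose_conjTranspose, Matrix.mul_smul,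
      Matrix.smul_mul, Matrix.mul_sub, Matrix.sub_mul, Matrix.mul_assoc]
  rw [h1]
  refine hZ.mul_mul_conjTranspose_same fun v w hvw => ?_
  have := congrArg (fun x => Matrix.vecMul x U') hvw
  simpa [Matrix.vecMul_vecMul, hUU] using this

variable [NumberField.IsTotallyComplex K]

/-- The block diagonal matrix with blocks $U$ and ${}^t\overline{U}{}^{-1}$ acts by $Z\mapsto
UZ\,{}^t\overline U$. Determinant one makes the automorphy factor trivial. -/
theorem IsHermitianModularForm.conj_unimodular (hK : Module.finrank ℚ K = 2) {σ : K →+* ℂ}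
    {k N : ℕ} {F : Matrix (Fin 2) (Fin 2) ℂ → ℂ} (hF : IsHermitianModularForm σ k N F)
    {U U' : Matrix (Fin 2) (Fin 2) ℂ} (hU : ∀ i j, U i j ∈ integers σ)
    (hU' : ∀ i j, U' i j ∈ integers σ) (hUU : U * U' = 1) (hdet : U'.det = 1)
    {Z : Matrix (Fin 2) (Fin 2) ℂ} (hZ : Z ∈ upperHalfSpace) :
    F (U * Z * U.conjTranspose) = F Z := by
  have hU'U : U' * U = 1 := mul_eq_one_comm.1 hUU
  have hM : Matrix.fromBlocks U 0 0 U'.conjTranspose ∈ hermitianGamma0 σ N := by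
    refine fromBlocks_mem_hermitianGamma0 hU (fun i j => zero_mem _)
      (fun i j => ⟨0, zero_mem _, by simp⟩) (fun i j => conj_mem_integers hK (hU' _ _))
      (by simp) ?_ (by simp)
    rw [← Matrix.conjTranspose_mul, hU'U]
    simp
  have h := hF.modular _ hM Z hZ
  have hinv : (U'.conjTranspose)⁻¹ = U.conjTranspose := by
    refine Matrix.inv_eq_right_inv ?_
    rw [← Matrix.conjTranspose_mul, hUU]
    simp
  simpa [hinv, hdet, Matrix.det_conjTranspose] using h

/-- Since $\mathrm{tr}(T\,UZ\,{}^t\overline U)=\mathrm{tr}({}^t\overline U\,TU\,Z)$, the expansions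
of $F(UZ\,{}^t\overline U)=F(Z)$ may be compared term by term. -/
theorem fourierCoeff_conj_unimodular (hK : Module.finrank ℚ K = 2) {σ : K →+* ℂ}
    {k N : ℕ} {F : Matrix (Fin 2) (Fin 2) ℂ → ℂ} (hF : IsHermitianModularForm σ k N F)
    {U U' : Matrix (Fin 2) (Fin 2) ℂ} (hU : ∀ i j, U i j ∈ integers σ)
    (hU' : ∀ i j, U' i j ∈ integers σ) (hUU : U * U' = 1) (hdet : U'.det = 1)
    {T : Matrix (Fin 2) (Fin 2) ℂ} (hT : T ∈ dualLattice σ) :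
    fourierCoeff K F (U.conjTranspose * T * U) = fourierCoeff K F T := by
  have hmem : ∀ n, ∃ m, U.conjTranspose * dualMat K n * U = dualMat K m := fun n =>
    (mem_dualLattice_iff hK σ).1 (conjTranspose_mul_mul_mem_dualLattice hK
      ((mem_dualLattice_iff hK σ).2 ⟨n, rfl⟩) hU)
  choose φ hφ using hmem
  have hinj : Function.Injective φ := by
    intro n m hnm
    apply dualMat_injective (K := K)
    have h1 : U.conjTranspose * dualMat K n * U = U.conjTranspose * dualMat K m * U := by
      rw [hφ, hφ, hnm]
    have h2 : ∀ X : Matrix (Fin 2) (Fin 2) ℂ,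
        U'.conjTranspose * (U.conjTranspose * X * U) * U' = X := by
      intro X
      have h3 : U'.conjTranspose * U.conjTranspose = 1 := by
        rw [← Matrix.conjTranspose_mul, hUU]; simp
      calc U'.conjTranspose * (U.conjTranspose * X * U) * U'
          = (U'.conjTranspose * U.conjTranspose) * X * (U * U') := by
            simp only [Matrix.mul_assoc]
        _ = X := by rw [h3, hUU]; simp
    rw [← h2 (dualMat K n), h1, h2]
  obtain ⟨n, rfl⟩ := (mem_dualLattice_iff hK σ).1 hT
  rw [hφ]
  refine fourierCoeff_eq_of_hasSum (c := fun n => fourierCoeff K F (dualMat K n)) hinj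
    (fun z h0 h1 h2 h3 => ?_) n
  have hz : toMat K z ∈ upperHalfSpace :=
    toMat_mem_upperHalfSpace_iff.2 (mem_tube_of_im_eq h0 h1 h2 h3)
  obtain ⟨z', hz'⟩ := exists_toMat (K := K) (U * toMat K z * U.conjTranspose)
  have hz'm := conj_mul_mem_upperHalfSpace hUU hz
  have hsum : ∀ n, ∑ i, (φ n i : ℂ) * z i = ∑ i, (n i : ℂ) * z' i := by
    intro n
    rw [← trace_dualMat_mul_toMat (K := K), ← trace_dualMat_mul_toMat (K := K), hz', ← hφ]
    rw [Matrix.mul_assoc, Matrix.mul_assoc, Matrix.trace_mul_comm]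
    simp only [Matrix.mul_assoc]
  rw [← hz'] at hz'm
  have := hF.hasSum_fourier hK (toMat_mem_upperHalfSpace_iff.1 hz'm)
  rw [hz', hF.conj_unimodular hK hU hU' hUU hdet hz] at this
  simp_rw [hsum]
  exact this

/-- A single term of the absolutely convergent series at $Z=iI_2$ is bounded by the whole sum. -/
theorem exists_norm_fourierCoeff_le (hK : Module.finrank ℚ K = 2) {σ : K →+* ℂ}
    {k N : ℕ} {F : Matrix (Fin 2) (Fin 2) ℂ → ℂ} (hF : IsHermitianModularForm σ k N F) :
    ∃ M : ℝ, ∀ T ∈ dualLattice σ, ‖fourierCoeff K F T‖ ≤ M * Real.exp (2 * Real.pi * T.trace.re) := by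
  have h := (hF.hasSum_fourier hK (z := ![Complex.I, Complex.I, 0, 0])
    (mem_tube_of_im_eq (by simp) (by simp) (by simp) (by simp))).1
  refine ⟨∑' n, ‖fourierCoeff K F (dualMat K n) * e (∑ i, n i *
    (![Complex.I, Complex.I, 0, 0] : Fin 4 → ℂ) i)‖, fun T hT => ?_⟩
  obtain ⟨n, rfl⟩ := (mem_dualLattice_iff hK σ).1 hT
  have h1 := h.le_tsum n fun _ _ => norm_nonneg _
  refine le_trans (le_of_eq ?_) (mul_le_mul_of_nonneg_right h1 (Real.exp_pos _).le)
  rw [norm_mul, norm_e, mul_assoc, ← Real.exp_add]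
  have : (dualMat K n).trace.re = n 0 + n 1 := by simp [dualMat, Matrix.trace_fin_two]
  rw [this]
  simp [Fin.sum_univ_four]

/-- Koecher's argument: if $T$ is negative on an integral vector, its unimodular orbit contains
matrices of trace tending to $-\infty$ with the same coefficient, and the exponential bound in the
trace forces that coefficient to vanish. -/
theorem fourierCoeff_eq_zero_of_neg (hK : Module.finrank ℚ K = 2) {σ : K →+* ℂ}
    {k N : ℕ} {F : Matrix (Fin 2) (Fin 2) ℂ → ℂ} (hF : IsHermitianModularForm σ k N F)
    {l m : ℝ} {t x y : ℂ} (hT : !![(l : ℂ), t; (starRingEnd ℂ) t, (m : ℂ)] ∈ dualLattice σ)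
    (hx : x ∈ integers σ) (hy : y ∈ integers σ)
    (hneg : l * Complex.normSq x + m * Complex.normSq y
      + 2 * ((starRingEnd ℂ) x * t * y).re < 0) :
    fourierCoeff K F !![(l : ℂ), t; (starRingEnd ℂ) t, (m : ℂ)] = 0 := by
  set T : Matrix (Fin 2) (Fin 2) ℂ := !![(l : ℂ), t; (starRingEnd ℂ) t, (m : ℂ)] with hTdef
  obtain ⟨M, hM⟩ := exists_norm_fourierCoeff_le hK hF
  -- This is $v\,{}^tu$ with $v={}^t(x,y)$ and $u={}^t(-y,x)$. As ${}^tuv=0$ it squares to zero, so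
  -- $1+jP$ is unimodular for every $j$.
  set P : Matrix (Fin 2) (Fin 2) ℂ := !![-(x * y), x * x; -(y * y), x * y] with hP
  have hPi : ∀ i j, P i j ∈ integers σ := by
    intro i j
    fin_cases i <;> fin_cases j
    · exact neg_mem (mul_mem hx hy)
    · exact mul_mem hx hx
    · exact neg_mem (mul_mem hy hy)
    · exact mul_mem hx hy
  have hPP : P * P = 0 := by
    ext i j
    fin_cases i <;> fin_cases j <;> simp [hP, Matrix.mul_apply, Fin.sum_univ_two] <;> ring
  have h1i : ∀ i j, (1 : Matrix (Fin 2) (Fin 2) ℂ) i j ∈ integers σ := by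
    intro i j
    rw [Matrix.one_apply]
    split_ifs
    · exact one_mem _
    · exact zero_mem _
  set α := T.trace.re with hα
  set β := (P.conjTranspose * T + T * P).trace.re with hβ
  set γ := (P.conjTranspose * T * P).trace.re with hγ
  have hγneg : γ < 0 := by
    have h0 : 0 < Complex.normSq x + Complex.normSq y := by
      by_contra h
      have hx0 : Complex.normSq x = 0 := by
        linarith [Complex.normSq_nonneg x, Complex.normSq_nonneg y]
      have hy0 : Complex.normSq y = 0 := by
        linarith [Complex.normSq_nonneg x, Complex.normSq_nonneg y]
      rw [Complex.normSq_eq_zero] at hx0 hy0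
      simp [hx0, hy0] at hneg
    have h1 : γ = (Complex.normSq x + Complex.normSq y) * (l * Complex.normSq x
        + m * Complex.normSq y + 2 * ((starRingEnd ℂ) x * t * y).re) := by
      simp only [hγ, hP, hTdef, Matrix.trace_fin_two, Matrix.mul_apply, Fin.sum_univ_two,
        Matrix.conjTranspose_apply, Complex.normSq_apply]
      simp
      ring
    rw [h1]
    exact mul_neg_of_pos_of_neg h0 hneg
  -- The trace along $U=1+jP$ is quadratic in $j$, with leading coefficient
  -- $\gamma=(|x|^2+|y|^2)\,{}^t\overline vTv<0$.
  have hbd : ∀ j : ℕ, ‖fourierCoeff K F T‖ ≤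
      M * Real.exp (2 * Real.pi * (α + j * (β + j * γ))) := by
    intro j
    have hU : ∀ a b, (1 + (j : ℂ) • P) a b ∈ integers σ := fun a b =>
      add_mem (h1i a b) (mul_mem (natCast_mem _ _) (hPi a b))
    have hU' : ∀ a b, (1 - (j : ℂ) • P) a b ∈ integers σ := fun a b =>
      sub_mem (h1i a b) (mul_mem (natCast_mem _ _) (hPi a b))
    have hUU : (1 + (j : ℂ) • P) * (1 - (j : ℂ) • P) = 1 := by
      rw [add_mul, mul_sub, mul_sub, smul_mul_smul_comm, hPP]
      simp
    have hdet : (1 - (j : ℂ) • P).det = 1 := by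
      rw [Matrix.det_fin_two]
      simp [hP]
      ring
    rw [← fourierCoeff_conj_unimodular hK hF hU hU' hUU hdet hT]
    refine (hM _ (conjTranspose_mul_mul_mem_dualLattice hK hT hU)).trans (le_of_eq ?_)
    congr 3
    have : (1 + (j : ℂ) • P).conjTranspose * T * (1 + (j : ℂ) • P) =
        T + (j : ℂ) • ((P.conjTranspose * T + T * P) + (j : ℂ) • (P.conjTranspose * T * P)) := by
      rw [Matrix.conjTranspose_add, Matrix.conjTranspose_smul]
      simp only [Matrix.conjTranspose_one, star_natCast, add_mul, mul_add, one_mul, mul_one,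
        Matrix.smul_mul, Matrix.mul_smul, smul_add]
      abel
    rw [this, Matrix.trace_add, Matrix.trace_smul, Matrix.trace_add, Matrix.trace_smul]
    simp [hα, hβ, hγ]
  have hlim : Tendsto (fun j : ℕ => M * Real.exp (2 * Real.pi * (α + j * (β + j * γ)))) atTop
      (𝓝 (M * 0)) := by
    refine Tendsto.const_mul M (Real.tendsto_exp_atBot.comp ?_)
    refine Tendsto.const_mul_atBot (by positivity) (tendsto_atBot_add_const_left _ _ ?_)
    refine Tendsto.atTop_mul_atBot₀ tendsto_natCast_atTop_atTop ?_
    exact tendsto_atBot_add_const_left _ _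
      (Tendsto.atTop_mul_const_of_neg hγneg tendsto_natCast_atTop_atTop)
  rw [mul_zero] at hlim
  have := ge_of_tendsto' hlim hbd
  exact norm_le_zero_iff.1 this

/-- Koecher's principle. -/
theorem fourierCoeff_eq_zero_of_not_posSemidef (hK : Module.finrank ℚ K = 2) {σ : K →+* ℂ}
    {k N : ℕ} {F : Matrix (Fin 2) (Fin 2) ℂ → ℂ} (hF : IsHermitianModularForm σ k N F)
    (n : Fin 4 → ℤ) (hn : ¬ (dualMat K n).PosSemidef) : fourierCoeff K F (dualMat K n) = 0 := by
  have hT : dualMat K n ∈ dualLattice σ := (mem_dualLattice_iff hK σ).2 ⟨n, rfl⟩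
  have hts : dualEntry K (n 2) (n 3) * sqrtNegDisc K ∈ integers σ := by
    rw [dualEntry, div_mul_cancel₀ _ sqrtNegDisc_ne_zero]
    exact (mem_integers_iff hK σ).2 ⟨-n 3, n 2, by simp⟩
  rw [dualMat] at hn hT ⊢
  rw [posSemidef_fin_two_iff] at hn
  set t := dualEntry K (n 2) (n 3)
  -- The entry $t$ need not be integral, so the test vectors below are multiplied by $\sqrt{-D_K}$
  -- to land in $\mathcal{O}^2$.
  have hs := sqrtNegDisc_mem_integers (σ := σ) hK
  set s := sqrtNegDisc K with hsdef
  have hns : 0 < Complex.normSq s := Complex.normSq_pos.2 sqrtNegDisc_ne_zero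
  have hts' : (starRingEnd ℂ) t * s ∈ integers σ := by
    have := neg_mem (conj_mem_integers hK hts)
    rw [map_mul, hsdef, conj_sqrtNegDisc] at this
    simpa using this
  rcases lt_or_ge (n 0 : ℝ) 0 with hl | hl
  · exact fourierCoeff_eq_zero_of_neg hK hF hT (one_mem _) (zero_mem _) (by simpa using hl)
  rcases lt_or_ge (n 1 : ℝ) 0 with hm | hm
  · exact fourierCoeff_eq_zero_of_neg hK hF hT (zero_mem _) (one_mem _) (by simpa using hm)
  have hd : (n 0 : ℝ) * n 1 < Complex.normSq t := by
    by_contra h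
    exact hn ⟨hl, hm, not_lt.1 h⟩
  -- Up to the factor $s$, the test vectors are $(-t,1)$ if both diagonal entries vanish,
  -- $(m,-\overline t)$ if only $\ell=0$, and $(-t,\ell)$ if $\ell>0$.
  rcases hl.eq_or_lt with hl0 | hl0
  · rcases hm.eq_or_lt with hm0 | hm0
    · refine fourierCoeff_eq_zero_of_neg hK hF hT (neg_mem hts) hs ?_
      rw [← hl0, ← hm0]
      rw [← hl0, zero_mul] at hd
      have : ((starRingEnd ℂ) (-(t * s)) * t * s).re = -(Complex.normSq t * Complex.normSq s) := by
        simp only [Complex.normSq_apply]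
        simp
        ring
      rw [this]
      nlinarith [mul_pos hd hns]
    · refine fourierCoeff_eq_zero_of_neg hK hF hT (x := (n 1 : ℂ) * s)
        (y := -((starRingEnd ℂ) t * s)) (mul_mem (intCast_mem _ _) hs) (neg_mem hts') ?_
      have : (n 0 : ℝ) * Complex.normSq ((n 1 : ℂ) * s) +
          n 1 * Complex.normSq (-((starRingEnd ℂ) t * s)) +
          2 * ((starRingEnd ℂ) ((n 1 : ℂ) * s) * t * -((starRingEnd ℂ) t * s)).re =
          -(n 1 * (Complex.normSq s * (Complex.normSq t - n 0 * n 1))) := by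
        simp only [Complex.normSq_apply]
        simp
        ring
      rw [this]
      have := mul_pos hm0 (mul_pos hns (sub_pos.2 hd))
      linarith
  · refine fourierCoeff_eq_zero_of_neg hK hF hT (x := -(t * s)) (y := (n 0 : ℂ) * s)
      (neg_mem hts) (mul_mem (intCast_mem _ _) hs) ?_
    have : (n 0 : ℝ) * Complex.normSq (-(t * s)) +
        n 1 * Complex.normSq ((n 0 : ℂ) * s) +
        2 * ((starRingEnd ℂ) (-(t * s)) * t * ((n 0 : ℂ) * s)).re =
        -(n 0 * (Complex.normSq s * (Complex.normSq t - n 0 * n 1))) := by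
      simp only [Complex.normSq_apply]
      simp
      ring
    rw [this]
    have := mul_pos hl0 (mul_pos hns (sub_pos.2 hd))
    linarith

end Unimodular

/-! ### The Fourier–Jacobi expansion and the modularity of its coefficients. -/

section FourierJacobi

/-- Uniqueness of the coefficients of a power series in `e[τ]`. -/
theorem eq_of_hasSum_e {A B : ℕ → ℂ} {Y : ℝ} {f : ℂ → ℂ}
    (hA : ∀ τ : ℂ, Y < τ.im → HasSum (fun m : ℕ => A m * e ((m : ℂ) * τ)) (f τ))
    (hB : ∀ τ : ℂ, Y < τ.im → HasSum (fun m : ℕ => B m * e ((m : ℂ) * τ)) (f τ)) (m₀ : ℕ) :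
    A m₀ = B m₀ := by
  -- The expansions hold only above height $Y$; coefficients are extracted by integrating along the
  -- line at height $Y+1$.
  let y : ℂ := Complex.I * ((Y + 1 : ℝ) : ℂ)
  have hsum : ∀ x : ℝ, HasSum (fun m : ℕ => (A m - B m) * e ((m : ℂ) * (x + y))) 0 := by
    intro x
    have him : Y < (x + y : ℂ).im := by simp [y]
    have := (hA _ him).sub (hB _ him)
    simpa [sub_mul] using this
  let c : ℕ → ℂ := fun m => (A m - B m) * e ((m : ℂ) * y)
  have hc : Summable fun m => ‖c m‖ := by
    have := (hsum 0).summable.norm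
    simpa [c] using this
  have hint := integral_tsum_e hc (fun m => (m : ℤ) - m₀)
  have hzero : ∀ x : ℝ, ∑' m, c m * e ((((m : ℤ) - m₀ : ℤ) : ℂ) * (x : ℂ)) = 0 := by
    intro x
    have h1 := ((hsum x).mul_right (e (-(m₀ * x)))).tsum_eq
    rw [zero_mul] at h1
    rw [← h1]
    refine tsum_congr fun m => ?_
    simp only [c, mul_assoc, ← e_add]
    congr 2
    push_cast
    ring
  simp_rw [hzero] at hint
  rw [tsum_eq_single m₀] at hint
  · have h2 : c m₀ = 0 := by simpa using hint.symm
    simp only [c, mul_eq_zero, e_ne_zero, or_false] at h2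
    exact sub_eq_zero.1 h2
  · intro m hm
    rw [if_neg]
    omega

theorem exists_im_bound {τ z w : ℂ} (hτ : 0 < τ.im) :
    ∃ Y : ℝ, ∀ τ' : ℂ, Y < τ'.im → !![τ, z; w, τ'] ∈ upperHalfSpace := by
  refine ⟨Complex.normSq ((2 * Complex.I)⁻¹ * (z - (starRingEnd ℂ) w)) / τ.im, fun τ' h => ?_⟩
  rw [mem_upperHalfSpace_iff]
  refine ⟨hτ, ?_⟩
  rw [div_lt_iff₀ hτ] at h
  linarith

variable {K : Type*} [Field K] [NumberField K]

variable (K) in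
/-- Fourier–Jacobi exponent `e[l τ + t̄ z + t w]`, `t = dualEntry K p q`. -/
def jacobiExp (x : ℤ × ℤ × ℤ) (τ z w : ℂ) : ℂ :=
  e (x.1 * τ + (starRingEnd ℂ) (dualEntry K x.2.1 x.2.2) * z + dualEntry K x.2.1 x.2.2 * w)

variable (K) in
/-- The dual lattice vector with lower right entry `m` and remaining coordinates `x`. -/
def dualVec (m : ℤ) (x : ℤ × ℤ × ℤ) : Fin 4 → ℤ := ![x.1, m, x.2.1, x.2.2]

theorem trace_dualMat_dualVec (m : ℤ) (x : ℤ × ℤ × ℤ) (τ z w τ' : ℂ) :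
    (dualMat K (dualVec m x) * !![τ, z; w, τ']).trace =
      (x.1 * τ + (starRingEnd ℂ) (dualEntry K x.2.1 x.2.2) * z + dualEntry K x.2.1 x.2.2 * w) +
        m * τ' := by
  simp [dualMat, dualVec, Matrix.trace_fin_two]
  ring

theorem dualVec_injective : Function.Injective fun p : ℤ × (ℤ × ℤ × ℤ) => dualVec p.1 p.2 := by
  rintro ⟨m, l, p, q⟩ ⟨m', l', p', q'⟩ h
  have h0 := congrFun h 0
  have h1 := congrFun h 1
  have h2 := congrFun h 2
  have h3 := congrFun h 3
  simp [dualVec] at h0 h1 h2 h3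
  simp [h0, h1, h2, h3]

theorem dualVec_surjective (n : Fin 4 → ℤ) : dualVec (n 1) (n 0, n 2, n 3) = n := by
  ext i
  fin_cases i <;> rfl

variable [NumberField.IsTotallyComplex K] (hK : Module.finrank ℚ K = 2) {σ : K →+* ℂ}
  {k N : ℕ} {F : Matrix (Fin 2) (Fin 2) ℂ → ℂ} (hF : IsHermitianModularForm σ k N F)

include hK hF

/-- Koecher's principle allows the lower right entry to run over $\mathbf{N}$ instead of
$\mathbf{Z}$. -/
theorem IsHermitianModularForm.hasSum_dualVec {τ z w τ' : ℂ}
    (hZ : !![τ, z; w, τ'] ∈ upperHalfSpace) :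
    Summable (fun p : ℕ × (ℤ × ℤ × ℤ) =>
      ‖fourierCoeff K F (dualMat K (dualVec p.1 p.2)) * jacobiExp K p.2 τ z w *
        e ((p.1 : ℂ) * τ')‖) ∧
    HasSum (fun p : ℕ × (ℤ × ℤ × ℤ) =>
      fourierCoeff K F (dualMat K (dualVec p.1 p.2)) * jacobiExp K p.2 τ z w *
        e ((p.1 : ℂ) * τ')) (F !![τ, z; w, τ']) := by
  obtain ⟨v, hv⟩ := exists_toMat (K := K) !![τ, z; w, τ']
  have h := hF.hasSum_fourier hK (toMat_mem_upperHalfSpace_iff.1 (hv ▸ hZ))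
  simp_rw [← trace_dualMat_mul_toMat (K := K), hv] at h
  let g : ℕ × (ℤ × ℤ × ℤ) → Fin 4 → ℤ := fun p => dualVec p.1 p.2
  have hg : Function.Injective g := by
    intro p q hpq
    have := dualVec_injective (a₁ := ((p.1 : ℤ), p.2)) (a₂ := ((q.1 : ℤ), q.2)) hpq
    simp at this
    exact Prod.ext this.1 this.2
  have hterm : ∀ p, fourierCoeff K F (dualMat K (g p)) * e ((dualMat K (g p)) * !![τ, z; w, τ']).trace
      = fourierCoeff K F (dualMat K (dualVec p.1 p.2)) * jacobiExp K p.2 τ z w *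
        e ((p.1 : ℂ) * τ') := by
    intro p
    rw [mul_assoc, jacobiExp, ← e_add, trace_dualMat_dualVec]
    push_cast
    rfl
  constructor
  · have := h.1.comp_injective hg
    refine this.congr fun p => ?_
    rw [← hterm]
    rfl
  · have := (hg.hasSum_iff (f := fun n => fourierCoeff K F (dualMat K n) *
      e ((dualMat K n) * !![τ, z; w, τ']).trace) (fun n hn => ?_)).2 h.2
    · refine this.congr_fun fun p => ?_
      rw [← hterm]
      rfl
    · rw [fourierCoeff_eq_zero_of_not_posSemidef hK hF, zero_mul]
      intro hps
      rw [dualMat, posSemidef_fin_two_iff] at hps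
      apply hn
      refine ⟨((n 1).toNat, (n 0, n 2, n 3)), ?_⟩
      have h1 : (0 : ℤ) ≤ n 1 := by exact_mod_cast hps.2.1
      simp only [g]
      rw [Int.toNat_of_nonneg h1, dualVec_surjective]

/-- For $\tau^*$ of large imaginary part the point lies in $\mathbf{H}_2$; this series is a slice of
the full one, divided by the nonzero $e[m\tau^*]$. -/
theorem IsHermitianModularForm.summable_jacobi (m : ℕ) {τ z w : ℂ} (hτ : 0 < τ.im) :
    Summable (fun x : ℤ × ℤ × ℤ =>
      ‖fourierCoeff K F (dualMat K (dualVec m x)) * jacobiExp K x τ z w‖) := by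
  obtain ⟨Y, hY⟩ := exists_im_bound (z := z) (w := w) hτ
  have h := (hF.hasSum_dualVec hK (hY (Complex.I * ((Y + 1 : ℝ) : ℂ)) (by simp))).1
  have h1 := h.comp_injective (i := fun x : ℤ × ℤ × ℤ => (m, x)) (fun x y h => by simpa using h)
  refine (h1.mul_right ‖e ((m : ℂ) * (Complex.I * ((Y + 1 : ℝ) : ℂ)))‖⁻¹).congr fun x => ?_
  rw [Function.comp_apply, norm_mul _ (e _)]
  rw [mul_assoc, mul_inv_cancel₀ (norm_ne_zero_iff.2 (e_ne_zero _)), mul_one]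

/-- By Koecher's principle the semidefiniteness condition may be dropped, which leaves a sum over
the lattice $\mathbf{Z}^3$. -/
theorem IsHermitianModularForm.fourierJacobiCoeff_eq_tsum (m : ℕ) (τ z w : ℂ) :
    fourierJacobiCoeff σ F m τ z w =
      ∑' x : ℤ × ℤ × ℤ, fourierCoeff K F (dualMat K (dualVec m x)) * jacobiExp K x τ z w := by
  have hex : ∀ T : {T : Matrix (Fin 2) (Fin 2) ℂ // T ∈ dualLattice σ ∧ T.PosSemidef ∧
      T 1 1 = (m : ℂ)}, ∃ x : ℤ × ℤ × ℤ, T.1 = dualMat K (dualVec m x) := by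
    rintro ⟨T, hT, -, hm⟩
    obtain ⟨n, rfl⟩ := (mem_dualLattice_iff hK σ).1 hT
    refine ⟨(n 0, n 2, n 3), ?_⟩
    have : n 1 = m := by
      simp [dualMat] at hm
      exact_mod_cast hm
    rw [← this, dualVec_surjective]
  choose g hg using hex
  have hinj : Function.Injective g := fun S T h => Subtype.ext (by rw [hg, hg, h])
  rw [← hinj.tsum_eq, fourierJacobiCoeff]
  · refine tsum_congr fun T => ?_
    rw [← hg, jacobiExp]
    congr 2
    rw [hg]
    simp [dualMat, dualVec]
  · intro x hx
    rw [Function.mem_support] at hx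
    have hps : (dualMat K (dualVec m x)).PosSemidef := by
      by_contra h
      exact hx (by rw [fourierCoeff_eq_zero_of_not_posSemidef hK hF _ h, zero_mul])
    refine ⟨⟨dualMat K (dualVec m x), (mem_dualLattice_iff hK σ).2 ⟨_, rfl⟩, hps,
      by simp [dualMat, dualVec]⟩, ?_⟩
    have h2 := dualMat_injective (hg ⟨dualMat K (dualVec m x),
      (mem_dualLattice_iff hK σ).2 ⟨_, rfl⟩, hps, by simp [dualMat, dualVec]⟩)
    have h3 := dualVec_injective (a₁ := ((m : ℤ), x)) (a₂ := ((m : ℤ), _)) h2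
    simp only [Prod.mk.injEq, true_and] at h3
    exact h3.symm

theorem IsHermitianModularForm.hasSum_jacobi (m : ℕ) {τ z w : ℂ} (hτ : 0 < τ.im) :
    HasSum (fun x : ℤ × ℤ × ℤ =>
      fourierCoeff K F (dualMat K (dualVec m x)) * jacobiExp K x τ z w)
      (fourierJacobiCoeff σ F m τ z w) := by
  rw [hF.fourierJacobiCoeff_eq_tsum hK]
  exact (hF.summable_jacobi hK m hτ).of_norm.hasSum

theorem IsHermitianModularForm.hasSum_fourierJacobi {τ z w τ' : ℂ}
    (hZ : !![τ, z; w, τ'] ∈ upperHalfSpace) :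
    HasSum (fun m : ℕ => fourierJacobiCoeff σ F m τ z w * e ((m : ℂ) * τ'))
      (F !![τ, z; w, τ']) := by
  have hτ : 0 < τ.im := (mem_upperHalfSpace_iff.1 hZ).1
  exact (hF.hasSum_dualVec hK hZ).2.prod_fiberwise fun m =>
    (hF.hasSum_jacobi hK m hτ).mul_right _

-- The embedding of $\Gamma_0(N)$ in $\Gamma_0^{(2)}(N)$ that acts on the upper left variable.
omit hK [NumberField.IsTotallyComplex K] in
theorem IsHermitianModularForm.modular_embedded {a b c d : ℤ} (hdet : a * d - b * c = 1)
    (hc : (N : ℤ) ∣ c) {τ z w τ' : ℂ} (hZ : !![τ, z; w, τ'] ∈ upperHalfSpace) :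
    F !![(a * τ + b) / (c * τ + d), z / (c * τ + d);
      w / (c * τ + d), τ' - c * z * w / (c * τ + d)] =
    (c * τ + d) ^ k * F !![τ, z; w, τ'] := by
  have hτ : 0 < τ.im := (mem_upperHalfSpace_iff.1 hZ).1
  have hdetC : (a : ℂ) * d - b * c = 1 := by exact_mod_cast hdet
  have hj : (c : ℂ) * τ + d ≠ 0 := by
    intro h
    have h1 := congrArg Complex.im h
    simp [hτ.ne'] at h1
    subst h1
    simp at h
    subst h
    simp at hdet
  set j : ℂ := (c : ℂ) * τ + d with hjdef
  have hmem : ∀ x y : ℤ, ∀ i i' : Fin 2,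
      (!![(x : ℂ), 0; 0, (y : ℂ)] : Matrix (Fin 2) (Fin 2) ℂ) i i' ∈ integers σ := by
    intro x y i i'
    fin_cases i <;> fin_cases i'
    · exact intCast_mem _ _
    · exact zero_mem _
    · exact zero_mem _
    · exact intCast_mem _ _
  have hM : Matrix.fromBlocks !![(a : ℂ), 0; 0, ((1 : ℤ) : ℂ)] !![(b : ℂ), 0; 0, ((0 : ℤ) : ℂ)]
      !![(c : ℂ), 0; 0, ((0 : ℤ) : ℂ)] !![(d : ℂ), 0; 0, ((1 : ℤ) : ℂ)] ∈ hermitianGamma0 σ N := by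
    refine fromBlocks_mem_hermitianGamma0 (hmem _ _) (hmem _ _) ?_ (hmem _ _) ?_ ?_ ?_
    · obtain ⟨c', rfl⟩ := hc
      intro i i'
      refine ⟨_, hmem c' 0 i i', ?_⟩
      fin_cases i <;> fin_cases i' <;> simp
    · ext i i'
      fin_cases i <;> fin_cases i' <;> simp [Matrix.mul_apply, Fin.sum_univ_two, mul_comm]
    · ext i i'
      fin_cases i <;> fin_cases i' <;> simp [Matrix.mul_apply, Fin.sum_univ_two]
      linear_combination hdetC
    · ext i i'
      fin_cases i <;> fin_cases i' <;> simp [Matrix.mul_apply, Fin.sum_univ_two, mul_comm]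
  have h := hF.modular _ hM _ hZ
  simp only [Matrix.toBlocks_fromBlocks₁₁, Matrix.toBlocks_fromBlocks₁₂,
    Matrix.toBlocks_fromBlocks₂₁, Matrix.toBlocks_fromBlocks₂₂] at h
  have hden : !![(c : ℂ), 0; 0, ((0 : ℤ) : ℂ)] * !![τ, z; w, τ'] +
      !![(d : ℂ), 0; 0, ((1 : ℤ) : ℂ)] = !![j, c * z; 0, 1] := by
    ext i i'
    fin_cases i <;> fin_cases i' <;> simp [hjdef]
  have hnum : !![(a : ℂ), 0; 0, ((1 : ℤ) : ℂ)] * !![τ, z; w, τ'] +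
      !![(b : ℂ), 0; 0, ((0 : ℤ) : ℂ)] = !![a * τ + b, a * z; w, τ'] := by
    ext i i'
    fin_cases i <;> fin_cases i' <;> simp
  have hinv : (!![j, c * z; 0, 1] : Matrix (Fin 2) (Fin 2) ℂ)⁻¹ = !![j⁻¹, -(c * z / j); 0, 1] := by
    refine Matrix.inv_eq_right_inv ?_
    ext i i'
    fin_cases i <;> fin_cases i' <;> simp [Matrix.mul_apply, Fin.sum_univ_two, hj]
    field_simp
    ring
  rw [hden, hnum, hinv] at h
  have hdet2 : (!![j, c * z; 0, 1] : Matrix (Fin 2) (Fin 2) ℂ).det = j := by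
    simp [Matrix.det_fin_two]
  rw [hdet2] at h
  rw [← h]
  congr 1
  ext i i'
  fin_cases i <;> fin_cases i'
  · simp [Matrix.mul_apply, Fin.sum_univ_two, div_eq_mul_inv]
  · simp [Matrix.mul_apply, Fin.sum_univ_two]
    field_simp
    rw [hjdef]
    linear_combination -z * hdetC
  · simp [Matrix.mul_apply, Fin.sum_univ_two, div_eq_mul_inv]
  · simp [Matrix.mul_apply, Fin.sum_univ_two]
    ring

omit hK hF [NumberField.IsTotallyComplex K] [NumberField K] [Field K] in
theorem mobius_im_pos {a b c d : ℤ} (hdet : 0 < a * d - b * c) {τ : ℂ} (hτ : 0 < τ.im) :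
    (c : ℂ) * τ + d ≠ 0 ∧ 0 < (((a : ℂ) * τ + b) / (c * τ + d)).im := by
  have hj : (c : ℂ) * τ + d ≠ 0 := by
    intro h
    have h1 := congrArg Complex.im h
    simp [hτ.ne'] at h1
    subst h1
    simp at h
    subst h
    simp at hdet
  refine ⟨hj, ?_⟩
  have hn : Complex.normSq (c * τ + d) ≠ 0 := fun h => hj (Complex.normSq_eq_zero.mp h)
  have h1 : (((a : ℂ) * τ + b) / (c * τ + d)).im =
      ((a * d - b * c : ℤ) : ℝ) * τ.im / Complex.normSq (c * τ + d) := by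
    rw [Complex.div_im]
    field_simp
    simp
    ring
  rw [h1]
  exact div_pos (mul_pos (by exact_mod_cast hdet) hτ) (Complex.normSq_pos.2 hj)

/-- Both sides of `modular_embedded` are expanded in $e[m\tau^*]$ and compared. The shift of
$\tau^*$ by $-czw/(c\tau+d)$ produces the exponential factor. -/
theorem IsHermitianModularForm.fourierJacobiCoeff_modular {a b c d : ℤ}
    (hdet : a * d - b * c = 1) (hc : (N : ℤ) ∣ c) (m : ℕ) {τ z w : ℂ} (hτ : 0 < τ.im) :
    fourierJacobiCoeff σ F m ((a * τ + b) / (c * τ + d)) (z / (c * τ + d)) (w / (c * τ + d)) *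
      e (-(m * c * z * w / (c * τ + d))) = (c * τ + d) ^ k * fourierJacobiCoeff σ F m τ z w := by
  obtain ⟨-, hτ1⟩ := mobius_im_pos (a := a) (b := b) (c := c) (d := d) (by omega) hτ
  set j : ℂ := (c : ℂ) * τ + d with hj
  obtain ⟨Y₁, hY₁⟩ := exists_im_bound (z := z) (w := w) hτ
  obtain ⟨Y₂, hY₂⟩ := exists_im_bound (z := z / j) (w := w / j) hτ1
  refine eq_of_hasSum_e (Y := max Y₁ (Y₂ + (c * z * w / j).im))
    (A := fun m => fourierJacobiCoeff σ F m ((a * τ + b) / j) (z / j) (w / j) *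
      e (-(m * c * z * w / j)))
    (B := fun m => j ^ k * fourierJacobiCoeff σ F m τ z w)
    (f := fun τ' => j ^ k * F !![τ, z; w, τ']) (fun τ' hτ' => ?_) (fun τ' hτ' => ?_) m
  · rw [max_lt_iff] at hτ'
    have h1 := hF.hasSum_fourierJacobi hK (hY₂ (τ' - c * z * w / j)
      (by rw [Complex.sub_im]; linarith))
    rw [hF.modular_embedded hdet hc (hY₁ τ' hτ'.1)] at h1
    refine h1.congr_fun fun n => ?_
    rw [mul_assoc, ← e_add]
    congr 2
    ring
  · rw [max_lt_iff] at hτ'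
    have h1 := (hF.hasSum_fourierJacobi hK (hY₁ τ' hτ'.1)).mul_left (j ^ k)
    refine h1.congr_fun fun n => ?_
    rw [mul_assoc]

theorem IsHermitianModularForm.jacobiSlash_fourierJacobiCoeff {γ : SL(2, ℤ)}
    (hγ : γ ∈ CongruenceSubgroup.Gamma0 N) (m : ℕ) {τ z w : ℂ} (hτ : 0 < τ.im) :
    jacobiSlash k m ((γ : Matrix (Fin 2) (Fin 2) ℤ).map (Int.cast : ℤ → ℝ))
      (fourierJacobiCoeff σ F m) τ z w = fourierJacobiCoeff σ F m τ z w := by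
  have hdet : γ 0 0 * γ 1 1 - γ 0 1 * γ 1 0 = 1 := by
    rw [← Matrix.det_fin_two]
    exact γ.2
  have hc : (N : ℤ) ∣ γ 1 0 := by
    rw [CongruenceSubgroup.Gamma0_mem] at hγ
    exact (ZMod.intCast_zmod_eq_zero_iff_dvd _ _).1 hγ
  have h := hF.fourierJacobiCoeff_modular hK hdet hc m (z := z) (w := w) hτ
  have hj := (mobius_im_pos (a := γ 0 0) (b := γ 0 1) (c := γ 1 0) (d := γ 1 1) (by omega) hτ).1
  have hdetR : ((γ : Matrix (Fin 2) (Fin 2) ℤ).map (Int.cast : ℤ → ℝ)).det = 1 := by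
    rw [Matrix.det_fin_two]
    simp only [Matrix.map_apply]
    exact_mod_cast hdet
  rw [jacobiSlash, hdetR]
  simp only [Matrix.map_apply, Real.sqrt_one, Complex.ofReal_one, one_mul, Complex.ofReal_intCast]
  rw [h]
  field_simp

end FourierJacobi

/-! ### Upper triangular representatives of $\Gamma_0(N)\backslash\Delta_N(m)$. -/

section HeckeCosets

/-- Parameters `(a, b)` of the representatives `(a b; 0 m/a)` of `Γ₀(N) \ Δ_N(m)`. -/
def heckeIndex (N m : ℕ) : Finset (Σ _ : ℕ, ℕ) :=
  (m.divisors.filter fun a => a.Coprime N).sigma fun a => Finset.range (m / a)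

theorem mem_heckeIndex {N m : ℕ} {p : Σ _ : ℕ, ℕ} :
    p ∈ heckeIndex N m ↔ (p.1 ∣ m ∧ m ≠ 0) ∧ p.1.Coprime N ∧ p.2 < m / p.1 := by
  simp [heckeIndex, and_assoc]

/-- The representative `(a b; 0 m/a)`. -/
def heckeRep {N m : ℕ} (p : heckeIndex N m) : heckeSet N m :=
  ⟨!![(p.1.1 : ℤ), p.1.2; 0, (m / p.1.1 : ℕ)], by
    obtain ⟨⟨h1, -⟩, h2, -⟩ := mem_heckeIndex.1 p.2
    refine ⟨by simp, ?_, ?_⟩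
    · rw [Matrix.det_fin_two_of]
      simp only [mul_zero, sub_zero]
      exact_mod_cast Nat.mul_div_cancel' h1
    · simpa using h2⟩

/-- A $\gamma$ carrying one representative to another has lower left entry $0$ and, since $a,a'>0$,
diagonal $1$. So $a=a'$, and $b$, $b'$ are reduced residues of the same class modulo $m/a$. -/
theorem heckeRep_injective {N m : ℕ} :
    Function.Injective fun p : heckeIndex N m => (⟦heckeRep p⟧ : Quotient (heckeSetoid N m)) := by
  rintro ⟨⟨a, b⟩, hp⟩ ⟨⟨a', b'⟩, hp'⟩ h
  obtain ⟨⟨h1, hm⟩, -, h3⟩ := mem_heckeIndex.1 hp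
  obtain ⟨⟨h1', -⟩, -, h3'⟩ := mem_heckeIndex.1 hp'
  obtain ⟨γ, -, hγ⟩ := Quotient.exact h
  simp only [heckeRep] at hγ h1 h3 h1' h3'
  have ha : 0 < a := Nat.pos_of_dvd_of_pos h1 (Nat.pos_of_ne_zero hm)
  have ha' : 0 < a' := Nat.pos_of_dvd_of_pos h1' (Nat.pos_of_ne_zero hm)
  have hdet : γ 0 0 * γ 1 1 - γ 0 1 * γ 1 0 = 1 := by
    rw [← Matrix.det_fin_two]
    exact γ.2
  have e00 := congrFun (congrFun hγ 0) 0
  have e01 := congrFun (congrFun hγ 0) 1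
  have e10 := congrFun (congrFun hγ 1) 0
  simp [Matrix.mul_apply, Fin.sum_univ_two] at e00 e01 e10
  have hr : γ 1 0 = 0 := by
    rcases e10 with h | h
    · exact h
    · omega
  rw [hr, mul_zero, sub_zero] at hdet
  have hpos : 0 < γ 0 0 := by
    by_contra hcon
    have : γ 0 0 * (a : ℤ) ≤ 0 := mul_nonpos_of_nonpos_of_nonneg (not_lt.1 hcon) (by positivity)
    omega
  have hone : γ 0 0 = 1 := by
    rcases Int.eq_one_or_neg_one_of_mul_eq_one hdet with h | h
    · exact h
    · omega
  rw [hone, one_mul] at e00 e01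
  have haa : a = a' := by exact_mod_cast e00
  subst haa
  have hq : γ 0 1 = 0 := by
    have hd : (0 : ℤ) < (m / a : ℕ) := by exact_mod_cast (Nat.zero_le _).trans_lt h3
    have hlt : γ 0 1 * ((m / a : ℕ) : ℤ) < 1 * ((m / a : ℕ) : ℤ) := by push_cast at *; omega
    have hgt : -1 * ((m / a : ℕ) : ℤ) < γ 0 1 * ((m / a : ℕ) : ℤ) := by push_cast at *; omega
    have := lt_of_mul_lt_mul_right hlt hd.le
    have := lt_of_mul_lt_mul_right hgt hd.le
    omega
  rw [hq, zero_mul, add_zero] at e01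
  have hbb : b = b' := by exact_mod_cast e01
  subst hbb
  rfl

theorem heckeRep_surjective {N m : ℕ} (hm : 0 < m) :
    Function.Surjective fun p : heckeIndex N m => (⟦heckeRep p⟧ : Quotient (heckeSetoid N m)) := by
  intro q
  induction q using Quotient.inductionOn with
  | h g =>
  obtain ⟨g, hN, hdet, hcop⟩ := g
  rw [Matrix.det_fin_two] at hdet
  set a := g 0 0
  set b := g 0 1
  set c := g 1 0
  set d := g 1 1
  have hg0 : 0 < Int.gcd a c := by
    refine Int.gcd_pos_iff.2 ?_
    by_contra! h
    rw [h.1, h.2] at hdet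
    simp at hdet
    omega
  set g₀ := Int.gcd a c with hg₀
  obtain ⟨a₁, ha₁⟩ : (g₀ : ℤ) ∣ a := Int.gcd_dvd_left ..
  obtain ⟨c₁, hc₁⟩ : (g₀ : ℤ) ∣ c := Int.gcd_dvd_right ..
  have hbez : (g₀ : ℤ) = a * Int.gcdA a c + c * Int.gcdB a c := Int.gcd_eq_gcd_ab a c
  set x := Int.gcdA a c
  set y := Int.gcdB a c
  have hg0' : (g₀ : ℤ) ≠ 0 := by exact_mod_cast hg0.ne'
  have hxy : a₁ * x + c₁ * y = 1 := by
    apply mul_left_cancel₀ hg0'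
    linear_combination (-hbez) - x * ha₁ - y * hc₁
  set d' := a₁ * d - c₁ * b with hd'
  have hmd : (g₀ : ℤ) * d' = m := by
    rw [← hdet, hd']
    linear_combination (-d) * ha₁ + b * hc₁
  have hd'pos : 0 < d' := by
    have h1 : 0 < (g₀ : ℤ) * d' := by rw [hmd]; exact_mod_cast hm
    exact pos_of_mul_pos_right h1 (by positivity)
  have hgm : g₀ ∣ m := by
    have : (g₀ : ℤ) ∣ m := ⟨d', hmd.symm⟩
    exact_mod_cast this
  have hdiv : ((m / g₀ : ℕ) : ℤ) = d' := by
    rw [Int.natCast_div, ← hmd, Int.mul_ediv_cancel_left _ hg0']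
  have hcopg : IsCoprime (g₀ : ℤ) (N : ℤ) := by
    have : IsCoprime a (N : ℤ) := Int.isCoprime_iff_gcd_eq_one.2 hcop
    rw [ha₁] at this
    exact this.of_mul_left_left
  -- Here $\gcd(a,N)=1$ enters: it makes $g_0\mid a$ prime to $N$, so $N\mid c=g_0c_1$ gives $N\mid
  -- c_1$ and the matrix built below lies in $\Gamma_0(N)$.
  have hNc : (N : ℤ) ∣ c₁ := by
    rw [hc₁] at hN
    exact hcopg.symm.dvd_of_dvd_mul_left hN
  set β := x * b + y * d with hβ
  set n := β / d' with hn
  have hmod : β - n * d' = β % d' := by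
    rw [hn, mul_comm]
    linarith [Int.mul_ediv_add_emod β d']
  have hmod0 := Int.emod_nonneg β hd'pos.ne'
  have hmod1 := Int.emod_lt_of_pos β hd'pos
  have hidx : (⟨g₀, (β % d').toNat⟩ : Σ _ : ℕ, ℕ) ∈ heckeIndex N m := by
    refine mem_heckeIndex.2 ⟨⟨hgm, hm.ne'⟩, ?_, ?_⟩
    · exact Nat.isCoprime_iff_coprime.1 hcopg
    · change (β % d').toNat < m / g₀
      zify
      rw [Int.toNat_of_nonneg hmod0, ← Int.natCast_div, hdiv]
      exact hmod1
  refine ⟨⟨_, hidx⟩, ?_⟩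
  symm
  apply Quotient.sound
  -- The second row annihilates the first column of $g$. Bézout supplies the first row, from which
  -- $n$ times the second is subtracted to reduce the upper right entry modulo $d'$.
  have hdetγ : (!![x + n * c₁, y - n * a₁; -c₁, a₁] : Matrix (Fin 2) (Fin 2) ℤ).det = 1 := by
    rw [Matrix.det_fin_two_of]
    linear_combination hxy
  let γ : SL(2, ℤ) := ⟨_, hdetγ⟩
  refine ⟨γ, ?_, ?_⟩
  · refine CongruenceSubgroup.Gamma0_mem.2 ?_
    refine (ZMod.intCast_zmod_eq_zero_iff_dvd _ _).2 ?_
    change (N : ℤ) ∣ -c₁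
    exact hNc.neg_right
  · change !![x + n * c₁, y - n * a₁; -c₁, a₁] * g =
      !![(g₀ : ℤ), ((β % d').toNat : ℤ); 0, ((m / g₀ : ℕ) : ℤ)]
    rw [hdiv, Int.toNat_of_nonneg hmod0, ← hmod]
    ext i j
    fin_cases i <;> fin_cases j
    · change (!![x + n * c₁, y - n * a₁; -c₁, a₁] * g) 0 0 = (g₀ : ℤ)
      simp only [Matrix.mul_apply, Fin.sum_univ_two, Matrix.of_apply, Matrix.cons_val', Matrix.cons_val]
      change (x + n * c₁) * a + (y - n * a₁) * c = (g₀ : ℤ)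
      linear_combination -hbez + n * c₁ * ha₁ - n * a₁ * hc₁
    · change (!![x + n * c₁, y - n * a₁; -c₁, a₁] * g) 0 1 = β - n * d'
      simp only [Matrix.mul_apply, Fin.sum_univ_two, Matrix.of_apply, Matrix.cons_val', Matrix.cons_val]
      change (x + n * c₁) * b + (y - n * a₁) * d = β - n * d'
      rw [hβ, hd']
      ring
    · change (!![x + n * c₁, y - n * a₁; -c₁, a₁] * g) 1 0 = 0
      simp only [Matrix.mul_apply, Fin.sum_univ_two, Matrix.of_apply, Matrix.cons_val', Matrix.cons_val]
      change -c₁ * a + a₁ * c = 0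
      linear_combination (-c₁) * ha₁ + a₁ * hc₁
    · change (!![x + n * c₁, y - n * a₁; -c₁, a₁] * g) 1 1 = d'
      simp only [Matrix.mul_apply, Fin.sum_univ_two, Matrix.of_apply, Matrix.cons_val', Matrix.cons_val]
      change -c₁ * b + a₁ * d = d'
      rw [hd']
      ring

/-- `V_m` as a sum over upper triangular representatives. -/
theorem V_eq_sum {k t N m : ℕ} (hm : 0 < m) {φ : ℂ → ℂ → ℂ → ℂ}
    (hφ : ∀ γ : SL(2, ℤ), γ ∈ CongruenceSubgroup.Gamma0 N → ∀ τ z w : ℂ, 0 < τ.im →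
      jacobiSlash k t ((γ : Matrix (Fin 2) (Fin 2) ℤ).map (Int.cast : ℤ → ℝ)) φ τ z w = φ τ z w)
    {τ z w : ℂ} (hτ : 0 < τ.im) :
    V k t N m φ τ z w = (m : ℂ) ^ (k - 1) *
      ∑ a ∈ m.divisors with a.Coprime N, ∑ b ∈ Finset.range (m / a),
        jacobiSlash k t !![(a : ℝ), b; 0, (m / a : ℕ)] φ τ z w := by
  rw [V]
  congr 1
  have hbij : Function.Bijective
      fun p : heckeIndex N m => (⟦heckeRep p⟧ : Quotient (heckeSetoid N m)) :=
    ⟨heckeRep_injective, heckeRep_surjective hm⟩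
  rw [← finsum_eq_of_bijective (f := fun p : heckeIndex N m =>
    jacobiSlash k t !![(p.1.1 : ℝ), p.1.2; 0, (m / p.1.1 : ℕ)] φ τ z w) _ hbij (fun p => ?_)]
  · rw [finsum_eq_sum_of_fintype, Finset.univ_eq_attach,
      Finset.sum_attach (heckeIndex N m) (fun p : (Σ _ : ℕ, ℕ) =>
        jacobiSlash k t !![(p.1 : ℝ), p.2; 0, (m / p.1 : ℕ)] φ τ z w), heckeIndex,
      Finset.sum_sigma]
  -- The chosen representative differs from the triangular one by an element of $\Gamma_0(N)$, under
  -- which `φ` is invariant.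
  · obtain ⟨γ, hγ, h⟩ := Quotient.exact (Quotient.out_eq (⟦heckeRep p⟧ : Quotient (heckeSetoid N m)))
    have hdet := (Quotient.out (⟦heckeRep p⟧ : Quotient (heckeSetoid N m))).2.2.1
    set g := (Quotient.out (⟦heckeRep p⟧ : Quotient (heckeSetoid N m))).1
    have hcast : !![(p.1.1 : ℝ), p.1.2; 0, (m / p.1.1 : ℕ)] =
        ((γ : Matrix (Fin 2) (Fin 2) ℤ).map (Int.cast : ℤ → ℝ)) * (g.map (Int.cast : ℤ → ℝ)) := by
      have h2 : ((γ : Matrix (Fin 2) (Fin 2) ℤ) * g).map (Int.cast : ℤ → ℝ) =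
          ((γ : Matrix (Fin 2) (Fin 2) ℤ).map (Int.cast : ℤ → ℝ)) *
            (g.map (Int.cast : ℤ → ℝ)) := Matrix.map_mul (f := Int.castRingHom ℝ)
      rw [← h2, h, heckeRep]
      ext i j
      fin_cases i <;> fin_cases j
      · simp
      · simp
      · simp
      · exact (Int.cast_natCast _).symm
    rw [hcast]
    refine jacobiSlash_mul_left k t φ _ _ ?_ ?_ (fun τ z w hτ => hφ γ hγ τ z w hτ) τ z w hτ
    · have := (Int.castRingHom ℝ).map_det (γ : Matrix (Fin 2) (Fin 2) ℤ)
      rw [γ.2, map_one] at this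
      exact this.symm
    · have := (Int.castRingHom ℝ).map_det g
      rw [hdet] at this
      have h3 : (g.map (Int.cast : ℤ → ℝ)).det = m := by
        rw [← Int.cast_natCast]; exact this.symm
      rw [h3]
      exact_mod_cast hm

end HeckeCosets

/-! ### The Maass relation and the identity for $V_m$. -/

section MaassRelation

variable {K : Type*} [Field K] [NumberField K]

theorem dualMat_smul (d : ℤ) (n : Fin 4 → ℤ) :
    dualMat K (fun i => d * n i) = (d : ℂ) • dualMat K n := by
  ext i j
  fin_cases i <;> fin_cases j <;> simp [dualMat, dualEntry_mul]

theorem dualMat_ne_zero {n : Fin 4 → ℤ} (hn : n ≠ 0) : dualMat K n ≠ 0 := by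
  intro h
  apply hn
  apply dualMat_injective (K := K)
  rw [h]
  ext i j
  fin_cases i <;> fin_cases j <;> simp [dualMat, dualEntry]

theorem posSemidef_dualVec_iff {m : ℤ} {x : ℤ × ℤ × ℤ} :
    (dualMat K (dualVec m x)).PosSemidef ↔ (0 : ℝ) ≤ x.1 ∧ (0 : ℝ) ≤ m ∧
      Complex.normSq (dualEntry K x.2.1 x.2.2) ≤ x.1 * m :=
  posSemidef_fin_two_iff

theorem det_dualVec_re (m : ℤ) (x : ℤ × ℤ × ℤ) :
    (dualMat K (dualVec m x)).det.re = x.1 * m - Complex.normSq (dualEntry K x.2.1 x.2.2) := by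
  rw [dualMat, Matrix.det_fin_two_of, Complex.mul_conj]
  simp [dualVec]

variable [NumberField.IsTotallyComplex K] (hK : Module.finrank ℚ K = 2) {σ : K →+* ℂ}

include hK

theorem inv_smul_dualMat_mem_iff {q : ℕ} (hq : 0 < q) {n : Fin 4 → ℤ} :
    (q : ℂ)⁻¹ • dualMat K n ∈ dualLattice σ ↔ ∀ i, (q : ℤ) ∣ n i := by
  have hq' : (q : ℂ) ≠ 0 := by exact_mod_cast hq.ne'
  rw [mem_dualLattice_iff hK]
  constructor
  · rintro ⟨n', hn'⟩ i
    rw [inv_smul_eq_iff₀ hq'] at hn'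
    have h : dualMat K n = dualMat K (fun i => (q : ℤ) * n' i) := by
      rw [dualMat_smul, hn', Int.cast_natCast]
    rw [dualMat_injective h]
    exact dvd_mul_right _ _
  · intro h
    choose n' hn' using h
    refine ⟨n', ?_⟩
    rw [inv_smul_eq_iff₀ hq', ← Int.cast_natCast, ← dualMat_smul]
    congr 1
    ext i
    exact hn' i

/-- Dividing by $q$ stays in the lattice exactly when $q$ divides all four integral coordinates. -/
theorem content_dualMat {n : Fin 4 → ℤ} (hn : n ≠ 0) :
    content σ (dualMat K n) = Finset.univ.gcd fun i => (n i).natAbs := by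
  set g := Finset.univ.gcd fun i => (n i).natAbs with hg
  have hg0 : g ≠ 0 := by
    intro h
    rw [hg, Finset.gcd_eq_zero_iff] at h
    apply hn
    ext i
    exact Int.natAbs_eq_zero.1 (h i (Finset.mem_univ i))
  have hdvd : ∀ q : ℕ, q ∣ g ↔ ∀ i, (q : ℤ) ∣ n i := by
    intro q
    rw [hg, Finset.dvd_gcd_iff]
    simp [Int.natCast_dvd]
  have : IsGreatest {q : ℕ | 0 < q ∧ (q : ℂ)⁻¹ • dualMat K n ∈ dualLattice σ} g := by
    refine ⟨⟨Nat.pos_of_ne_zero hg0, ?_⟩, ?_⟩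
    · exact (inv_smul_dualMat_mem_iff hK (Nat.pos_of_ne_zero hg0)).2 ((hdvd g).1 dvd_rfl)
    · rintro q ⟨hq, hqm⟩
      exact Nat.le_of_dvd (Nat.pos_of_ne_zero hg0)
        ((hdvd q).2 ((inv_smul_dualMat_mem_iff hK hq).1 hqm))
  exact this.csSup_eq

theorem mem_divisors_content_iff {n : Fin 4 → ℤ} (hn : n ≠ 0) {d : ℕ} :
    d ∈ (content σ (dualMat K n)).divisors ↔ ∀ i, (d : ℤ) ∣ n i := by
  rw [content_dualMat hK hn, Nat.mem_divisors, Finset.dvd_gcd_iff]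
  simp only [Finset.mem_univ, true_implies, Int.natCast_dvd]
  refine ⟨fun h => h.1, fun h => ⟨h, fun h0 => ?_⟩⟩
  rw [Finset.gcd_eq_zero_iff] at h0
  apply hn
  ext i
  exact Int.natAbs_eq_zero.1 (h0 i (Finset.mem_univ i))

/-- Divisibility of all coordinates of a triple. -/
def TripleDvd (a : ℕ) (y : ℤ × ℤ × ℤ) : Prop := (a : ℤ) ∣ y.1 ∧ (a : ℤ) ∣ y.2.1 ∧ (a : ℤ) ∣ y.2.2

-- Indexing by divisors of $m$ with a divisibility condition, rather than by divisors of the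
-- content, makes the range of summation independent of $T$ and equal to that in $V_m$.
open Classical in
theorem maass_relation_dualVec {k N : ℕ} {F : Matrix (Fin 2) (Fin 2) ℂ → ℂ} {α : ℕ → ℂ}
    (hα : ∀ T ∈ dualLattice σ, T.PosSemidef → T ≠ 0 →
      fourierCoeff K F T = ∑ d ∈ (content σ T).divisors with d.Coprime N,
        (d : ℂ) ^ (k - 1) * α ⌊(absDisc K : ℝ) * T.det.re / (d : ℝ) ^ 2⌋₊)
    {m : ℕ} (hm : 0 < m) {y : ℤ × ℤ × ℤ} (hy : (dualMat K (dualVec m y)).PosSemidef) :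
    fourierCoeff K F (dualMat K (dualVec m y)) = ∑ a ∈ m.divisors with a.Coprime N,
      if TripleDvd a y then (a : ℂ) ^ (k - 1) *
        α ⌊(absDisc K : ℝ) * (dualMat K (dualVec m y)).det.re / (a : ℝ) ^ 2⌋₊ else 0 := by
  have hne : dualVec m y ≠ 0 := by
    intro h
    have := congrFun h 1
    simp [dualVec] at this
    omega
  rw [hα _ ((mem_dualLattice_iff hK σ).2 ⟨_, rfl⟩) hy (dualMat_ne_zero hne), ← Finset.sum_filter]
  refine Finset.sum_congr ?_ fun _ _ => rfl
  ext d
  simp only [Finset.mem_filter, mem_divisors_content_iff hK hne, Nat.mem_divisors]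
  constructor
  · rintro ⟨h, hc⟩
    refine ⟨⟨⟨?_, hm.ne'⟩, hc⟩, h 0, h 2, h 3⟩
    have := h 1
    simp [dualVec] at this
    exact_mod_cast this
  · rintro ⟨⟨⟨h, -⟩, hc⟩, h0, h2, h3⟩
    refine ⟨fun i => ?_, hc⟩
    fin_cases i
    · exact h0
    · change (d : ℤ) ∣ m
      exact_mod_cast h
    · exact h2
    · exact h3

variable {k N : ℕ} {F : Matrix (Fin 2) (Fin 2) ℂ → ℂ}

-- This form eliminates $\alpha_F^*$. For $T=\begin{pmatrix}\ell&t\\ \overline t&m\end{pmatrix}$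
-- divisible by $a$, the matrix $\begin{pmatrix}m\ell/a^2&t/a\\ \overline t/a&1\end{pmatrix}$ has
-- determinant $\det T/a^2$ and content $1$.
open Classical in
theorem IsMaassForm.fourierCoeff_dualVec (hF : IsMaassForm σ k N F) {m : ℕ} (hm : 0 < m)
    (y : ℤ × ℤ × ℤ) :
    fourierCoeff K F (dualMat K (dualVec m y)) = ∑ a ∈ m.divisors with a.Coprime N,
      if TripleDvd a y then (a : ℂ) ^ (k - 1) *
        fourierCoeff K F (dualMat K (dualVec 1 ((m / a : ℕ) * (y.1 / a), y.2.1 / a, y.2.2 / a)))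
      else 0 := by
  obtain ⟨α, hα⟩ := hF.maass
  have key : ∀ a ∈ m.divisors.filter (fun a => a.Coprime N), TripleDvd a y →
      ((dualMat K (dualVec 1 ((m / a : ℕ) * (y.1 / a), y.2.1 / a, y.2.2 / a))).PosSemidef ↔
        (dualMat K (dualVec m y)).PosSemidef) ∧
      (dualMat K (dualVec 1 ((m / a : ℕ) * (y.1 / a), y.2.1 / a, y.2.2 / a))).det.re =
        (dualMat K (dualVec m y)).det.re / (a : ℝ) ^ 2 := by
    intro a ha
    rw [Finset.mem_filter, Nat.mem_divisors] at ha
    obtain ⟨d, rfl⟩ := ha.1.1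
    have ha0 : 0 < a := Nat.pos_of_ne_zero (by rintro rfl; simp at ha)
    have hd0 : 0 < d := Nat.pos_of_ne_zero (by rintro rfl; simp at ha)
    obtain ⟨l, p, q⟩ := y
    rintro ⟨⟨l', rfl⟩, ⟨p', rfl⟩, ⟨q', rfl⟩⟩
    have ha0' : (a : ℤ) ≠ 0 := by exact_mod_cast ha0.ne'
    have haR : (0 : ℝ) < a := by exact_mod_cast ha0
    have hdR : (0 : ℝ) < d := by exact_mod_cast hd0
    rw [posSemidef_dualVec_iff, posSemidef_dualVec_iff, det_dualVec_re, det_dualVec_re]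
    simp only [Int.mul_ediv_cancel_left _ ha0', Nat.mul_div_cancel_left _ ha0, dualEntry_mul,
      Complex.normSq_mul]
    have hna : Complex.normSq ((a : ℤ) : ℂ) = (a : ℝ) ^ 2 := by
      rw [Int.cast_natCast, Complex.normSq_natCast]
      ring
    rw [hna]
    push_cast
    constructor
    · constructor
      · rintro ⟨h1, -, h2⟩
        have hl : (0 : ℝ) ≤ l' := nonneg_of_mul_nonneg_right h1 hdR
        refine ⟨by positivity, by positivity, ?_⟩
        nlinarith [mul_le_mul_of_nonneg_left h2 (sq_nonneg (a : ℝ))]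
      · rintro ⟨h1, -, h2⟩
        have hl : (0 : ℝ) ≤ l' := nonneg_of_mul_nonneg_right h1 haR
        refine ⟨by positivity, zero_le_one, ?_⟩
        have h3 : (a : ℝ) ^ 2 * Complex.normSq (dualEntry K p' q') ≤ (a : ℝ) ^ 2 * (d * l' * 1) := by
          linarith
        exact le_of_mul_le_mul_left h3 (by positivity)
    · field_simp
  by_cases hy : (dualMat K (dualVec m y)).PosSemidef
  · rw [maass_relation_dualVec hK hα hm hy]
    refine Finset.sum_congr rfl fun a ha => ?_
    split_ifs with hd
    · obtain ⟨h1, h2⟩ := key a ha hd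
      have := maass_relation_dualVec hK hα (m := 1) one_pos (y := ((m / a : ℕ) * (y.1 / a),
        y.2.1 / a, y.2.2 / a)) (h1.2 hy)
      rw [Nat.cast_one] at this
      rw [this, h2, mul_div_assoc]
      have h3 : (Nat.divisors 1).filter (fun a => a.Coprime N) = {1} := by simp [Finset.filter_singleton]
      rw [h3, Finset.sum_singleton, if_pos (by simp [TripleDvd])]
      simp
    · rfl
  -- Outside the semidefinite range the Maass relation is not available, but both sides vanish by
  -- Koecher's principle.
  · rw [fourierCoeff_eq_zero_of_not_posSemidef hK hF.modularForm _ hy]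
    symm
    refine Finset.sum_eq_zero fun a ha => ?_
    split_ifs with hd
    · rw [fourierCoeff_eq_zero_of_not_posSemidef hK hF.modularForm _
        (fun h => hy ((key a ha hd).1.1 h)), mul_zero]
    · rfl

omit hK [NumberField.IsTotallyComplex K] [NumberField K] [Field K] in
theorem sum_e_div {d : ℕ} (hd : 0 < d) (l : ℤ) :
    ∑ b ∈ Finset.range d, e ((l : ℂ) * (b / d)) = if (d : ℤ) ∣ l then (d : ℂ) else 0 := by
  have hd' : (d : ℂ) ≠ 0 := by exact_mod_cast hd.ne'
  have hpow : ∀ b : ℕ, e ((l : ℂ) * (b / d)) = e ((l : ℂ) / d) ^ b := by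
    intro b
    rw [← e_natCast_mul]
    congr 1
    ring
  simp_rw [hpow]
  split_ifs with h
  · obtain ⟨l', rfl⟩ := h
    have : (((d : ℤ) * l' : ℤ) : ℂ) / d = (l' : ℤ) := by
      push_cast
      field_simp
    rw [this, e_int]
    simp
  · have hne : e ((l : ℂ) / d) ≠ 1 := by
      intro h1
      rw [e, Complex.exp_eq_one_iff] at h1
      obtain ⟨n, hn⟩ := h1
      have h2 : (l : ℂ) / d = n := by
        have h3 : (2 * Real.pi * Complex.I : ℂ) ≠ 0 := by simp
        apply mul_left_cancel₀ h3
        rw [hn]; ring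
      rw [div_eq_iff hd'] at h2
      apply h
      refine ⟨n, ?_⟩
      have h4 : l = n * d := by exact_mod_cast h2
      rw [h4, mul_comm]
    rw [geom_sum_eq hne, ← e_natCast_mul, mul_div_cancel₀ _ hd', e_int]
    simp

/-- Summing $e[\ell b/d]$ over $b$ gives $d$ when $d\mid\ell$ and $0$ otherwise; the prefactor
cancels this $d$ and the $d^{-k}$ of the slash action. The surviving indices are parametrised by
$\ell/d$. -/
theorem hasSum_sum_jacobiSlash (hF : IsHermitianModularForm σ k N F) {a d : ℕ} (ha : 0 < a)
    (hd : 0 < d) {τ z w : ℂ} (hτ : 0 < τ.im) :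
    HasSum (fun x : ℤ × ℤ × ℤ => fourierCoeff K F (dualMat K (dualVec 1 (d * x.1, x.2.1, x.2.2))) *
      jacobiExp K (a * x.1, a * x.2.1, a * x.2.2) τ (z / (Real.sqrt (a * d : ℕ) : ℂ))
        (w / (Real.sqrt (a * d : ℕ) : ℂ)))
      ((d : ℂ) ^ k / d * ∑ b ∈ Finset.range d,
        jacobiSlash k 1 !![(a : ℝ), b; 0, (d : ℝ)] (fourierJacobiCoeff σ F 1) τ z w) := by
  have hd' : (d : ℂ) ≠ 0 := by exact_mod_cast hd.ne'
  have ha' : (a : ℂ) ≠ 0 := by exact_mod_cast ha.ne'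
  have hmpos : (0 : ℝ) < (a * d : ℕ) := by exact_mod_cast Nat.mul_pos ha hd
  set s : ℂ := (Real.sqrt (a * d : ℕ) : ℂ) with hs
  have hss : s * s = a * d := by
    rw [hs, ← Complex.ofReal_mul, Real.mul_self_sqrt hmpos.le]
    push_cast
    rfl
  have hs0 : s ≠ 0 := by
    intro h
    rw [h, zero_mul] at hss
    exact mul_ne_zero ha' hd' hss.symm
  have hslash : ∀ b : ℕ, HasSum (fun x : ℤ × ℤ × ℤ => fourierCoeff K F (dualMat K (dualVec 1 x)) *
      (jacobiExp K x (a * τ / d) (s * z / d) (s * w / d) * e ((x.1 : ℂ) * (b / d))) *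
        ((d : ℂ) ^ k)⁻¹)
      (jacobiSlash k 1 !![(a : ℝ), b; 0, (d : ℝ)] (fourierJacobiCoeff σ F 1) τ z w) := by
    intro b
    have him : 0 < (((a : ℂ) * τ + b) / d).im := by
      have := (mobius_im_pos (a := a) (b := b) (c := 0) (d := d) (by
        simp only [mul_zero, sub_zero]
        exact_mod_cast Nat.mul_pos ha hd) hτ).2
      simpa using this
    have h := (hF.hasSum_jacobi hK 1 (z := s * z / d) (w := s * w / d) him).mul_right
      ((d : ℂ) ^ k)⁻¹
    have hval : jacobiSlash k 1 !![(a : ℝ), b; 0, (d : ℝ)] (fourierJacobiCoeff σ F 1) τ z w =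
        fourierJacobiCoeff σ F 1 (((a : ℂ) * τ + b) / d) (s * z / d) (s * w / d) *
          ((d : ℂ) ^ k)⁻¹ := by
      have hdet : (!![(a : ℝ), b; 0, (d : ℝ)] : Matrix (Fin 2) (Fin 2) ℝ).det = (a * d : ℕ) := by
        rw [Matrix.det_fin_two_of]; push_cast; ring
      rw [jacobiSlash, hdet, ← hs]
      simp [e_zero]
    rw [hval]
    refine h.congr_fun fun x => ?_
    congr 2
    rw [jacobiExp, jacobiExp, ← e_add]
    congr 1
    ring
  have hsum := (hasSum_sum fun b (_ : b ∈ Finset.range d) => hslash b).mul_left ((d : ℂ) ^ k / d)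
  have hterm : ∀ x : ℤ × ℤ × ℤ, (d : ℂ) ^ k / d * ∑ b ∈ Finset.range d,
      fourierCoeff K F (dualMat K (dualVec 1 x)) *
      (jacobiExp K x (a * τ / d) (s * z / d) (s * w / d) * e ((x.1 : ℂ) * (b / d))) *
        ((d : ℂ) ^ k)⁻¹ = if (d : ℤ) ∣ x.1 then fourierCoeff K F (dualMat K (dualVec 1 x)) *
          jacobiExp K x (a * τ / d) (s * z / d) (s * w / d) else 0 := by
    intro x
    rw [← Finset.sum_mul, ← Finset.mul_sum, ← Finset.mul_sum, sum_e_div hd]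
    split_ifs with h
    · field_simp
    · simp
  simp_rw [hterm] at hsum
  let g : ℤ × ℤ × ℤ → ℤ × ℤ × ℤ := fun x => (d * x.1, x.2.1, x.2.2)
  have hg : Function.Injective g := by
    rintro ⟨l, p, q⟩ ⟨l', p', q'⟩ h
    simp only [g, Prod.mk.injEq] at h
    have h0 : (d : ℤ) ≠ 0 := by exact_mod_cast hd.ne'
    simp [mul_left_cancel₀ h0 h.1, h.2.1, h.2.2]
  have h2 := (hg.hasSum_iff (fun x hx => ?_)).2 hsum
  · refine h2.congr_fun fun x => ?_
    rw [Function.comp_apply, if_pos (dvd_mul_right _ _)]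
    congr 1
    rw [jacobiExp, jacobiExp]
    congr 1
    simp only [g, dualEntry_mul, map_mul, map_intCast]
    push_cast
    -- The two rescalings of $z$ and $w$ agree because $s^2=ad$.
    have h3 : ∀ u v : ℂ, (a : ℂ) * u * (v / s) = u * (s * v / d) := by
      intro u v
      field_simp
      linear_combination -(u * v) * hss
    rw [h3, h3]
    field_simp
  · rw [if_neg]
    rintro ⟨l, hl⟩
    exact hx ⟨(l, x.2.1, x.2.2), by simp only [g]; rw [← hl]⟩

/-- The Fourier–Jacobi coefficients of a Maass form are the images of the first one under `V_m`. -/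
theorem IsMaassForm.fourierJacobiCoeff_eq_V (hk : 0 < k) (hF : IsMaassForm σ k N F) {m : ℕ}
    (hm : 0 < m) {τ z w : ℂ} (hτ : 0 < τ.im) :
    fourierJacobiCoeff σ F m τ (z / (Real.sqrt m : ℂ)) (w / (Real.sqrt m : ℂ)) =
      V k 1 N m (fourierJacobiCoeff σ F 1) τ z w := by
  classical
  rw [V_eq_sum hm (fun γ hγ τ z w hτ =>
    hF.modularForm.jacobiSlash_fourierJacobiCoeff hK hγ 1 hτ) hτ]
  refine (hF.modularForm.hasSum_jacobi hK m hτ).unique ?_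
  rw [Finset.mul_sum]
  simp_rw [hF.fourierCoeff_dualVec hK hm, Finset.sum_mul]
  refine hasSum_sum fun a ha => ?_
  rw [Finset.mem_filter, Nat.mem_divisors] at ha
  obtain ⟨d, rfl⟩ := ha.1.1
  have ha0 : 0 < a := Nat.pos_of_ne_zero (by rintro rfl; simp at hm)
  have hd0 : 0 < d := Nat.pos_of_ne_zero (by rintro rfl; simp at hm)
  have ha0' : (a : ℤ) ≠ 0 := by exact_mod_cast ha0.ne'
  have hd' : (d : ℂ) ≠ 0 := by exact_mod_cast hd0.ne'
  -- For this $a$ the nonzero terms lie on indices divisible by $a$, so the sum is reindexed by the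
  -- quotients.
  rw [Nat.mul_div_cancel_left _ ha0]
  let g : ℤ × ℤ × ℤ → ℤ × ℤ × ℤ := fun x => (a * x.1, a * x.2.1, a * x.2.2)
  have hg : Function.Injective g := by
    rintro ⟨l, p, q⟩ ⟨l', p', q'⟩ h
    simp only [g, Prod.mk.injEq] at h
    simp [mul_left_cancel₀ ha0' h.1, mul_left_cancel₀ ha0' h.2.1, mul_left_cancel₀ ha0' h.2.2]
  refine (hg.hasSum_iff (fun x hx => ?_)).1 ?_
  · rw [if_neg, zero_mul]
    rintro ⟨⟨l, hl⟩, ⟨p, hp⟩, ⟨q, hq⟩⟩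
    exact hx ⟨(l, p, q), by simp only [g]; rw [← hl, ← hp, ← hq]⟩
  · have h := (hasSum_sum_jacobiSlash hK hF.modularForm ha0 hd0 (z := z) (w := w) hτ).mul_left
      ((a : ℂ) ^ (k - 1))
    have hpow : (a : ℂ) ^ (k - 1) * ((d : ℂ) ^ k / d * ∑ b ∈ Finset.range d,
        jacobiSlash k 1 !![(a : ℝ), b; 0, (d : ℝ)] (fourierJacobiCoeff σ F 1) τ z w) =
        ((a * d : ℕ) : ℂ) ^ (k - 1) * ∑ b ∈ Finset.range d,
        jacobiSlash k 1 !![(a : ℝ), b; 0, (d : ℝ)] (fourierJacobiCoeff σ F 1) τ z w := by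
      obtain ⟨k', rfl⟩ : ∃ k', k = k' + 1 := ⟨k - 1, by omega⟩
      rw [Nat.add_sub_cancel, pow_succ, mul_div_assoc, div_self hd', Nat.cast_mul, mul_pow]
      ring
    rw [hpow] at h
    refine h.congr_fun fun x => ?_
    have hdvd : TripleDvd a (g x) := ⟨dvd_mul_right _ _, dvd_mul_right _ _, dvd_mul_right _ _⟩
    rw [Function.comp_apply, if_pos hdvd]
    simp only [g, Int.mul_ediv_cancel_left _ ha0']
    ring

end MaassRelation

/-! ### Eisenstein series of level one, including weight two. -/

section Eisenstein

open ArithmeticFunction in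
/-- `G_k(τ) = -B_k / (2k) + ∑ σ_{k-1}(n) e[nτ]`. -/
def eisensteinG (k : ℕ) (τ : ℂ) : ℂ :=
  -((bernoulli k : ℚ) : ℂ) / (2 * (k : ℂ)) + ∑' n : ℕ+, (sigma (k - 1) (n : ℕ) : ℂ) * e ((n : ℕ) * τ)

/-- Euler's formula expresses $\zeta(k)\ne0$ as a multiple of $B_k$. -/
theorem bernoulli_ne_zero_of_even {k : ℕ} (hk : 0 < k) (hk2 : Even k) : bernoulli k ≠ 0 := by
  obtain ⟨n, rfl⟩ := hk2
  have hn : n ≠ 0 := by omega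
  intro h
  have h1 := riemannZeta_two_mul_nat hn
  rw [← two_mul] at h
  rw [h] at h1
  simp only [Rat.cast_zero, mul_zero, zero_div] at h1
  refine riemannZeta_ne_zero_of_one_lt_re ?_ h1
  have : (1 : ℝ) < 2 * n := by exact_mod_cast (by omega : 1 < 2 * n)
  simpa using this

theorem qParam_pow_eq_e (n : ℕ) (τ : ℂ) : Complex.exp (2 * Real.pi * Complex.I * τ) ^ n = e (n * τ) := by
  rw [e_natCast_mul, e]

open ArithmeticFunction in
theorem summable_sigma_mul_e {k : ℕ} (hk : 1 ≤ k) {τ : ℂ} (hτ : 0 < τ.im) :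
    Summable fun n : ℕ => (sigma (k - 1) n : ℂ) * e (n * τ) := by
  have := EisensteinSeries.summable_sigma_mul_cexp_pow hk ⟨τ, hτ⟩
  refine this.congr fun n => ?_
  rw [← qParam_pow_eq_e]

theorem eisensteinG_eq_E {k : ℕ} (hk : 3 ≤ k) (hk2 : Even k) (z : UpperHalfPlane) :
    eisensteinG k z = -((bernoulli k : ℚ) : ℂ) / (2 * (k : ℂ)) * ModularForm.E hk z := by
  have hB : ((bernoulli k : ℚ) : ℂ) ≠ 0 := by
    exact_mod_cast bernoulli_ne_zero_of_even (by omega) hk2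
  have hk0 : (k : ℂ) ≠ 0 := by exact_mod_cast (by omega : k ≠ 0)
  rw [EisensteinSeries.q_expansion_bernoulli hk hk2, eisensteinG]
  simp_rw [zpow_natCast, qParam_pow_eq_e]
  set S := ∑' n : ℕ+, (ArithmeticFunction.sigma (k - 1) (n : ℕ) : ℂ) * e ((n : ℕ) * (z : ℂ))
  field_simp
  ring

theorem eisensteinG_two_eq_E2 (z : UpperHalfPlane) :
    eisensteinG 2 z = -(1 / 24 : ℂ) * EisensteinSeries.E2 z := by
  rw [EisensteinSeries.E2_eq_tsum_cexp, eisensteinG]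
  simp_rw [qParam_pow_eq_e]
  rw [bernoulli_two]
  push_cast
  ring

/-- The lower triangular unipotent matrix `(1 0; c 1)`. -/
def lowerUnipotent (c : ℤ) : SL(2, ℤ) := ⟨!![1, 0; c, 1], by simp [Matrix.det_fin_two_of]⟩

theorem denom_lowerUnipotent (c : ℤ) (z : UpperHalfPlane) :
    UpperHalfPlane.denom (lowerUnipotent c) z = c * z + 1 := by
  rw [ModularGroup.denom_apply]
  simp [lowerUnipotent]

theorem coe_lowerUnipotent_smul (c : ℤ) (z : UpperHalfPlane) :
    ((lowerUnipotent c • z : UpperHalfPlane) : ℂ) = z / (c * z + 1) := by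
  rw [UpperHalfPlane.coe_specialLinearGroup_apply]
  simp [lowerUnipotent]

/-- Behaviour of `G_k` under `τ ↦ τ / (cτ + 1)`, including the quasimodular weight two. -/
theorem exists_eisensteinG_transform {k : ℕ} (hk : 0 < k) (hk2 : Even k) :
    ∃ κ : ℂ, ∀ (c : ℤ) (τ : ℂ), 0 < τ.im →
      eisensteinG k (τ / (c * τ + 1)) =
        (c * τ + 1) ^ k * eisensteinG k τ + κ * c * (c * τ + 1) := by
  obtain rfl | hk3 : k = 2 ∨ 3 ≤ k := by
    obtain ⟨n, rfl⟩ := hk2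
    omega
  -- The weight two defect of $E_2$ is a multiple of $c/(c\tau+1)$. It is scaled by $-1/24$ to pass
  -- to $G_2$, and clearing $(c\tau+1)^2$ leaves $c(c\tau+1)$.
  · refine ⟨-(1 / 24 : ℂ) * -(1 / (2 * riemannZeta 2) * (2 * Real.pi * Complex.I)), fun c τ hτ => ?_⟩
    let z : UpperHalfPlane := ⟨τ, hτ⟩
    have h := congrFun (EisensteinSeries.E2_slash_action (lowerUnipotent c)) z
    have hj := UpperHalfPlane.denom_ne_zero (lowerUnipotent c) z
    rw [ModularForm.SL_slash_apply] at h
    simp only [Pi.sub_apply, Pi.smul_apply, EisensteinSeries.D2, smul_eq_mul] at h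
    rw [denom_lowerUnipotent] at h hj
    have h1 : ((lowerUnipotent c) 1 0 : ℤ) = c := by simp [lowerUnipotent]
    rw [h1] at h
    have h2 := eisensteinG_two_eq_E2 (lowerUnipotent c • z)
    have h3 := eisensteinG_two_eq_E2 z
    rw [coe_lowerUnipotent_smul] at h2
    change eisensteinG 2 (τ / (c * τ + 1)) = _ at h2
    change eisensteinG 2 τ = _ at h3
    change (c : ℂ) * τ + 1 ≠ 0 at hj
    change _ * ((c : ℂ) * τ + 1) ^ (-2 : ℤ) = _ - _ * (_ / ((c : ℂ) * τ + 1)) at h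
    rw [h2, h3]
    set j : ℂ := (c : ℂ) * τ + 1
    rw [zpow_neg, ← div_eq_mul_inv, div_eq_iff (zpow_ne_zero _ hj)] at h
    rw [h]
    have h4 : j ^ (2 : ℤ) = j ^ 2 := rfl
    rw [h4]
    field_simp
    ring
  · refine ⟨0, fun c τ hτ => ?_⟩
    let z : UpperHalfPlane := ⟨τ, hτ⟩
    have hmem : ((lowerUnipotent c : SL(2, ℤ)) : GL (Fin 2) ℝ) ∈ 𝒮ℒ := ⟨lowerUnipotent c, rfl⟩
    have h := SlashInvariantForm.slash_action_eqn'' (ModularForm.E hk3) hmem z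
    have h2 := eisensteinG_eq_E hk3 hk2 (lowerUnipotent c • z)
    have h3 := eisensteinG_eq_E hk3 hk2 z
    rw [coe_lowerUnipotent_smul] at h2
    change eisensteinG k (τ / (c * τ + 1)) = _ at h2
    change eisensteinG k τ = _ at h3
    rw [h2, h3]
    have h4 : ModularForm.E hk3 (lowerUnipotent c • z) =
        ((c : ℂ) * τ + 1) ^ k * ModularForm.E hk3 z := by
      rw [← zpow_natCast]
      have h5 := denom_lowerUnipotent c z
      change _ = (c : ℂ) * τ + 1 at h5
      rw [← h5]
      exact h
    rw [h4]
    ring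

end Eisenstein

/-! ### Eisenstein series of level $N$ and the constant term. -/

section LevelN

open UniqueFactorizationMonoid (radical squarefree_radical radical_dvd_self radical_ne_zero)
open ArithmeticFunction (sigma coe_zeta_mul_moebius coe_zeta_mul_apply one_apply sigma_apply
  natCoe_apply pow_apply isMultiplicative_pow IsMultiplicative)

theorem coprime_radical_iff {d N : ℕ} (hN : 0 < N) : d.Coprime (radical N) ↔ d.Coprime N := by
  constructor
  · intro h
    exact (Nat.Coprime.pow_right N h).coprime_dvd_right (Nat.dvd_radical_pow_self hN.ne')
  · intro h
    exact h.coprime_dvd_right radical_dvd_self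

theorem sum_moebius_divisors {n : ℕ} : ∑ d ∈ n.divisors, (ArithmeticFunction.moebius d : ℂ) = if n = 1 then 1 else 0 := by
  have h := congrArg (fun f : ArithmeticFunction ℤ => f n) coe_zeta_mul_moebius
  simp only [coe_zeta_mul_apply, one_apply] at h
  exact_mod_cast h

theorem sum_filter_dvd_divisors {n a : ℕ} (hn : n ≠ 0) (ha : a ∣ n) (f : ℕ → ℂ) :
    ∑ d ∈ n.divisors with a ∣ d, f d = ∑ d ∈ (n / a).divisors, f (a * d) := by
  obtain ⟨b, rfl⟩ := ha
  have ha0 : 0 < a := Nat.pos_of_ne_zero (by rintro rfl; simp at hn)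
  rw [Nat.mul_div_cancel_left _ ha0]
  symm
  refine Finset.sum_bij (fun d _ => a * d) ?_ ?_ ?_ ?_
  · intro d hd
    rw [Nat.mem_divisors] at hd
    rw [Finset.mem_filter, Nat.mem_divisors]
    exact ⟨⟨Nat.mul_dvd_mul_left _ hd.1, hn⟩, dvd_mul_right _ _⟩
  · intro d _ d' _ h
    exact Nat.eq_of_mul_eq_mul_left ha0 h
  · intro d hd
    rw [Finset.mem_filter, Nat.mem_divisors] at hd
    obtain ⟨⟨h1, -⟩, c, rfl⟩ := hd
    refine ⟨c, Nat.mem_divisors.2 ⟨Nat.dvd_of_mul_dvd_mul_left ha0 h1, ?_⟩, rfl⟩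
    rintro rfl
    simp at hn
  · intro d _
    rfl

/-- The divisor sum restricted to divisors prime to `N`, as a combination of `σ`. -/
theorem sum_moebius_mul_sigma {N : ℕ} (hN : 0 < N) (r n : ℕ) :
    ∑ a ∈ (radical N).divisors, (ArithmeticFunction.moebius a : ℂ) * (a : ℂ) ^ r *
      (if a ∣ n then (sigma r (n / a) : ℂ) else 0) =
    ∑ d ∈ n.divisors with d.Coprime N, (d : ℂ) ^ r := by
  rcases eq_or_ne n 0 with rfl | hn
  · simp
  -- Coprimality is detected by $\sum_{a\mid\gcd(d,\mathrm{rad}\,N)}\mu(a)$, and the sums over $a$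
  -- and $d$ are then interchanged.
  have h1 : ∀ d ∈ n.divisors, (if d.Coprime N then (d : ℂ) ^ r else 0) =
      ∑ a ∈ (radical N).divisors, if a ∣ d then (ArithmeticFunction.moebius a : ℂ) * (d : ℂ) ^ r else 0 := by
    intro d hd
    have hd0 : d ≠ 0 := by rintro rfl; simp at hd
    have h2 : (radical N).divisors.filter (· ∣ d) = (Nat.gcd d (radical N)).divisors := by
      ext a
      simp only [Finset.mem_filter, Nat.mem_divisors, Nat.dvd_gcd_iff]
      constructor
      · rintro ⟨⟨h, -⟩, h'⟩
        exact ⟨⟨h', h⟩, Nat.gcd_ne_zero_left hd0⟩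
      · rintro ⟨⟨h', h⟩, -⟩
        exact ⟨⟨h, radical_ne_zero⟩, h'⟩
    rw [← Finset.sum_filter, h2, ← Finset.sum_mul, sum_moebius_divisors]
    have h3 : Nat.gcd d (radical N) = 1 ↔ d.Coprime N := coprime_radical_iff hN
    simp only [h3]
    split_ifs <;> simp
  rw [Finset.sum_filter, Finset.sum_congr rfl h1, Finset.sum_comm]
  refine Finset.sum_congr rfl fun a _ => ?_
  rw [← Finset.sum_filter]
  split_ifs with h
  · rw [sum_filter_dvd_divisors hn h, sigma_apply]
    push_cast
    rw [Finset.mul_sum]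
    refine Finset.sum_congr rfl fun d _ => ?_
    rw [mul_pow]
    ring
  · rw [mul_zero]
    symm
    refine Finset.sum_eq_zero fun d hd => ?_
    rw [Finset.mem_filter, Nat.mem_divisors] at hd
    exact absurd (hd.2.trans hd.1.1) h

/-- The Euler product of a multiplicative function over a squarefree number. It supplies the
constant term in `V0`. -/
theorem sum_moebius_mul_pow_eq_prod (N r : ℕ) :
    ∑ a ∈ (radical N).divisors, (ArithmeticFunction.moebius a : ℂ) * (a : ℂ) ^ r =
      ∏ p ∈ N.primeFactors, (1 - (p : ℂ) ^ r) := by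
  have h := IsMultiplicative.prodPrimeFactors_one_sub_of_squarefree
    (R := ℂ) ((ArithmeticFunction.pow r : ArithmeticFunction ℕ) : ArithmeticFunction ℂ)
    isMultiplicative_pow.natCast (squarefree_radical (a := N))
  rw [Nat.primeFactors_radical] at h
  have hval : ∀ n : ℕ, n ≠ 0 →
      ((ArithmeticFunction.pow r : ArithmeticFunction ℕ) : ArithmeticFunction ℂ) n = (n : ℂ) ^ r := by
    intro n hn
    rw [natCoe_apply, pow_apply, if_neg (fun h => hn h.2)]
    push_cast
    rfl
  rw [Finset.prod_congr rfl fun p hp => by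
    rw [hval p (Nat.prime_of_mem_primeFactors hp).ne_zero]] at h
  rw [h]
  refine Finset.sum_congr rfl fun a ha => ?_
  rw [hval a (Nat.pos_of_mem_divisors ha).ne']

theorem hasSum_eisensteinG {k : ℕ} (hk : 1 ≤ k) {τ : ℂ} (hτ : 0 < τ.im) :
    HasSum (fun n : ℕ => (sigma (k - 1) n : ℂ) * e (n * τ))
      (eisensteinG k τ + ((bernoulli k : ℚ) : ℂ) / (2 * (k : ℂ))) := by
  have h := (summable_sigma_mul_e hk hτ).hasSum
  convert h using 1
  rw [eisensteinG, neg_div, neg_add_cancel_comm, ← PNat.coe_injective.tsum_eq]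
  intro n hn
  rw [Function.mem_support] at hn
  have : n ≠ 0 := by rintro rfl; simp at hn
  exact ⟨⟨n, Nat.pos_of_ne_zero this⟩, rfl⟩

/-- The Eisenstein series of level `N` as a combination of the `G_k(aτ)`. -/
theorem hasSum_levelN {k N : ℕ} (hk : 1 ≤ k) (hN : 0 < N) {τ : ℂ} (hτ : 0 < τ.im) :
    HasSum (fun n : ℕ => (∑ d ∈ n.divisors with d.Coprime N, (d : ℂ) ^ (k - 1)) * e (n * τ))
      (∑ a ∈ (radical N).divisors, (ArithmeticFunction.moebius a : ℂ) * (a : ℂ) ^ (k - 1) * eisensteinG k (a * τ) +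
        ((bernoulli k : ℚ) : ℂ) / (2 * (k : ℂ)) * ∏ p ∈ N.primeFactors, (1 - (p : ℂ) ^ (k - 1))) := by
  rw [← sum_moebius_mul_pow_eq_prod, Finset.mul_sum, ← Finset.sum_add_distrib]
  simp_rw [← sum_moebius_mul_sigma hN, Finset.sum_mul]
  refine hasSum_sum fun a ha => ?_
  have ha0 : 0 < a := Nat.pos_of_mem_divisors ha
  have him : 0 < ((a : ℂ) * τ).im := by
    rw [← Complex.ofReal_natCast, Complex.im_ofReal_mul]
    have : (0 : ℝ) < a := by exact_mod_cast ha0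
    positivity
  have h := (hasSum_eisensteinG hk him).mul_left ((ArithmeticFunction.moebius a : ℂ) * (a : ℂ) ^ (k - 1))
  have hg : Function.Injective fun n : ℕ => a * n := fun x y h => Nat.eq_of_mul_eq_mul_left ha0 h
  have hval : (ArithmeticFunction.moebius a : ℂ) * (a : ℂ) ^ (k - 1) * eisensteinG k (a * τ) +
      ((bernoulli k : ℚ) : ℂ) / (2 * (k : ℂ)) * ((ArithmeticFunction.moebius a : ℂ) * (a : ℂ) ^ (k - 1)) =
      (ArithmeticFunction.moebius a : ℂ) * (a : ℂ) ^ (k - 1) * (eisensteinG k (a * τ) +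
        ((bernoulli k : ℚ) : ℂ) / (2 * (k : ℂ))) := by ring
  rw [hval]
  refine (hg.hasSum_iff (fun n hn => ?_)).1 (h.congr_fun fun n => ?_)
  · rw [if_neg, mul_zero, zero_mul]
    rintro ⟨b, rfl⟩
    exact hn ⟨b, rfl⟩
  · rw [Function.comp_apply, if_pos (dvd_mul_right _ _), Nat.mul_div_cancel_left _ ha0]
    push_cast
    rw [mul_assoc _ (sigma (k - 1) n : ℂ), mul_comm (a : ℂ) (n : ℂ), mul_assoc (n : ℂ)]

/-- The constant term of a modular form of level `N` whose higher coefficients are those of the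
Eisenstein series. -/
theorem constantTerm_eq {k N : ℕ} (hk : 0 < k) (hk2 : Even k) (hN : 0 < N) {f : ℂ → ℂ} {C A : ℂ}
    (hf : ∀ τ : ℂ, 0 < τ.im → f τ = C + A * ∑' n : ℕ,
      (∑ d ∈ n.divisors with d.Coprime N, (d : ℂ) ^ (k - 1)) * e (n * τ))
    (hmod : ∀ τ : ℂ, 0 < τ.im → f (τ / (N * τ + 1)) = (N * τ + 1) ^ k * f τ) :
    C = A * (-((bernoulli k : ℚ) : ℂ) / (2 * (k : ℂ)) *
      ∏ p ∈ N.primeFactors, (1 - (p : ℂ) ^ (k - 1))) := by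
  obtain ⟨κ, hκ⟩ := exists_eisensteinG_transform hk hk2
  set P : ℂ := ∏ p ∈ N.primeFactors, (1 - (p : ℂ) ^ (k - 1))
  set G : ℂ → ℂ := fun τ =>
    ∑ a ∈ (radical N).divisors, (ArithmeticFunction.moebius a : ℂ) * (a : ℂ) ^ (k - 1) * eisensteinG k (a * τ) with hG
  set B : ℂ := ((bernoulli k : ℚ) : ℂ) / (2 * (k : ℂ)) with hB
  set C' : ℂ := C + A * (B * P) with hC'
  have hf' : ∀ τ : ℂ, 0 < τ.im → f τ = C' + A * G τ := by
    intro τ hτ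
    rw [hf τ hτ, (hasSum_levelN hk hN hτ).tsum_eq]
    ring
  -- The total quasimodular defect; its value is never needed. With $N=ab$, the point
  -- $a\tau/(N\tau+1)$ is $\tau'/(b\tau'+1)$ for $\tau'=a\tau$.
  set κ' : ℂ := ∑ a ∈ (radical N).divisors, (ArithmeticFunction.moebius a : ℂ) * (a : ℂ) ^ (k - 1) *
    (κ * ((N / a : ℕ) : ℂ)) with hκ'
  have hGmod : ∀ τ : ℂ, 0 < τ.im → G (τ / (N * τ + 1)) =
      (N * τ + 1) ^ k * G τ + κ' * (N * τ + 1) := by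
    intro τ hτ
    simp only [hG, hκ']
    rw [Finset.mul_sum, Finset.sum_mul, ← Finset.sum_add_distrib]
    refine Finset.sum_congr rfl fun a ha => ?_
    have ha0 : 0 < a := Nat.pos_of_mem_divisors ha
    have him : 0 < ((a : ℂ) * τ).im := by
      rw [← Complex.ofReal_natCast, Complex.im_ofReal_mul]
      have : (0 : ℝ) < a := by exact_mod_cast ha0
      positivity
    obtain ⟨b, hb⟩ : a ∣ N := (Nat.dvd_of_mem_divisors ha).trans radical_dvd_self
    have h := hκ b (a * τ) him
    have hbN : (((b : ℕ) : ℤ) : ℂ) * (a * τ) + 1 = N * τ + 1 := by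
      rw [hb]; push_cast; ring
    rw [hbN] at h
    have hdiv : N / a = b := by rw [hb, Nat.mul_div_cancel_left _ ha0]
    rw [hdiv, ← mul_div_assoc, h]
    push_cast
    ring
  have key : ∀ τ : ℂ, 0 < τ.im → C' + A * κ' * (N * τ + 1) = (N * τ + 1) ^ k * C' := by
    intro τ hτ
    have h1 := hmod τ hτ
    have him : 0 < (τ / (N * τ + 1)).im := by
      have := (mobius_im_pos (a := 1) (b := 0) (c := N) (d := 1) (by norm_num) hτ).2
      simpa using this
    rw [hf' _ him, hf' _ hτ, hGmod τ hτ] at h1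
    linear_combination h1
  have hNC : (N : ℂ) ≠ 0 := by exact_mod_cast hN.ne'
  -- Choosing $\tau=(si-1)/N$ makes $N\tau+1=si$.
  have key2 : ∀ s : ℝ, 0 < s → C' + A * κ' * (s * Complex.I) = (s * Complex.I) ^ k * C' := by
    intro s hs
    have hNR : (0 : ℝ) < N := by exact_mod_cast hN
    have h := key ((s * Complex.I - 1) / N) (by
      rw [← Complex.ofReal_natCast, Complex.div_ofReal_im]
      simp
      positivity)
    rw [mul_div_cancel₀ _ hNC, sub_add_cancel] at h
    exact h
  have hC0 : C' = 0 := by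
    have h1 := key2 1 one_pos
    have h2 := key2 2 two_pos
    push_cast at h1 h2
    rw [mul_pow] at h1 h2
    have hI : Complex.I ^ k = 1 ∨ Complex.I ^ k = -1 := by
      obtain ⟨n, rfl⟩ := hk2
      rw [← two_mul, pow_mul, Complex.I_sq]
      exact neg_one_pow_eq_or ℂ n
    -- Twice the relation at $s=1$ minus that at $s=2$ eliminates `κ'`. The other factor is nonzero,
    -- since $i^k=\pm1$ and $2^k$ is neither $1$ nor $3$.
    have h3 : C' * ((2 ^ k - 2) * Complex.I ^ k + 1) = 0 := by
      linear_combination 2 * h1 - h2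
    have hk4 : 4 ≤ 2 ^ k := by
      obtain ⟨n, rfl⟩ := hk2
      calc 4 = 2 ^ 2 := by norm_num
        _ ≤ 2 ^ (n + n) := Nat.pow_le_pow_right (by norm_num) (by omega)
    rcases mul_eq_zero.1 h3 with h | h
    · exact h
    · exfalso
      rcases hI with h4 | h4 <;> rw [h4] at h
      · have : (2 : ℂ) ^ k = 1 := by linear_combination h
        have : 2 ^ k = 1 := by exact_mod_cast this
        omega
      · have : (2 : ℂ) ^ k = 3 := by linear_combination -h
        have : 2 ^ k = 3 := by exact_mod_cast this
        omega
  rw [neg_div, ← hB]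
  linear_combination hC0

end LevelN

/-! ### The zeroth Fourier–Jacobi coefficient and $V_0$. -/

section ConstantTerm

variable {K : Type*} [Field K] [NumberField K]

theorem dualEntry_zero_zero : dualEntry K 0 0 = 0 := by simp [dualEntry]

theorem eq_zero_of_dualEntry_eq_zero {p q : ℤ} (h : dualEntry K p q = 0) : p = 0 ∧ q = 0 := by
  have h1 := dualEntry_add_conj (K := K) p q
  have h2 := dualEntry_mul_add_conj (K := K) p q
  rw [h] at h1 h2
  simp only [map_zero, zero_mul, add_zero] at h1 h2
  exact ⟨by exact_mod_cast h1.symm, by exact_mod_cast h2.symm⟩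

variable [NumberField.IsTotallyComplex K] (hK : Module.finrank ℚ K = 2) {σ : K →+* ℂ}
  {k N : ℕ} {F : Matrix (Fin 2) (Fin 2) ℂ → ℂ}

include hK

/-- All determinants involved vanish, so only $\alpha_F^*(0)$ occurs; the matrix with $m=1$,
$\ell=t=0$ has content $1$ and its coefficient is that value. -/
theorem IsMaassForm.fourierCoeff_dualVec_zero (hF : IsMaassForm σ k N F) {l : ℕ} (hl : 0 < l) :
    fourierCoeff K F (dualMat K (dualVec 0 (l, 0, 0))) =
      (∑ d ∈ l.divisors with d.Coprime N, (d : ℂ) ^ (k - 1)) *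
        fourierCoeff K F (dualMat K (dualVec 1 (0, 0, 0))) := by
  obtain ⟨α, hα⟩ := hF.maass
  have h1 := maass_relation_dualVec hK hα one_pos (y := (0, 0, 0))
    (posSemidef_dualVec_iff.2 (by simp [dualEntry_zero_zero]))
  simp only [det_dualVec_re] at h1
  simp [dualEntry_zero_zero, TripleDvd, Finset.filter_singleton] at h1
  have hne : dualVec 0 ((l : ℤ), 0, 0) ≠ 0 := by
    intro h
    have := congrFun h 0
    simp [dualVec] at this
    omega
  rw [h1, hα _ ((mem_dualLattice_iff hK σ).2 ⟨_, rfl⟩)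
    (posSemidef_dualVec_iff.2 (by simp [dualEntry_zero_zero])) (dualMat_ne_zero hne),
    Finset.sum_mul, det_dualVec_re]
  refine Finset.sum_congr ?_ fun d _ => by simp [dualEntry_zero_zero]
  ext d
  simp only [Finset.mem_filter, mem_divisors_content_iff hK hne, Nat.mem_divisors]
  refine and_congr_left fun _ => ⟨fun h => ⟨Int.natCast_dvd_natCast.1 (h 0), hl.ne'⟩, fun h i => ?_⟩
  have h0 : (d : ℤ) ∣ l := by exact_mod_cast h.1
  fin_cases i <;> simp [dualVec, h0]

theorem IsMaassForm.fourierJacobiCoeff_zero (hF : IsMaassForm σ k N F) {τ z w : ℂ}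
    (hτ : 0 < τ.im) :
    fourierJacobiCoeff σ F 0 τ z w = fourierCoeff K F (dualMat K (dualVec 0 (0, 0, 0))) +
      fourierCoeff K F (dualMat K (dualVec 1 (0, 0, 0))) *
        ∑' n : ℕ, (∑ d ∈ n.divisors with d.Coprime N, (d : ℂ) ^ (k - 1)) * e (n * τ) := by
  have h := hF.modularForm.hasSum_jacobi hK 0 (z := z) (w := w) hτ
  have hg : Function.Injective fun n : ℕ => (((n : ℤ), 0, 0) : ℤ × ℤ × ℤ) := by
    intro n m h
    simpa using h
  rw [← hg.hasSum_iff (fun x hx => ?_)] at h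
  · have h1 : HasSum (fun n : ℕ => fourierCoeff K F (dualMat K (dualVec 0 ((n : ℤ), 0, 0))) *
        e (n * τ)) (fourierJacobiCoeff σ F 0 τ z w) := by
      refine h.congr_fun fun n => ?_
      simp [jacobiExp, dualEntry_zero_zero]
    set A := fourierCoeff K F (dualMat K (dualVec 1 (0, 0, 0)))
    set c : ℕ → ℂ := fun n => fourierCoeff K F (dualMat K (dualVec 0 ((n : ℤ), 0, 0)))
    set s : ℕ → ℂ := fun n => ∑ d ∈ n.divisors with d.Coprime N, (d : ℂ) ^ (k - 1) with hs
    have hc : ∀ n : ℕ, c (n + 1) = s (n + 1) * A :=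
      fun n => hF.fourierCoeff_dualVec_zero hK n.succ_pos
    have hs0 : s 0 = 0 := by simp [hs]
    change _ = c 0 + A * ∑' n : ℕ, s n * e (n * τ)
    have h2 : HasSum (fun n : ℕ => A * (s n * e (n * τ))) (fourierJacobiCoeff σ F 0 τ z w - c 0) := by
      -- The term $n=0$ is removed from both series: $C_F(0)$ is not covered by the Maass relation,
      -- and the divisor sum of $0$ is empty.
      rw [← hasSum_nat_add_iff' 1] at h1 ⊢
      simp only [Finset.sum_range_one, Nat.cast_zero, zero_mul, e_zero, mul_one, hs0, mul_zero,
        sub_zero] at h1 ⊢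
      refine h1.congr_fun fun n => ?_
      have h3 : fourierCoeff K F (dualMat K (dualVec 0 (((n + 1 : ℕ) : ℤ), 0, 0))) =
          s (n + 1) * A := hc n
      rw [h3]
      ring
    rw [← tsum_mul_left, h2.tsum_eq]
    ring
  -- With $m=0$, semidefiniteness gives $|t|^2\le0$ and $\ell\ge0$, so only the indices $(\ell,0)$
  -- contribute.
  · by_contra hne
    have hps : (dualMat K (dualVec (0 : ℕ) x)).PosSemidef := by
      by_contra h
      exact hne (by rw [fourierCoeff_eq_zero_of_not_posSemidef hK hF.modularForm _ h, zero_mul])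
    rw [posSemidef_dualVec_iff] at hps
    obtain ⟨h0, -, h2⟩ := hps
    have h3 : dualEntry K x.2.1 x.2.2 = 0 := by
      rw [← Complex.normSq_eq_zero]
      exact le_antisymm (by simpa using h2) (Complex.normSq_nonneg _)
    obtain ⟨hp, hq⟩ := eq_zero_of_dualEntry_eq_zero h3
    have h0' : 0 ≤ x.1 := by exact_mod_cast h0
    exact hx ⟨x.1.toNat, Prod.ext (Int.toNat_of_nonneg h0') (Prod.ext hp.symm hq.symm)⟩

theorem IsHermitianModularForm.jacobiConstCoeff_fourierJacobiCoeff
    (hF : IsHermitianModularForm σ k N F) (m : ℕ) :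
    jacobiConstCoeff K (fourierJacobiCoeff σ F m) =
      fourierCoeff K F (dualMat K (dualVec m (0, 0, 0))) := by
  rw [jacobiConstCoeff]
  have hexp : ∀ (x a b : ℝ) (y : ℤ × ℤ × ℤ),
      jacobiExp K y (x + Complex.I) (a + b * omega K) (a + b * (starRingEnd ℂ) (omega K)) =
        jacobiExp K y Complex.I 0 0 * e (y.1 * (x : ℂ)) * e (y.2.1 * (a : ℂ)) *
          e (y.2.2 * (b : ℂ)) := by
    intro x a b y
    rw [jacobiExp, jacobiExp, ← e_add, ← e_add, ← e_add]
    congr 1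
    linear_combination (a : ℂ) * dualEntry_add_conj (K := K) y.2.1 y.2.2 +
      b * dualEntry_mul_add_conj (K := K) y.2.1 y.2.2
  simp_rw [hF.fourierJacobiCoeff_eq_tsum hK, hexp, ← mul_assoc]
  rw [integral_tsum_e_three (hF.summable_jacobi hK m (by simp)), tsum_eq_single (0, 0, 0)]
  · simp [jacobiExp, dualEntry_zero_zero, e_zero]
  · rintro ⟨l, p, q⟩ hne
    split_ifs with h1 h2 h3
    · exact absurd (by simp_all) hne
    all_goals rfl

/-- The zeroth Fourier–Jacobi coefficient of a Maass form is the image of the first one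
under `V₀`. -/
theorem IsMaassForm.fourierJacobiCoeff_zero_eq_V0 (hk : 0 < k) (hk2 : Even k) (hN : 0 < N)
    (hF : IsMaassForm σ k N F) {τ z w : ℂ} (hτ : 0 < τ.im) :
    fourierJacobiCoeff σ F 0 τ z w = V0 K k N (fourierJacobiCoeff σ F 1) τ z w := by
  -- The constant term does not involve $z$ and $w$, so it can be read off at $z=w=0$.
  have hC := constantTerm_eq hk hk2 hN (f := fun τ => fourierJacobiCoeff σ F 0 τ 0 0)
    (fun τ hτ => hF.fourierJacobiCoeff_zero hK hτ) (fun τ hτ => by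
      have h := hF.modularForm.fourierJacobiCoeff_modular hK (a := 1) (b := 0) (c := N) (d := 1)
        (by norm_num) dvd_rfl 0 (z := 0) (w := 0) hτ
      simpa [e_zero] using h)
  rw [hF.fourierJacobiCoeff_zero hK hτ, hC, V0,
    hF.modularForm.jacobiConstCoeff_fourierJacobiCoeff hK, Nat.cast_one, mul_add]
  congr 2
  rw [← PNat.coe_injective.tsum_eq]
  intro n hn
  rw [Function.mem_support] at hn
  have : n ≠ 0 := by rintro rfl; simp at hn
  exact ⟨⟨n, Nat.pos_of_ne_zero this⟩, rfl⟩

end ConstantTerm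

/-! ### Determination of $F$ by $\varphi_1$. -/

section Determined

variable {K : Type*} [Field K] [NumberField K]

theorem jacobiConstCoeff_congr {φ ψ : ℂ → ℂ → ℂ → ℂ}
    (h : ∀ τ z w : ℂ, 0 < τ.im → φ τ z w = ψ τ z w) :
    jacobiConstCoeff K φ = jacobiConstCoeff K ψ := by
  have h1 : ∀ (x : ℝ) (z w : ℂ), φ (x + Complex.I) z w = ψ (x + Complex.I) z w :=
    fun x z w => h _ _ _ (by simp)
  simp_rw [jacobiConstCoeff, h1]

/-- Matrices of positive determinant preserve the upper half plane, so only values over it enter. -/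
theorem V_congr {k t N m : ℕ} (hm : 0 < m) {φ ψ : ℂ → ℂ → ℂ → ℂ}
    (h : ∀ τ z w : ℂ, 0 < τ.im → φ τ z w = ψ τ z w) {τ z w : ℂ} (hτ : 0 < τ.im) :
    V k t N m φ τ z w = V k t N m ψ τ z w := by
  rw [V, V]
  congr 2
  ext q
  have hdet := q.out.2.2.1
  rw [Matrix.det_fin_two] at hdet
  simp only [jacobiSlash, Matrix.map_apply, Complex.ofReal_intCast]
  rw [h _ _ _ (mobius_im_pos (by rw [hdet]; exact_mod_cast hm) hτ).2]

variable [NumberField.IsTotallyComplex K] (hK : Module.finrank ℚ K = 2) {σ : K →+* ℂ}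
  {k N : ℕ} {F G : Matrix (Fin 2) (Fin 2) ℂ → ℂ}

include hK

/-- A Maass form is determined by its first Fourier–Jacobi coefficient. -/
theorem IsMaassForm.eqOn_of_fourierJacobiCoeff_one (hk : 0 < k) (hk2 : Even k) (hN : 0 < N)
    (hF : IsMaassForm σ k N F) (hG : IsMaassForm σ k N G)
    (h : ∀ τ z w : ℂ, 0 < τ.im → fourierJacobiCoeff σ F 1 τ z w = fourierJacobiCoeff σ G 1 τ z w) :
    EqOn F G upperHalfSpace := by
  have key : ∀ (m : ℕ) (τ z w : ℂ), 0 < τ.im →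
      fourierJacobiCoeff σ F m τ z w = fourierJacobiCoeff σ G m τ z w := by
    intro m τ z w hτ
    rcases m.eq_zero_or_pos with rfl | hm
    · rw [hF.fourierJacobiCoeff_zero_eq_V0 hK hk hk2 hN hτ,
        hG.fourierJacobiCoeff_zero_eq_V0 hK hk hk2 hN hτ, V0, V0, jacobiConstCoeff_congr h]
    · have hs : (Real.sqrt m : ℂ) ≠ 0 := by
        rw [Complex.ofReal_ne_zero, Real.sqrt_ne_zero']
        exact_mod_cast hm
      rw [← mul_div_cancel_left₀ z hs, ← mul_div_cancel_left₀ w hs,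
        hF.fourierJacobiCoeff_eq_V hK hk hm hτ, hG.fourierJacobiCoeff_eq_V hK hk hm hτ,
        V_congr hm h hτ]
  intro Z hZ
  rw [Matrix.eta_fin_two Z] at hZ ⊢
  have hτ := (mem_upperHalfSpace_iff.1 hZ).1
  have h1 := hF.modularForm.hasSum_fourierJacobi hK hZ
  simp_rw [key _ _ _ _ hτ] at h1
  exact h1.unique (hG.modularForm.hasSum_fourierJacobi hK hZ)

end Determined

end HermitianMaass

end

open HermitianMaass
theorem mainTheorem8 {K : Type*} [Field K] [NumberField K] [NumberField.IsTotallyComplex K]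
    (hK : Module.finrank ℚ K = 2) (hcl : NumberField.classNumber K = 1) (σ : K →+* ℂ)
    (k N : ℕ) (hk : 0 < k) (hkO : Nat.card (𝓞 K)ˣ ∣ k) (hN : 0 < N) :
    (∀ F : Matrix (Fin 2) (Fin 2) ℂ → ℂ, IsMaassForm σ k N F →
      (∀ τ z w τ' : ℂ, !![τ, z; w, τ'] ∈ upperHalfSpace →
        HasSum (fun m : ℕ => fourierJacobiCoeff σ F m τ z w * e ((m : ℂ) * τ'))
          (F !![τ, z; w, τ'])) ∧
      (∀ m : ℕ, 0 < m → ∀ τ z w : ℂ, 0 < τ.im →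
        fourierJacobiCoeff σ F m τ (z / (Real.sqrt m : ℂ)) (w / (Real.sqrt m : ℂ)) =
          V k 1 N m (fourierJacobiCoeff σ F 1) τ z w) ∧
      (∀ τ z w : ℂ, 0 < τ.im →
        fourierJacobiCoeff σ F 0 τ z w = V0 K k N (fourierJacobiCoeff σ F 1) τ z w)) ∧
    (∀ F G : Matrix (Fin 2) (Fin 2) ℂ → ℂ, IsMaassForm σ k N F → IsMaassForm σ k N G →
      (∀ τ z w : ℂ, 0 < τ.im →
        fourierJacobiCoeff σ F 1 τ z w = fourierJacobiCoeff σ G 1 τ z w) →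
      Set.EqOn F G upperHalfSpace) := by
  have hk2 : Even k := even_of_card_units_dvd hkO hk
  refine ⟨fun F hF => ⟨fun τ z w τ' hZ => hF.modularForm.hasSum_fourierJacobi hK hZ,
    fun m hm τ z w hτ => hF.fourierJacobiCoeff_eq_V hK hk hm hτ,
    fun τ z w hτ => hF.fourierJacobiCoeff_zero_eq_V0 hK hk hk2 hN hτ⟩,
    fun F G hF hG h => hF.eqOn_of_fourierJacobiCoeff_one hK hk hk2 hN hG h⟩
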